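/- Theorem. Let $f:\mathbb{R}^d\to\mathbb{R}$ be strongly convex with constant $\mu>0$, i.e. $f(t\theta_1+(1-t)\theta_2)\le t f(\theta_1)+(1-t)f(\theta_2)-\frac{\mu}{2}t(1-t)\|\theta_1-\theta_2\|^2$ for all $\theta_1,\theta_2$ and $t\in[0,1]$, with minimizer $\theta^*$. Assume that $f$ is five times continuously differentiable, that its derivatives of orders $2,\dots,5$ are bounded on $\mathbb{R}^d$, and that its gradient $f'$ is $L$-Lipschitz, $L\ge 0$. Let $(\varepsilon_k)_{k\ge1}$ be independent, identically distributed random fields $\mathbb{R}^d\to\mathbb{R}^d$ on a probability space such that, for some filtration $(\mathcal{F}_k)_{k\ge0}$, all $k\ge0$ and all $\theta\in\mathbb{R}^d$, $\varepsilon_{k+1}(\theta)$ is integrable and $\mathcal{F}_{k+1}$-measurable and $\mathbb{E}[\varepsilon_{k+1}(\theta)\mid\mathcal{F}_k]=0$. Put $f'_k=f'+\varepsilon_k$ and let $k_\varepsilon\ge0$. Assume that, for every $k\ge1$, almost surely $L\langle f'_k(\theta)-f'_k(\eta),\theta-\eta\rangle\ge\|f'_k(\theta)-f'_k(\eta)\|^2$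 for all $\theta,\eta\in\mathbb{R}^d$, and that $\sup_{k\ge1}\mathbb{E}[\|\varepsilon_k(\theta^*)\|^p]<\infty$ with $p=\max\{6,2(k_\varepsilon+1)\}$. Assume finally that the noise covariance $\mathcal{C}(\theta)=\mathbb{E}[\varepsilon_1(\theta)\varepsilon_1(\theta)^\top]$ is three times continuously differentiable in $\theta$ and that, for some $M_\varepsilon\ge0$, $\|\mathcal{C}^{(i)}(\theta)\|\le M_\varepsilon(1+\|\theta-\theta^*\|^{k_\varepsilon})$ for all $\theta$ and $i\in\{1,2,3\}$. For $\gamma>0$ let $R_\gamma$ be the Markov kernel of the recursion $\theta_{k+1}=\theta_k-\gamma[f'(\theta_k)+\varepsilon_{k+1}(\theta_k)]$, that is, $R_\gamma(\theta,\cdot)$ is the law of $\theta-\gamma[f'(\theta)+\varepsilon_1(\theta)]$. For matrices $M,N\in\mathbb{R}^{d\times d}$ let $M\otimes N$ be the endomorphism $X\mapsto MXN$ of $\mathbb{R}^{d\times d}$, and let $f'''(\theta)M$ be the vector with coordinates $(f'''(\theta)M)_l=\sum_{i,j}M_{ij}\,\partial_i\partial_j\partial_l f(\theta)$. Then the Hessian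 matrix $f''(\theta^*)$ and the operator $f''(\theta^*)\otimes I+I\otimes f''(\theta^*)$ are invertible; write $\mathbf{A}=(f''(\theta^*)\otimes I+I\otimes f''(\theta^*))^{-1}$. For every $\gamma>0$ with $\gamma L<2$ the kernel $R_\gamma$ has a unique invariant probability measure $\pi_\gamma$, which has a finite second moment. With $\bar\theta_\gamma=\int\theta\,\pi_\gamma(d\theta)$, as $\gamma\downarrow0$, $$\bar\theta_\gamma-\theta^*=-\frac{\gamma}{2}\,f''(\theta^*)^{-1}f'''(\theta^*)\,\mathbf{A}\,\mathcal{C}(\theta^*)+O(\gamma^2),$$ $$\int(\theta-\theta^*)(\theta-\theta^*)^\top\,\pi_\gamma(d\theta)=\gamma\,\mathbf{A}\,\mathcal{C}(\theta^*)+O(\gamma^2).$$ -/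

import Mathlib

open MeasureTheory ProbabilityTheory Filter Topology Asymptotics
open scoped Matrix Gradient Matrix.Norms.Frobenius

namespace SGD

/-- Smoothness of the objective: `f` is five times continuously
differentiable, its derivatives of orders `2, …, 5` are bounded, and `f'` is `L`-Lipschitz. -/
structure SmoothObjective {d : ℕ} (f : EuclideanSpace ℝ (Fin d) → ℝ) (L : ℝ) : Prop where
  contDiff : ContDiff ℝ 5 f
  bounded : ∀ k ∈ Finset.Icc 2 5, ∃ B : ℝ, ∀ θ, ‖iteratedFDeriv ℝ k f θ‖ ≤ B
  nonneg : 0 ≤ L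
  lipschitz : ∀ θ η, ‖∇ f θ - ∇ f η‖ ≤ L * ‖θ - η‖

/-- The random fields `ε 1, ε 2, …` (the entry `ε 0` is not used) are adapted to a filtration, have
zero conditional mean given the past at every point, and are independent and identically
distributed as random elements of the space of functions with its product σ-algebra. -/
structure GradientNoise {Ω : Type*} [mΩ : MeasurableSpace Ω] {d : ℕ} (P : Measure Ω)
    (ε : ℕ → Ω → EuclideanSpace ℝ (Fin d) → EuclideanSpace ℝ (Fin d)) : Prop where
  martingaleDifference : ∃ ℱ : Filtration ℕ mΩ, ∀ (k : ℕ) (θ : EuclideanSpace ℝ (Fin d)),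
    Measurable[ℱ (k + 1)] (fun ω => ε (k + 1) ω θ) ∧
    Integrable (fun ω => ε (k + 1) ω θ) P ∧
    P[fun ω => ε (k + 1) ω θ | ℱ k] =ᵐ[P] 0
  indep : iIndepFun (fun k : ℕ => ε (k + 1)) P
  identDistrib : ∀ k : ℕ, IdentDistrib (ε (k + 1)) (ε 1) P P

/-- The noisy gradients `f' + ε k`, `k ≥ 1`, are almost surely `L`-co-coercive, and the noise at
`θs` has a moment of order `p`, bounded uniformly in `k ≥ 1`. -/
structure CocoerciveNoise {Ω : Type*} [MeasurableSpace Ω] {d : ℕ} (P : Measure Ω)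
    (f : EuclideanSpace ℝ (Fin d) → ℝ)
    (ε : ℕ → Ω → EuclideanSpace ℝ (Fin d) → EuclideanSpace ℝ (Fin d))
    (L : ℝ) (θs : EuclideanSpace ℝ (Fin d)) (p : ℝ) : Prop where
  cocoercive : ∀ k : ℕ, ∀ᵐ ω ∂P, ∀ θ η : EuclideanSpace ℝ (Fin d),
    ‖(∇ f θ + ε (k + 1) ω θ) - (∇ f η + ε (k + 1) ω η)‖ ^ 2 ≤
      L * inner ℝ ((∇ f θ + ε (k + 1) ω θ) - (∇ f η + ε (k + 1) ω η)) (θ - η)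
  moment : ∃ τ : ℝ, 0 ≤ τ ∧ ∀ k : ℕ,
    eLpNorm (fun ω => ε (k + 1) ω θs) (ENNReal.ofReal p) P ≤ ENNReal.ofReal τ

/-- The noise covariance `𝒞(θ) = 𝔼[ε₁(θ)^{⊗2}]`, as a matrix. -/
noncomputable def noiseCov {Ω : Type*} [MeasurableSpace Ω] {d : ℕ} (P : Measure Ω)
    (ε : ℕ → Ω → EuclideanSpace ℝ (Fin d) → EuclideanSpace ℝ (Fin d))
    (θ : EuclideanSpace ℝ (Fin d)) : Matrix (Fin d) (Fin d) ℝ :=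
  Matrix.of fun i j => ∫ ω, ε 1 ω θ i * ε 1 ω θ j ∂P

/-- A matrix-valued function is three times continuously differentiable and its derivatives of
orders `1, 2, 3` are bounded by `M (1 + ‖θ - θs‖ ^ κ)`. The norm on matrices is Frobenius. -/
structure SmoothCov {d : ℕ} (C : EuclideanSpace ℝ (Fin d) → Matrix (Fin d) (Fin d) ℝ)
    (θs : EuclideanSpace ℝ (Fin d)) (κ : ℝ) : Prop where
  contDiff : ContDiff ℝ 3 C
  growth : ∃ M : ℝ, 0 ≤ M ∧ ∀ i ∈ Finset.Icc 1 3, ∀ θ,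
    ‖iteratedFDeriv ℝ i C θ‖ ≤ M * (1 + ‖θ - θs‖ ^ κ)

/-- The Markov kernel `R_γ` of the recursion: `R_γ(θ, ·)` is the law of
`θ - γ (f'(θ) + ε₁(θ))`. -/
noncomputable def kernel {Ω : Type*} [MeasurableSpace Ω] {d : ℕ} (P : Measure Ω)
    (f : EuclideanSpace ℝ (Fin d) → ℝ)
    (ε : ℕ → Ω → EuclideanSpace ℝ (Fin d) → EuclideanSpace ℝ (Fin d))
    (γ : ℝ) (θ : EuclideanSpace ℝ (Fin d)) : Measure (EuclideanSpace ℝ (Fin d)) :=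
  P.map fun ω => θ - γ • (∇ f θ + ε 1 ω θ)

/-- `ν` is an invariant probability measure of a transition kernel `R`: `ν R = ν`. -/
def IsInvariantProb {d : ℕ}
    (R : EuclideanSpace ℝ (Fin d) → Measure (EuclideanSpace ℝ (Fin d)))
    (ν : Measure (EuclideanSpace ℝ (Fin d))) : Prop :=
  IsProbabilityMeasure ν ∧ ∀ A, MeasurableSet A → ∫⁻ θ, R θ A ∂ν = ν A

/-- The Hessian matrix `f''(θ)`. -/
noncomputable def hessian {d : ℕ} (f : EuclideanSpace ℝ (Fin d) → ℝ)
    (θ : EuclideanSpace ℝ (Fin d)) : Matrix (Fin d) (Fin d) ℝ :=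
  Matrix.of fun i j => iteratedFDeriv ℝ 2 f θ
    ![EuclideanSpace.single i 1, EuclideanSpace.single j 1]

/-- The vector `f'''(θ) M`, with coordinates `∑ i j, M i j * ∂³f/∂θᵢ∂θⱼ∂θₗ (θ)`. -/
noncomputable def thirdApply {d : ℕ} (f : EuclideanSpace ℝ (Fin d) → ℝ)
    (θ : EuclideanSpace ℝ (Fin d)) (M : Matrix (Fin d) (Fin d) ℝ) : Fin d → ℝ :=
  fun l => ∑ i, ∑ j, M i j * iteratedFDeriv ℝ 3 f θ
    ![EuclideanSpace.single i 1, EuclideanSpace.single j 1, EuclideanSpace.single l 1]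

/-- For square matrices, `M ⊗ N` is the endomorphism `X ↦ M X N` of the space of matrices. -/
def tensor {d : ℕ} (M N : Matrix (Fin d) (Fin d) ℝ) :
    Module.End ℝ (Matrix (Fin d) (Fin d) ℝ) :=
  LinearMap.mulLeftRight ℝ (M, N)

/-- The operator `H ⊗ I + I ⊗ H` on matrices. -/
def lyapunov {d : ℕ} (H : Matrix (Fin d) (Fin d) ℝ) :
    Module.End ℝ (Matrix (Fin d) (Fin d) ℝ) :=
  tensor H 1 + tensor 1 H

/-- The second moment `∫ (θ - θs)^{⊗2} ν(dθ)`, as a matrix. -/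
noncomputable def secondMoment {d : ℕ} (ν : Measure (EuclideanSpace ℝ (Fin d)))
    (θs : EuclideanSpace ℝ (Fin d)) : Matrix (Fin d) (Fin d) ℝ :=
  Matrix.of fun i j => ∫ θ, (θ - θs) i * (θ - θs) j ∂ν

end SGD

/-! Co-coercivity of the noisy gradient and strong monotonicity of its mean make two copies of the
recursion, driven by the same noise, approach each other in mean square when `γ * L < 2`
(`exists_contraction`). Hence one step shrinks the Lipschitz constant of a test function by a factor
below one, and a quadratic drift condition holds. The contraction gives uniqueness
(`invariant_unique`); with tightness of the iterated laws it also gives existence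
(`exists_invariant`).

The asymptotics need moments that are uniform in the step size. The variable `1 + ‖θ - θs‖ ^ 2 / γ`
is of order one at stationarity: each of its relevant powers satisfies a drift inequality whose
contraction rate and constant are both proportional to `γ`, so their quotient does not depend on `γ`
(`exists_moment_bound`). Thus the moment of order `2k` of `θ - θs` is `O(γ ^ k)`.

The expansions come from stationarity tested on monomials in `θ - θs` (`hasMean_drift`,
`stationary_one`, `stationary_two`, `stationary_three`). Let `H` be the Hessian at the minimizer,
`T` the third derivative and `C` the covariance there. Degree one says that the gradient has mean
zero, and its first-order Taylor expansion gives a bias `O(γ)`. Absolute moments would bound the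
third moments only by `γ ^ (3/2)`. The degree three identity does better: `H`, acting on all three
indices, sends the third moment tensor to `γ` times a linear function of the bias, up to `O(γ ^ 2)`;
as this operator is injective, the third moments are `O(γ ^ 2)` (`isBigO_third_moment`). With this,
degree two becomes the Lyapunov equation `H M + M H = γ C + O(γ ^ 2)` for the second moment `M`
(`isBigO_second_moment`), and the mean gradient expanded to third order becomes `H m + T M / 2 = O(γ
^ 2)` for the bias `m` (`isBigO_mean_expansion`). Coercivity of `H` inverts both equations. -/

set_option linter.unusedSectionVars false

/-! ### One step of the recursion: mean-square contraction, drift, integrability. -/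

namespace SGD

section Recursion

variable {Ω : Type*} [MeasurableSpace Ω] {E : Type*} [NormedAddCommGroup E]
  [InnerProductSpace ℝ E] [FiniteDimensional ℝ E] [MeasurableSpace E] [BorelSpace E]

lemma norm_sub_le_of_cocoercive {u : E → E} {L : ℝ} (hL : 0 ≤ L)
    (hu : ∀ θ η, ‖u θ - u η‖ ^ 2 ≤ L * inner ℝ (u θ - u η) (θ - η)) (θ η : E) :
    ‖u θ - u η‖ ≤ L * ‖θ - η‖ := by
  have h1 := hu θ η
  have h3 := mul_le_mul_of_nonneg_left (real_inner_le_norm (u θ - u η) (θ - η)) hL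
  have h4 := mul_nonneg hL (norm_nonneg (θ - η))
  by_contra! hc
  have h5 : 0 < ‖u θ - u η‖ := h4.trans_lt hc
  nlinarith

/-- A jointly measurable random vector field which is `L`-co-coercive, with a mean field `g` that
is strongly monotone with constant `μ` and vanishes at `θs`. -/
structure CocoerciveField (P : Measure Ω) (G : Ω → E → E) (g : E → E) (L μ : ℝ) (θs : E) :
    Prop where
  measurable : Measurable (Function.uncurry G)
  cocoercive : ∀ ω θ η, ‖G ω θ - G ω η‖ ^ 2 ≤ L * inner ℝ (G ω θ - G ω η) (θ - η)
  nonneg : 0 ≤ L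
  pos : 0 < μ
  mean : ∀ θ, ∫ ω, G ω θ ∂P = g θ
  monotone : ∀ θ η, μ * ‖θ - η‖ ^ 2 ≤ inner ℝ (g θ - g η) (θ - η)
  zero : g θs = 0
  memLp : MemLp (fun ω => G ω θs) 2 P

/-- One step of the recursion driven by the field `G`. -/
def step (G : Ω → E → E) (γ : ℝ) (ω : Ω) (θ : E) : E := θ - γ • G ω θ

/-- The image of the measure `ν` under one step of the recursion. -/
noncomputable def push (P : Measure Ω) (G : Ω → E → E) (γ : ℝ) (ν : Measure E) : Measure E :=
  (ν.prod P).map fun q => step G γ q.2 q.1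

namespace CocoerciveField

variable {P : Measure Ω} [IsProbabilityMeasure P] {G : Ω → E → E} {g : E → E} {L μ : ℝ} {θs : E}

variable (h : CocoerciveField P G g L μ θs)
include h

lemma norm_sub_le (ω : Ω) (θ η : E) : ‖G ω θ - G ω η‖ ≤ L * ‖θ - η‖ :=
  norm_sub_le_of_cocoercive h.nonneg (h.cocoercive ω) θ η

lemma norm_le (ω : Ω) (θ : E) : ‖G ω θ‖ ≤ L * ‖θ - θs‖ + ‖G ω θs‖ := by
  have := h.norm_sub_le ω θ θs
  have h2 := norm_sub_norm_le (G ω θ) (G ω θs)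
  linarith

lemma measurable_field (θ : E) : Measurable fun ω => G ω θ :=
  h.measurable.comp (measurable_id.prodMk measurable_const)

lemma measurable_step (γ : ℝ) : Measurable fun q : E × Ω => step G γ q.2 q.1 :=
  measurable_fst.sub ((h.measurable.comp (measurable_snd.prodMk measurable_fst)).const_smul γ)

lemma measurable_step_right (γ : ℝ) (θ : E) : Measurable fun ω => step G γ ω θ :=
  measurable_const.sub ((h.measurable_field θ).const_smul γ)

lemma memLp_field {p : ENNReal} (hp : MemLp (fun ω => G ω θs) p P) (θ : E) :
    MemLp (fun ω => G ω θ) p P := by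
  have hb : MemLp (fun ω => L * ‖θ - θs‖ + ‖G ω θs‖) p P :=
    (memLp_const (L * ‖θ - θs‖)).add hp.norm
  refine hb.mono (h.measurable_field θ).aestronglyMeasurable (ae_of_all _ fun ω => ?_)
  exact (h.norm_le ω θ).trans (le_abs_self _)

lemma integrable_field (θ : E) : Integrable (fun ω => G ω θ) P :=
  (h.memLp_field h.memLp θ).integrable one_le_two

/-- Expanding the square leaves the term `γ ^ 2 * ‖G ω θ - G ω η‖ ^ 2`, which co-coercivity bounds
by `γ ^ 2 * L` times the same inner product as in the cross term. What remains has a favourable sign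
precisely in the range `γ * L < 2`. -/
lemma norm_step_sub_sq_le (γ : ℝ) (ω : Ω) (θ η : E) :
    ‖step G γ ω θ - step G γ ω η‖ ^ 2 ≤
      ‖θ - η‖ ^ 2 - γ * (2 - γ * L) * inner ℝ (G ω θ - G ω η) (θ - η) := by
  have e : step G γ ω θ - step G γ ω η = (θ - η) - γ • (G ω θ - G ω η) := by
    simp only [step, smul_sub]; abel
  rw [e, norm_sub_sq_real, norm_smul, mul_pow, real_inner_smul_right, real_inner_comm,
    Real.norm_eq_abs, sq_abs]
  nlinarith [mul_le_mul_of_nonneg_left (h.cocoercive ω θ η) (sq_nonneg γ)]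

/-- The contraction factor of the squared distance in one step of the recursion. -/
lemma exists_contraction {γ : ℝ} (hγ : 0 < γ) (hγL : γ * L < 2) :
    ∃ r : ℝ, 0 < r ∧ r < 1 ∧ ∀ θ η,
      Integrable (fun ω => ‖step G γ ω θ - step G γ ω η‖ ^ 2) P ∧
      ∫ ω, ‖step G γ ω θ - step G γ ω η‖ ^ 2 ∂P ≤ r * ‖θ - η‖ ^ 2 := by
  have hc : 0 < γ * (2 - γ * L) * μ := mul_pos (mul_pos hγ (by linarith)) h.pos
  -- The maximum with `1 / 2` only keeps the factor positive: later arguments divide by it and by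
  -- its square root.
  refine ⟨max (1 - γ * (2 - γ * L) * μ) (1 / 2), by positivity,
    max_lt (by linarith) (by norm_num), fun θ η => ?_⟩
  have hi : Integrable (fun ω => ‖step G γ ω θ - step G γ ω η‖ ^ 2) P := by
    refine (MemLp.integrable_norm_pow (p := 2) ?_ two_ne_zero)
    exact ((memLp_const _).sub ((h.memLp_field h.memLp θ).const_smul γ)).sub
      ((memLp_const _).sub ((h.memLp_field h.memLp η).const_smul γ))
  refine ⟨hi, ?_⟩
  have hin : Integrable (fun ω => inner ℝ (G ω θ - G ω η) (θ - η)) P :=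
    ((h.integrable_field θ).sub (h.integrable_field η)).inner_const _
  have hm : ∫ ω, inner ℝ (G ω θ - G ω η) (θ - η) ∂P = inner ℝ (g θ - g η) (θ - η) := by
    rw [← h.mean θ, ← h.mean η, ← integral_sub (h.integrable_field θ) (h.integrable_field η)]
    simp_rw [real_inner_comm (θ - η)]
    exact integral_inner ((h.integrable_field θ).sub (h.integrable_field η)) _
  calc ∫ ω, ‖step G γ ω θ - step G γ ω η‖ ^ 2 ∂P
      ≤ ∫ ω, (‖θ - η‖ ^ 2 - γ * (2 - γ * L) * inner ℝ (G ω θ - G ω η) (θ - η)) ∂P :=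
        integral_mono hi ((integrable_const _).sub (hin.const_mul _))
          fun ω => h.norm_step_sub_sq_le γ ω θ η
    _ = ‖θ - η‖ ^ 2 - γ * (2 - γ * L) * inner ℝ (g θ - g η) (θ - η) := by
        rw [integral_sub (integrable_const _) (hin.const_mul _), integral_const_mul, hm]; simp
    _ ≤ (1 - γ * (2 - γ * L) * μ) * ‖θ - η‖ ^ 2 := by
        nlinarith [mul_le_mul_of_nonneg_left (h.monotone θ η)
          (mul_nonneg hγ.le (by linarith : 0 ≤ 2 - γ * L))]
    _ ≤ _ := mul_le_mul_of_nonneg_right (le_max_left _ _) (by positivity)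

/-- The squared distance to `θs` satisfies a drift condition. -/
lemma exists_drift {γ : ℝ} (hγ : 0 < γ) (hγL : γ * L < 2) :
    ∃ ρ b : ℝ, 0 ≤ ρ ∧ ρ < 1 ∧ 0 ≤ b ∧ ∀ θ,
      Integrable (fun ω => ‖step G γ ω θ - θs‖ ^ 2) P ∧
      ∫ ω, ‖step G γ ω θ - θs‖ ^ 2 ∂P ≤ ρ * ‖θ - θs‖ ^ 2 + b := by
  obtain ⟨r, hr0, hr1, hr⟩ := h.exists_contraction hγ hγL
  -- Young's inequality `(a + b) ^ 2 ≤ (1 + t) * a ^ 2 + (1 + t⁻¹) * b ^ 2` splits off the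
  -- displacement of `θs` itself. This `t` puts `(1 + t) * r` halfway between `r` and `1`.
  set t := (1 - r) / (2 * r) with ht
  have ht0 : 0 < t := div_pos (by linarith) (by linarith)
  have htr : (1 + t) * r = (1 + r) / 2 := by rw [ht]; field_simp; ring
  have hs2 : Integrable (fun ω => ‖step G γ ω θs - θs‖ ^ 2) P :=
    MemLp.integrable_norm_pow (p := 2)
      (((memLp_const _).sub (h.memLp.const_smul γ)).sub (memLp_const _)) two_ne_zero
  refine ⟨(1 + r) / 2, (1 + t⁻¹) * ∫ ω, ‖step G γ ω θs - θs‖ ^ 2 ∂P, by linarith, by linarith,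
    mul_nonneg (by positivity) (integral_nonneg fun ω => by positivity), fun θ => ?_⟩
  have hi : Integrable (fun ω => ‖step G γ ω θ - θs‖ ^ 2) P :=
    MemLp.integrable_norm_pow (p := 2)
      (((memLp_const _).sub ((h.memLp_field h.memLp θ).const_smul γ)).sub (memLp_const _))
      two_ne_zero
  refine ⟨hi, ?_⟩
  calc ∫ ω, ‖step G γ ω θ - θs‖ ^ 2 ∂P
      ≤ ∫ ω, ((1 + t) * ‖step G γ ω θ - step G γ ω θs‖ ^ 2
          + (1 + t⁻¹) * ‖step G γ ω θs - θs‖ ^ 2) ∂P := by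
        refine integral_mono hi (((hr θ θs).1.const_mul _).add (hs2.const_mul _)) fun ω => ?_
        have h1 := norm_sub_le_norm_sub_add_norm_sub (step G γ ω θ) (step G γ ω θs) θs
        set a := ‖step G γ ω θ - step G γ ω θs‖
        set b := ‖step G γ ω θs - θs‖
        have h2 : ‖step G γ ω θ - θs‖ ^ 2 ≤ (a + b) ^ 2 := by gcongr
        have h3 : 0 ≤ t⁻¹ * (t * a - b) ^ 2 := by positivity
        have h4 : t⁻¹ * (t * a - b) ^ 2 = t * a ^ 2 - 2 * (a * b) + t⁻¹ * b ^ 2 := by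
          field_simp; ring
        simp only
        nlinarith
    _ = (1 + t) * ∫ ω, ‖step G γ ω θ - step G γ ω θs‖ ^ 2 ∂P
          + (1 + t⁻¹) * ∫ ω, ‖step G γ ω θs - θs‖ ^ 2 ∂P := by
        rw [integral_add ((hr θ θs).1.const_mul _) (hs2.const_mul _), integral_const_mul,
          integral_const_mul]
    _ ≤ _ := by
        rw [← htr, mul_assoc]
        gcongr
        exact (hr θ θs).2

lemma isProbabilityMeasure_push (γ : ℝ) (ν : Measure E) [IsProbabilityMeasure ν] :
    IsProbabilityMeasure (push P G γ ν) :=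
  Measure.isProbabilityMeasure_map (h.measurable_step γ).aemeasurable

lemma integrable_comp_step {F : Type*} [NormedAddCommGroup F] [SecondCountableTopology F]
    [MeasurableSpace F] [BorelSpace F] {γ : ℝ} {ν : Measure E}
    [IsProbabilityMeasure ν] {φ : E → F} (hm : Measurable φ) (hφ : Integrable φ (push P G γ ν)) :
    Integrable (fun q : E × Ω => φ (step G γ q.2 q.1)) (ν.prod P) :=
  (integrable_map_measure hm.aestronglyMeasurable (h.measurable_step γ).aemeasurable).1 hφ

lemma integral_push {F : Type*} [NormedAddCommGroup F] [NormedSpace ℝ F]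
    [SecondCountableTopology F] [MeasurableSpace F] [BorelSpace F] {γ : ℝ} {ν : Measure E}
    [IsProbabilityMeasure ν] {φ : E → F} (hm : Measurable φ) (hφ : Integrable φ (push P G γ ν)) :
    ∫ θ, φ θ ∂(push P G γ ν) = ∫ θ, ∫ ω, φ (step G γ ω θ) ∂P ∂ν := by
  rw [push, integral_map (h.measurable_step γ).aemeasurable hm.aestronglyMeasurable,
    integral_prod _ (h.integrable_comp_step hm hφ)]

lemma lintegral_push {γ : ℝ} {ν : Measure E} [IsProbabilityMeasure ν] {φ : E → ENNReal}
    (hm : Measurable φ) :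
    ∫⁻ θ, φ θ ∂(push P G γ ν) = ∫⁻ θ, ∫⁻ ω, φ (step G γ ω θ) ∂P ∂ν := by
  rw [push, lintegral_map hm (h.measurable_step γ),
    lintegral_prod (fun q : E × Ω => φ (step G γ q.2 q.1))
      (hm.comp (h.measurable_step γ)).aemeasurable]

/-- A Lyapunov function is integrable for every invariant probability measure. -/
lemma integral_le_of_drift {γ : ℝ} {ν : Measure E} [IsProbabilityMeasure ν]
    (hν : push P G γ ν = ν) {W : E → ℝ} (hW : Measurable W) (hW0 : ∀ θ, 0 ≤ W θ) {ρ b : ℝ}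
    (hρ0 : 0 ≤ ρ) (hρ : ρ < 1) (hb : 0 ≤ b)
    (hd : ∀ θ, Integrable (fun ω => W (step G γ ω θ)) P ∧
      ∫ ω, W (step G γ ω θ) ∂P ≤ ρ * W θ + b) :
    Integrable W ν ∧ ∫ θ, W θ ∂ν ≤ b / (1 - ρ) := by
  have hρ' : 0 < 1 - ρ := by linarith
  have hB : 0 ≤ b / (1 - ρ) := div_nonneg hb hρ'.le
  have bdd : ∀ (κ : Measure E) [IsProbabilityMeasure κ] (N : ℝ) (hN : 0 ≤ N) (φ : E → ℝ),
      Measurable φ → (∀ θ, 0 ≤ φ θ) → (∀ θ, φ θ ≤ N) → Integrable φ κ := by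
    intro κ _ N hN φ hm h0 h1
    refine Integrable.mono' (integrable_const N) hm.aestronglyMeasurable (ae_of_all _ fun θ => ?_)
    rw [Real.norm_eq_abs, abs_of_nonneg (h0 θ)]; exact h1 θ
  -- Integrability of `W` is not known yet, so invariance is applied to the truncation `min W N`,
  -- whose mean after one step is at most `min (ρ * W + b) N`. The difference of the two truncations
  -- is at least `(1 - ρ) * W - b` where `W ≤ N`, and nonnegative elsewhere.
  have key : ∀ N : ℕ, ∫ θ, {θ | W θ ≤ N}.indicator W θ ∂ν ≤ b / (1 - ρ) := by
    intro N
    have hN : (0 : ℝ) ≤ N := N.cast_nonneg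
    have i1 : Integrable (fun θ => min (W θ) N) ν :=
      bdd ν N hN _ (hW.min measurable_const) (fun θ => le_min (hW0 θ) hN) fun θ => min_le_right _ _
    have i2 : Integrable (fun θ => min (ρ * W θ + b) N) ν :=
      bdd ν N hN _ (((hW.const_mul ρ).add_const b).min measurable_const)
        (fun θ => le_min (add_nonneg (mul_nonneg hρ0 (hW0 θ)) hb) hN) fun θ => min_le_right _ _
    have i3 : Integrable ({θ | W θ ≤ N}.indicator W) ν := by
      refine bdd ν N hN _ (hW.indicator (measurableSet_le hW measurable_const))
        (fun θ => Set.indicator_nonneg (fun θ _ => hW0 θ) θ) fun θ => ?_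
      by_cases hθ : W θ ≤ N
      · rw [Set.indicator_of_mem (by exact hθ)]; exact hθ
      · rw [Set.indicator_of_notMem (by exact hθ)]; exact hN
    have e1 : ∫ θ, min (W θ) N ∂ν ≤ ∫ θ, min (ρ * W θ + b) N ∂ν := by
      have i1' : Integrable (fun θ => min (W θ) N) (push P G γ ν) := by rw [hν]; exact i1
      have e := h.integral_push (hW.min measurable_const) i1'
      rw [hν] at e
      rw [e]
      have i4 : Integrable (fun q : E × Ω => min (W (step G γ q.2 q.1)) N) (ν.prod P) :=
        h.integrable_comp_step (hW.min measurable_const) i1'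
      refine integral_mono i4.integral_prod_left i2 fun θ => ?_
      have i5 : Integrable (fun ω => min (W (step G γ ω θ)) N) P := by
        refine Integrable.mono' (hd θ).1
          ((hW.comp (h.measurable_step_right γ θ)).min measurable_const).aestronglyMeasurable
          (ae_of_all _ fun ω => ?_)
        rw [Real.norm_eq_abs, abs_of_nonneg (le_min (hW0 _) hN)]
        exact min_le_left _ _
      refine le_min ?_ ?_
      · exact (integral_mono i5 (hd θ).1 fun ω => min_le_left _ _).trans (hd θ).2
      · calc ∫ ω, min (W (step G γ ω θ)) N ∂P ≤ ∫ _, (N : ℝ) ∂P :=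
              integral_mono i5 (integrable_const _) fun ω => min_le_right _ _
          _ = N := by simp
    have e2 : (1 - ρ) * ∫ θ, {θ | W θ ≤ N}.indicator W θ ∂ν - b ≤
        ∫ θ, min (W θ) N ∂ν - ∫ θ, min (ρ * W θ + b) N ∂ν := by
      have : ∫ θ, ((1 - ρ) * {θ | W θ ≤ N}.indicator W θ - b) ∂ν =
          (1 - ρ) * ∫ θ, {θ | W θ ≤ N}.indicator W θ ∂ν - b := by
        rw [integral_sub (i3.const_mul _) (integrable_const _), integral_const_mul]; simp
      rw [← this, ← integral_sub i1 i2]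
      refine integral_mono ((i3.const_mul _).sub (integrable_const _)) (i1.sub i2) fun θ => ?_
      simp only
      by_cases hθ : W θ ≤ N
      · rw [Set.indicator_of_mem (by exact hθ), min_eq_left hθ]
        have := min_le_left (ρ * W θ + b) N
        linarith
      · rw [Set.indicator_of_notMem (by exact hθ), min_eq_right (not_le.1 hθ).le]
        have := min_le_right (ρ * W θ + b) N
        linarith
    rw [le_div_iff₀ hρ']
    linarith
  -- The bound does not depend on `N`, so monotone convergence gives integrability of `W` and the
  -- bound together.
  have hlim : Tendsto (fun N : ℕ => ∫⁻ θ, ENNReal.ofReal ({θ | W θ ≤ N}.indicator W θ) ∂ν) atTop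
      (𝓝 (∫⁻ θ, ENNReal.ofReal (W θ) ∂ν)) := by
    refine lintegral_tendsto_of_tendsto_of_monotone (fun N => ?_) (ae_of_all _ fun θ => ?_)
      (ae_of_all _ fun θ => ?_)
    · exact (hW.indicator (measurableSet_le hW measurable_const)).ennreal_ofReal.aemeasurable
    · intro M N hMN
      refine ENNReal.ofReal_le_ofReal ?_
      refine Set.indicator_le_indicator_of_subset (fun x hx => ?_) hW0 θ
      exact le_trans (by exact hx : W x ≤ M) (by exact_mod_cast hMN)
    · obtain ⟨N₀, hN₀⟩ := exists_nat_ge (W θ)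
      refine tendsto_const_nhds.congr' ?_
      filter_upwards [eventually_ge_atTop N₀] with N hN
      rw [Set.indicator_of_mem]
      exact hN₀.trans (by exact_mod_cast hN)
  have hle : ∫⁻ θ, ENNReal.ofReal (W θ) ∂ν ≤ ENNReal.ofReal (b / (1 - ρ)) := by
    refine le_of_tendsto' hlim fun N => ?_
    rw [← ofReal_integral_eq_lintegral_ofReal]
    · exact ENNReal.ofReal_le_ofReal (key N)
    · refine bdd ν N N.cast_nonneg _ (hW.indicator (measurableSet_le hW measurable_const))
        (fun θ => Set.indicator_nonneg (fun θ _ => hW0 θ) θ) fun θ => ?_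
      by_cases hθ : W θ ≤ N
      · rw [Set.indicator_of_mem (by exact hθ)]; exact hθ
      · rw [Set.indicator_of_notMem (by exact hθ)]; exact N.cast_nonneg
    · exact ae_of_all _ fun θ => Set.indicator_nonneg (fun θ _ => hW0 θ) θ
  have hint : Integrable W ν := by
    refine ⟨hW.aestronglyMeasurable, ?_⟩
    rw [hasFiniteIntegral_iff_ofReal (ae_of_all _ hW0)]
    exact hle.trans_lt ENNReal.ofReal_lt_top
  refine ⟨hint, ?_⟩
  rw [← ofReal_integral_eq_lintegral_ofReal hint (ae_of_all _ hW0)] at hle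
  exact (ENNReal.ofReal_le_ofReal_iff hB).1 hle

lemma integrable_sq_of_invariant {γ : ℝ} (hγ : 0 < γ) (hγL : γ * L < 2) {ν : Measure E}
    [IsProbabilityMeasure ν] (hν : push P G γ ν = ν) :
    Integrable (fun θ => ‖θ - θs‖ ^ 2) ν := by
  obtain ⟨ρ, b, hρ0, hρ, hb, hd⟩ := h.exists_drift hγ hγL
  exact (h.integral_le_of_drift hν (by fun_prop) (fun θ => by positivity) hρ0 hρ hb hd).1

lemma memLp_two_of_invariant {γ : ℝ} (hγ : 0 < γ) (hγL : γ * L < 2) {ν : Measure E}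
    [IsProbabilityMeasure ν] (hν : push P G γ ν = ν) : MemLp (fun θ => θ) 2 ν := by
  have h1 : MemLp (fun θ => θ - θs) 2 ν :=
    (memLp_two_iff_integrable_sq_norm (by fun_prop)).2 (h.integrable_sq_of_invariant hγ hγL hν)
  exact (h1.add (memLp_const θs)).ae_eq (ae_of_all _ fun θ => sub_add_cancel θ θs)

end CocoerciveField
end Recursion
end SGD

/-! ### Existence and uniqueness of the invariant probability measure. -/

namespace SGD

section Invariant

variable {Ω : Type*} [MeasurableSpace Ω] {E : Type*} [NormedAddCommGroup E]
  [InnerProductSpace ℝ E] [FiniteDimensional ℝ E] [MeasurableSpace E] [BorelSpace E]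
  {P : Measure Ω} [IsProbabilityMeasure P] {G : Ω → E → E} {g : E → E} {L μ : ℝ} {θs : E}

lemma integrable_of_lipschitzWith {κ : Measure E} [IsFiniteMeasure κ] {φ : E → ℝ} {K : NNReal}
    {B : ℝ} (hφ : LipschitzWith K φ) (hB : ∀ x, |φ x| ≤ B) : Integrable φ κ :=
  Integrable.mono' (integrable_const B) hφ.continuous.measurable.aestronglyMeasurable
    (ae_of_all _ hB)

/-- Probability measures are determined by the integrals of bounded Lipschitz functions. -/
lemma eq_of_forall_lipschitzWith {ν ν' : Measure E} [IsProbabilityMeasure ν]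
    [IsProbabilityMeasure ν']
    (h : ∀ (K : NNReal) (B : ℝ) (φ : E → ℝ), LipschitzWith K φ → (∀ x, |φ x| ≤ B) →
      ∫ x, φ x ∂ν = ∫ x, φ x ∂ν') : ν = ν' := by
  let p : ProbabilityMeasure E := ⟨ν, inferInstance⟩
  let p' : ProbabilityMeasure E := ⟨ν', inferInstance⟩
  -- Equality is read off from the Hausdorff property of weak convergence: the constant sequence `p`
  -- also converges to `p'`.
  have ht : Tendsto (fun _ : ℕ => p) atTop (𝓝 p') := by
    rw [tendsto_iff_forall_lipschitz_integral_tendsto]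
    rintro φ ⟨C, hC⟩ ⟨K, hK⟩
    have : ∀ x, |φ x| ≤ |φ 0| + C := fun x => by
      have h1 := hC x 0
      have h2 := abs_sub_abs_le_abs_sub (φ x) (φ 0)
      rw [Real.dist_eq] at h1
      linarith
    have e := h K _ φ hK this
    change Tendsto (fun _ : ℕ => ∫ x, φ x ∂ν) atTop (𝓝 (∫ x, φ x ∂ν'))
    rw [e]
    exact tendsto_const_nhds
  have hp : p = p' := tendsto_nhds_unique tendsto_const_nhds ht
  exact congrArg (fun q : ProbabilityMeasure E => (q : Measure E)) hp

namespace CocoerciveField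

variable (h : CocoerciveField P G g L μ θs)
include h

/-- One step of the recursion contracts the Lipschitz constant of test functions. -/
lemma exists_lipschitzWith_integral {γ : ℝ} (hγ : 0 < γ) (hγL : γ * L < 2) :
    ∃ q : NNReal, q < 1 ∧ ∀ (K : NNReal) (B : ℝ) (φ : E → ℝ), LipschitzWith K φ →
      (∀ x, |φ x| ≤ B) →
      LipschitzWith (K * q) (fun θ => ∫ ω, φ (step G γ ω θ) ∂P) ∧
      ∀ θ, |∫ ω, φ (step G γ ω θ) ∂P| ≤ B := by
  obtain ⟨r, hr0, hr1, hr⟩ := h.exists_contraction hγ hγL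
  refine ⟨(√r).toNNReal, ?_, fun K B φ hφ hB => ⟨?_, fun θ => ?_⟩⟩
  · rw [← NNReal.coe_lt_coe, Real.coe_toNNReal _ (Real.sqrt_nonneg r)]
    exact (Real.sqrt_lt' one_pos).2 (by simpa using hr1)
  · refine LipschitzWith.of_dist_le_mul fun θ η => ?_
    have hi : ∀ θ, Integrable (fun ω => φ (step G γ ω θ)) P := fun θ =>
      Integrable.mono' (integrable_const B)
        (hφ.continuous.measurable.comp (h.measurable_step_right γ θ)).aestronglyMeasurable
        (ae_of_all _ fun ω => hB _)
    rw [Real.dist_eq, ← integral_sub (hi θ) (hi η), NNReal.coe_mul,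
      Real.coe_toNNReal _ (Real.sqrt_nonneg r), mul_assoc]
    rcases eq_or_ne θ η with rfl | hne
    · simp
    have hd : 0 < dist θ η := dist_pos.2 hne
    -- The first moment of the coupled distance is bounded through its second by `a ≤ a ^ 2 / (2 *
    -- c) + c / 2`; this `c` is the bound on the root mean square, which makes the right side at
    -- most `c` after integration.
    set c := √r * dist θ η with hc
    have hc0 : 0 < c := mul_pos (Real.sqrt_pos.2 hr0) hd
    have hc2 : c ^ 2 = r * ‖θ - η‖ ^ 2 := by
      rw [hc, mul_pow, Real.sq_sqrt hr0.le, dist_eq_norm]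
    have hb : ∀ ω, ‖φ (step G γ ω θ) - φ (step G γ ω η)‖ ≤
        K * ((2 * c)⁻¹ * ‖step G γ ω θ - step G γ ω η‖ ^ 2 + c / 2) := fun ω => by
      have h1 := hφ.dist_le_mul (step G γ ω θ) (step G γ ω η)
      rw [dist_eq_norm, dist_eq_norm] at h1
      refine h1.trans (mul_le_mul_of_nonneg_left ?_ K.2)
      set a := ‖step G γ ω θ - step G γ ω η‖
      have : (2 * c)⁻¹ * a ^ 2 + c / 2 - a = (2 * c)⁻¹ * (a - c) ^ 2 := by
        field_simp; ring
      have : 0 ≤ (2 * c)⁻¹ * (a - c) ^ 2 := by positivity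
      linarith
    have hi2 : Integrable (fun ω => (2 * c)⁻¹ * ‖step G γ ω θ - step G γ ω η‖ ^ 2 + c / 2) P :=
      ((hr θ η).1.const_mul _).add (integrable_const _)
    refine (norm_integral_le_of_norm_le (hi2.const_mul (K : ℝ)) (ae_of_all _ hb)).trans ?_
    rw [integral_const_mul, integral_add ((hr θ η).1.const_mul _) (integrable_const _),
      integral_const_mul]
    refine mul_le_mul_of_nonneg_left ?_ K.2
    have h2 := (hr θ η).2
    rw [← hc2] at h2
    have h3 : (2 * c)⁻¹ * ∫ ω, ‖step G γ ω θ - step G γ ω η‖ ^ 2 ∂P ≤ (2 * c)⁻¹ * c ^ 2 := by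
      gcongr
    have h4 : (2 * c)⁻¹ * c ^ 2 = c / 2 := by field_simp
    simp only [integral_const, probReal_univ, smul_eq_mul]
    linarith
  · have : ∀ᵐ ω ∂P, ‖φ (step G γ ω θ)‖ ≤ B := ae_of_all _ fun ω => hB _
    simpa using norm_integral_le_of_norm_le_const this

/-- Applying the kernel `n` times to a test function leaves its two stationary integrals unchanged
but multiplies its Lipschitz constant by `q ^ n`. The drift condition gives both measures finite
first moments, so the gap between the integrals is bounded by that Lipschitz constant and tends to
zero. -/
theorem invariant_unique {γ : ℝ} (hγ : 0 < γ) (hγL : γ * L < 2) {ν ν' : Measure E}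
    [IsProbabilityMeasure ν] [IsProbabilityMeasure ν'] (hν : push P G γ ν = ν)
    (hν' : push P G γ ν' = ν') : ν = ν' := by
  obtain ⟨q, hq, hlip⟩ := h.exists_lipschitzWith_integral hγ hγL
  have first : ∀ κ : Measure E, IsProbabilityMeasure κ → push P G γ κ = κ →
      Integrable (fun θ => ‖θ - θs‖) κ := fun κ _ hκ =>
    (((h.memLp_two_of_invariant hγ hγL hκ).sub (memLp_const θs)).integrable one_le_two).norm
  have base : ∀ κ : Measure E, IsProbabilityMeasure κ → push P G γ κ = κ →
      ∀ (K : NNReal) (B : ℝ) (φ : E → ℝ), LipschitzWith K φ → (∀ x, |φ x| ≤ B) →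
      |∫ x, φ x ∂κ - φ θs| ≤ K * ∫ θ, ‖θ - θs‖ ∂κ := by
    intro κ _ hκ K B φ hφ hB
    have e : ∫ x, φ x ∂κ - φ θs = ∫ x, (φ x - φ θs) ∂κ := by
      rw [integral_sub (integrable_of_lipschitzWith hφ hB) (integrable_const _)]; simp
    rw [e, ← integral_const_mul]
    refine norm_integral_le_of_norm_le (f := fun x => φ x - φ θs) ((first κ inferInstance hκ).const_mul _)
      (ae_of_all _ fun x => ?_)
    have := hφ.dist_le_mul x θs
    rwa [dist_eq_norm, dist_eq_norm] at this
  set D := ∫ θ, ‖θ - θs‖ ∂ν + ∫ θ, ‖θ - θs‖ ∂ν' with hD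
  have iter : ∀ (n : ℕ) (K : NNReal) (B : ℝ) (φ : E → ℝ), LipschitzWith K φ → (∀ x, |φ x| ≤ B) →
      |∫ x, φ x ∂ν - ∫ x, φ x ∂ν'| ≤ K * q ^ n * D := by
    intro n
    induction n with
    | zero =>
      intro K B φ hφ hB
      have h1 := base ν inferInstance hν K B φ hφ hB
      have h2 := base ν' inferInstance hν' K B φ hφ hB
      have h3 := abs_sub_le (∫ x, φ x ∂ν) (φ θs) (∫ x, φ x ∂ν')
      rw [abs_sub_comm (φ θs)] at h3
      rw [hD, pow_zero, mul_one, mul_add]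
      linarith
    | succ n ih =>
      intro K B φ hφ hB
      obtain ⟨hl, hb⟩ := hlip K B φ hφ hB
      have h1 := ih (K * q) B _ hl hb
      have e : ∀ κ : Measure E, IsProbabilityMeasure κ → push P G γ κ = κ →
          ∫ θ, ∫ ω, φ (step G γ ω θ) ∂P ∂κ = ∫ x, φ x ∂κ := fun κ _ hκ => by
        have := h.integral_push (γ := γ) (ν := κ) hφ.continuous.measurable
          (by rw [hκ]; exact integrable_of_lipschitzWith hφ hB)
        rw [hκ] at this
        exact this.symm
      rw [e ν inferInstance hν, e ν' inferInstance hν'] at h1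
      refine h1.trans (le_of_eq ?_)
      push_cast; ring
  refine eq_of_forall_lipschitzWith fun K B φ hφ hB => ?_
  have hlim : Tendsto (fun n : ℕ => (K : ℝ) * (q : ℝ) ^ n * D) atTop (𝓝 (K * 0 * D)) :=
    ((tendsto_pow_atTop_nhds_zero_of_lt_one q.2 (by exact_mod_cast hq)).const_mul _).mul_const _
  have := ge_of_tendsto' hlim fun n => iter n K B φ hφ hB
  rw [mul_zero, zero_mul] at this
  exact sub_eq_zero.1 (abs_eq_zero.1 (le_antisymm this (abs_nonneg _)))

/-- The laws started from a Dirac mass at `θs` have bounded second moments, hence are tight. The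
contraction makes consecutive laws merge on bounded Lipschitz functions and the kernel preserves
this class, so every limit point is invariant. -/
theorem exists_invariant {γ : ℝ} (hγ : 0 < γ) (hγL : γ * L < 2) :
    ∃ ν : Measure E, IsProbabilityMeasure ν ∧ push P G γ ν = ν := by
  obtain ⟨q, hq, hlip⟩ := h.exists_lipschitzWith_integral hγ hγL
  obtain ⟨ρ, b, hρ0, hρ, hb, hd⟩ := h.exists_drift hγ hγL
  let ν : ℕ → Measure E := fun n => (push P G γ)^[n] (Measure.dirac θs)
  have hν0 : ν 0 = Measure.dirac θs := rfl
  have hνs : ∀ n, ν (n + 1) = push P G γ (ν n) := fun n => Function.iterate_succ_apply' _ _ _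
  have hprob : ∀ n, IsProbabilityMeasure (ν n) := fun n => by
    induction n with
    | zero => rw [hν0]; infer_instance
    | succ n ih => rw [hνs]; exact h.isProbabilityMeasure_push γ _
  have hpush : ∀ (κ : Measure E) [IsProbabilityMeasure κ] (K : NNReal) (B : ℝ) (φ : E → ℝ),
      LipschitzWith K φ → (∀ x, |φ x| ≤ B) →
      ∫ x, φ x ∂(push P G γ κ) = ∫ θ, ∫ ω, φ (step G γ ω θ) ∂P ∂κ := by
    intro κ _ K B φ hφ hB
    have := h.isProbabilityMeasure_push γ κ
    exact h.integral_push hφ.continuous.measurable (integrable_of_lipschitzWith hφ hB)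
  -- the second moments are bounded
  have hmom : ∀ n, ∫⁻ θ, ENNReal.ofReal (‖θ - θs‖ ^ 2) ∂(ν n) ≤ ENNReal.ofReal (b / (1 - ρ)) := by
    intro n
    induction n with
    | zero => rw [hν0, lintegral_dirac' _ (by fun_prop)]; simp
    | succ n ih =>
      have := hprob n
      rw [hνs, h.lintegral_push (by fun_prop)]
      calc ∫⁻ θ, ∫⁻ ω, ENNReal.ofReal (‖step G γ ω θ - θs‖ ^ 2) ∂P ∂(ν n)
          ≤ ∫⁻ θ, (ENNReal.ofReal ρ * ENNReal.ofReal (‖θ - θs‖ ^ 2) + ENNReal.ofReal b) ∂(ν n) := by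
            refine lintegral_mono fun θ => ?_
            rw [← ofReal_integral_eq_lintegral_ofReal (hd θ).1
              (ae_of_all _ fun ω => by positivity), ← ENNReal.ofReal_mul hρ0,
              ← ENNReal.ofReal_add (by positivity) hb]
            exact ENNReal.ofReal_le_ofReal (hd θ).2
        _ = ENNReal.ofReal ρ * ∫⁻ θ, ENNReal.ofReal (‖θ - θs‖ ^ 2) ∂(ν n) + ENNReal.ofReal b := by
            rw [lintegral_add_right _ measurable_const, lintegral_const_mul _ (by fun_prop)]; simp
        _ ≤ ENNReal.ofReal ρ * ENNReal.ofReal (b / (1 - ρ)) + ENNReal.ofReal b := by gcongr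
        _ = ENNReal.ofReal (b / (1 - ρ)) := by
            have : 0 < 1 - ρ := by linarith
            rw [← ENNReal.ofReal_mul hρ0, ← ENNReal.ofReal_add (by positivity) hb]
            congr 1; field_simp; ring
  let p : ℕ → ProbabilityMeasure E := fun n => ⟨ν n, hprob n⟩
  -- Markov's inequality for the squared distance, with the uniform second moment bound.
  have htight : IsTightMeasureSet {((μ : ProbabilityMeasure E) : Measure E) | μ ∈ Set.range p} := by
    refine isTightMeasureSet_of_tendsto_measure_compl_closedBall (x := θs) ?_
    have hM : Tendsto (fun r : ℝ => ENNReal.ofReal (b / (1 - ρ) / r ^ 2)) atTop (𝓝 0) := by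
      rw [← ENNReal.ofReal_zero]
      refine ENNReal.tendsto_ofReal ?_
      exact tendsto_const_nhds.div_atTop (tendsto_pow_atTop two_ne_zero)
    refine tendsto_of_tendsto_of_tendsto_of_le_of_le' tendsto_const_nhds hM
      (Eventually.of_forall fun _ => zero_le) ?_
    filter_upwards [eventually_gt_atTop 0] with r hr
    refine iSup₂_le ?_
    rintro _ ⟨_, ⟨n, rfl⟩, rfl⟩
    change ν n _ ≤ _
    have hr2 : 0 < r ^ 2 := by positivity
    have h1 : ENNReal.ofReal (r ^ 2) * ν n (Metric.closedBall θs r)ᶜ ≤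
        ENNReal.ofReal (b / (1 - ρ)) := by
      refine le_trans ?_ ((mul_meas_ge_le_lintegral (μ := ν n)
        (f := fun θ => ENNReal.ofReal (‖θ - θs‖ ^ 2)) (by fun_prop)
        (ENNReal.ofReal (r ^ 2))).trans (hmom n))
      gcongr
      intro θ hθ
      simp only [Set.mem_compl_iff, Metric.mem_closedBall, dist_eq_norm, not_le] at hθ
      refine ENNReal.ofReal_le_ofReal ?_
      gcongr
    rw [ENNReal.ofReal_div_of_pos hr2, ENNReal.le_div_iff_mul_le
      (Or.inl (by simpa using hr.ne')) (Or.inl ENNReal.ofReal_ne_top), mul_comm]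
    exact h1
  -- A limit along a nonprincipal ultrafilter replaces the extraction of a subsequence.
  obtain ⟨p0, -, hp0⟩ := (isCompact_closure_of_isTightMeasureSet htight).ultrafilter_le_nhds
    ((hyperfilter ℕ : Ultrafilter ℕ).map p) (by
      rw [le_principal_iff]
      exact Filter.mem_of_superset (range_mem_map) subset_closure)
  have hconv : ∀ (K : NNReal) (B : ℝ) (φ : E → ℝ), LipschitzWith K φ → (∀ x, |φ x| ≤ B) →
      Tendsto (fun n => ∫ x, φ x ∂(ν n)) (hyperfilter ℕ : Ultrafilter ℕ)
        (𝓝 (∫ x, φ x ∂(p0 : Measure E))) := by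
    intro K B φ hφ hB
    have ht : Tendsto p (hyperfilter ℕ : Ultrafilter ℕ) (𝓝 p0) := hp0
    exact (ProbabilityMeasure.tendsto_iff_forall_integral_tendsto.1 ht)
      (BoundedContinuousFunction.ofNormedAddCommGroup φ hφ.continuous B hB)
  set c := ∫ ω, ‖step G γ ω θs - θs‖ ∂P with hc
  -- The induction moves one step of the kernel from the measures onto the test function; in the
  -- base case, the gap is the mean displacement of `θs` in one step.
  have iter : ∀ (n : ℕ) (K : NNReal) (B : ℝ) (φ : E → ℝ), LipschitzWith K φ → (∀ x, |φ x| ≤ B) →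
      |∫ x, φ x ∂(ν (n + 1)) - ∫ x, φ x ∂(ν n)| ≤ K * q ^ n * c := by
    intro n
    induction n with
    | zero =>
      intro K B φ hφ hB
      have e1 : ∫ x, φ x ∂(ν 0) = φ θs := by
        rw [hν0]; exact integral_dirac' _ _ hφ.continuous.stronglyMeasurable
      have e2 : ∫ x, φ x ∂(ν (0 + 1)) = ∫ ω, φ (step G γ ω θs) ∂P := by
        have := hprob 0
        rw [hνs, hpush (ν 0) K B φ hφ hB, hν0]
        exact integral_dirac' _ _ (hlip K B φ hφ hB).1.continuous.stronglyMeasurable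
      have hi : Integrable (fun ω => φ (step G γ ω θs)) P :=
        Integrable.mono' (integrable_const B)
          (hφ.continuous.measurable.comp (h.measurable_step_right γ θs)).aestronglyMeasurable
          (ae_of_all _ fun ω => hB _)
      have hi2 : Integrable (fun ω => ‖step G γ ω θs - θs‖) P :=
        (((integrable_const θs).sub ((h.integrable_field θs).smul γ)).sub
          (integrable_const θs)).norm
      have e3 : ∫ ω, φ (step G γ ω θs) ∂P - φ θs = ∫ ω, (φ (step G γ ω θs) - φ θs) ∂P := by
        rw [integral_sub hi (integrable_const _)]; simp
      rw [e1, e2, e3, hc, pow_zero, mul_one, ← integral_const_mul]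
      refine norm_integral_le_of_norm_le (f := fun ω => φ (step G γ ω θs) - φ θs)
        (hi2.const_mul _) (ae_of_all _ fun ω => ?_)
      have := hφ.dist_le_mul (step G γ ω θs) θs
      rwa [dist_eq_norm, dist_eq_norm] at this
    | succ n ih =>
      intro K B φ hφ hB
      obtain ⟨hl, hb⟩ := hlip K B φ hφ hB
      have h1 := ih (K * q) B _ hl hb
      have := hprob n
      have := hprob (n + 1)
      rw [← hpush (ν n) K B φ hφ hB, ← hpush (ν (n + 1)) K B φ hφ hB, ← hνs, ← hνs] at h1
      refine h1.trans (le_of_eq ?_)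
      push_cast; ring
  have hp0' : IsProbabilityMeasure (p0 : Measure E) := p0.2
  have := h.isProbabilityMeasure_push γ (p0 : Measure E)
  refine ⟨p0, p0.2, eq_of_forall_lipschitzWith fun K B φ hφ hB => ?_⟩
  have hle : ((hyperfilter ℕ : Ultrafilter ℕ) : Filter ℕ) ≤ atTop := by
    rw [← Nat.cofinite_eq_atTop]; exact hyperfilter_le_cofinite
  obtain ⟨hl, hb'⟩ := hlip K B φ hφ hB
  have t1 := hconv _ B _ hl hb'
  rw [← hpush (p0 : Measure E) K B φ hφ hB] at t1
  have t2 := hconv K B φ hφ hB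
  have t3 : Tendsto (fun n => ∫ x, φ x ∂(ν (n + 1)) - ∫ x, φ x ∂(ν n)) atTop (𝓝 0) := by
    have hlim : Tendsto (fun n : ℕ => (K : ℝ) * (q : ℝ) ^ n * c) atTop (𝓝 (K * 0 * c)) :=
      ((tendsto_pow_atTop_nhds_zero_of_lt_one q.2 (by exact_mod_cast hq)).const_mul _).mul_const _
    rw [mul_zero, zero_mul] at hlim
    exact squeeze_zero_norm (fun n => iter n K B φ hφ hB) hlim
  have t4 := (t1.sub t2)
  have e : (fun n => ∫ x, φ x ∂(ν (n + 1)) - ∫ x, φ x ∂(ν n)) =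
      fun n => ∫ θ, ∫ ω, φ (step G γ ω θ) ∂P ∂(ν n) - ∫ x, φ x ∂(ν n) := by
    funext n
    have := hprob n
    rw [hνs, hpush (ν n) K B φ hφ hB]
  rw [← e] at t4
  exact sub_eq_zero.1 (tendsto_nhds_unique t4 (t3.mono_left hle))

end CocoerciveField
end Invariant
end SGD

/-! ### Moments of stationary measures, uniformly in small step sizes. -/

namespace SGD

/-- A binomial expansion with a remainder of second order in the scale `s`. -/
lemma add_pow_succ_le {w a s q K : ℝ} (n : ℕ) (hw : 1 ≤ w) (hs0 : 0 ≤ s) (hs1 : s ≤ 1)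
    (hq : 1 ≤ q) (hK : 1 ≤ K) (ha : |a| ≤ K * q ^ 2 * s * (s * w ^ 2 + w)) :
    (w ^ 2 + a) ^ (n + 1) ≤ (w ^ 2) ^ (n + 1) + (n + 1) * (w ^ 2) ^ n * a
      + (4 * K) ^ (n + 1) * q ^ (2 * (n + 1)) *
        (s ^ 2 * (s * (w ^ 2) ^ (n + 1) + (w ^ 2) ^ n)) := by
  have hw0 : 0 ≤ w := zero_le_one.trans hw
  have hq0 : 0 ≤ q := zero_le_one.trans hq
  have hK0 : 0 ≤ K := zero_le_one.trans hK
  set R := (2 * K) ^ (n + 1) * q ^ (2 * (n + 1)) *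
        (s ^ 2 * (s * (w ^ 2) ^ (n + 1) + (w ^ 2) ^ n)) with hR
  have hR0 : 0 ≤ R := by positivity
  -- Only the terms of degree at least two in `a` are estimated; the linear term stays exact, since
  -- its mean carries the contraction. Two factors of `a` give `s ^ 2`, and then the top power of
  -- `w` keeps a further factor `s`, while the pure `w` part loses a full power of `w ^ 2` because
  -- `w ≥ 1`.
  have term : ∀ k, k < n → a ^ (k + 2) * (w ^ 2) ^ (n + 1 - (k + 2)) ≤ R := by
    intro k hk
    have h1 : |a| ^ (k + 2) ≤ (K * q ^ 2 * s * (s * w ^ 2 + w)) ^ (k + 2) := by gcongr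
    have h2 : (s * w ^ 2 + w) ^ (k + 2) ≤ 2 ^ (k + 2) * (s * (w ^ 2) ^ (k + 2) + (w ^ 2) ^ (k + 1)) := by
      refine (add_pow_le (by positivity) hw0 (k + 2)).trans ?_
      have e1 : (2 : ℝ) ^ (k + 2 - 1) ≤ 2 ^ (k + 2) :=
        pow_le_pow_right₀ one_le_two (by omega)
      have e2 : (s * w ^ 2) ^ (k + 2) ≤ s * (w ^ 2) ^ (k + 2) := by
        rw [mul_pow]
        gcongr
        exact pow_le_of_le_one hs0 hs1 (by omega)
      have e3 : w ^ (k + 2) ≤ (w ^ 2) ^ (k + 1) := by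
        rw [← pow_mul]; exact pow_le_pow_right₀ hw (by omega)
      gcongr
    have h3 : s ^ (k + 2) ≤ s ^ 2 := pow_le_pow_of_le_one hs0 hs1 (by omega)
    have h4 : (2 * K) ^ (k + 2) ≤ (2 * K) ^ (n + 1) :=
      pow_le_pow_right₀ (by linarith) (by omega)
    have h5 : q ^ (2 * (k + 2)) ≤ q ^ (2 * (n + 1)) := pow_le_pow_right₀ hq (by omega)
    calc a ^ (k + 2) * (w ^ 2) ^ (n + 1 - (k + 2))
        ≤ |a| ^ (k + 2) * (w ^ 2) ^ (n + 1 - (k + 2)) := by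
          refine mul_le_mul_of_nonneg_right ?_ (by positivity)
          rw [← abs_pow]; exact le_abs_self _
      _ ≤ (K * q ^ 2 * s * (s * w ^ 2 + w)) ^ (k + 2) * (w ^ 2) ^ (n + 1 - (k + 2)) := by gcongr
      _ = K ^ (k + 2) * q ^ (2 * (k + 2)) * s ^ (k + 2) * (s * w ^ 2 + w) ^ (k + 2)
            * (w ^ 2) ^ (n + 1 - (k + 2)) := by rw [mul_pow, mul_pow, mul_pow, ← pow_mul q]
      _ ≤ K ^ (k + 2) * q ^ (2 * (k + 2)) * s ^ 2 *
            (2 ^ (k + 2) * (s * (w ^ 2) ^ (k + 2) + (w ^ 2) ^ (k + 1)))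
            * (w ^ 2) ^ (n + 1 - (k + 2)) := by gcongr
      _ = (2 * K) ^ (k + 2) * q ^ (2 * (k + 2)) * (s ^ 2 *
            (s * ((w ^ 2) ^ (k + 2) * (w ^ 2) ^ (n + 1 - (k + 2)))
              + (w ^ 2) ^ (k + 1) * (w ^ 2) ^ (n + 1 - (k + 2)))) := by rw [mul_pow]; ring
      _ = (2 * K) ^ (k + 2) * q ^ (2 * (k + 2)) *
            (s ^ 2 * (s * (w ^ 2) ^ (n + 1) + (w ^ 2) ^ n)) := by
          rw [← pow_add, ← pow_add, show k + 2 + (n + 1 - (k + 2)) = n + 1 by omega,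
            show k + 1 + (n + 1 - (k + 2)) = n by omega]
      _ ≤ R := by rw [hR]; gcongr
  rw [add_comm (w ^ 2) a, add_pow, Finset.sum_range_succ', Finset.sum_range_succ']
  have hsum : ∑ k ∈ Finset.range n, a ^ (k + 1 + 1) * (w ^ 2) ^ (n + 1 - (k + 1 + 1)) *
      ((n + 1).choose (k + 1 + 1) : ℝ) ≤ 2 ^ (n + 1) * R := by
    calc _ ≤ ∑ k ∈ Finset.range n, R * ((n + 1).choose (k + 1 + 1) : ℝ) := by
          refine Finset.sum_le_sum fun k hk => ?_
          exact mul_le_mul_of_nonneg_right (term k (Finset.mem_range.1 hk)) (Nat.cast_nonneg _)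
      _ = R * ∑ k ∈ Finset.range n, ((n + 1).choose (k + 1 + 1) : ℝ) := by rw [Finset.mul_sum]
      _ ≤ R * 2 ^ (n + 1) := by
          gcongr
          have e := Nat.sum_range_choose (n + 1)
          rw [Finset.sum_range_succ', Finset.sum_range_succ'] at e
          have : ∑ k ∈ Finset.range n, (n + 1).choose (k + 1 + 1) ≤ 2 ^ (n + 1) := by omega
          exact_mod_cast this
      _ = 2 ^ (n + 1) * R := mul_comm _ _
  -- The extra `2 ^ (n + 1)` is the sum of the binomial coefficients.
  have e4 : (4 * K) ^ (n + 1) = 2 ^ (n + 1) * (2 * K) ^ (n + 1) := by rw [← mul_pow]; ring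
  rw [e4, mul_assoc (2 ^ (n + 1)), mul_assoc (2 ^ (n + 1)), ← hR]
  simp only [zero_add, Nat.add_sub_cancel, pow_one, Nat.choose_one_right, pow_zero, Nat.sub_zero,
    Nat.choose_zero_right, Nat.cast_one, mul_one, one_mul, Nat.cast_add]
  nlinarith [hsum]

/-- A lower power is absorbed by a higher one. -/
lemma mul_pow_le_add {W A c : ℝ} (n : ℕ) (hW : 0 ≤ W) (hA : 0 ≤ A) (hc : 0 < c) :
    A * W ^ n ≤ c * W ^ (n + 1) + A * (A / c) ^ n := by
  rcases le_total A (c * W) with hle | hle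
  · have h1 : A * W ^ n ≤ c * W * W ^ n := by gcongr
    have h2 : 0 ≤ A * (A / c) ^ n := by positivity
    rw [pow_succ]; linarith
  · have h1 : W ≤ A / c := by rw [le_div_iff₀ hc]; linarith
    have h2 : A * W ^ n ≤ A * (A / c) ^ n := by gcongr
    have h3 : 0 ≤ c * W ^ (n + 1) := by positivity
    linarith

/-- The scalar form of the increment estimate: `x` stands for the distance to `θs`, `y` for the norm
of the field, `e` for the noise at `θs`, `s` for `√γ`, and `w ^ 2` for the normalized squared
distance. The right side has the shape required by `add_pow_succ_le`, with `q = 1 + e`. -/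
lemma increment_bound {L e x y s w : ℝ} (hL : 0 ≤ L) (he : 0 ≤ e) (hy0 : 0 ≤ y)
    (hs0 : 0 ≤ s) (hs1 : s ≤ 1) (hw : 1 ≤ w) (hx : x ≤ s * w) (hy : y ≤ L * x + e) :
    s ^ 2 * y ^ 2 + 2 * (x * y) ≤
      5 * (1 + L) ^ 2 * (1 + e) ^ 2 * s * (s * w ^ 2 + w) := by
  have hw0 : 0 ≤ w := zero_le_one.trans hw
  have hsw : 0 ≤ s * w := mul_nonneg hs0 hw0
  set B := (1 + L) * (1 + e) with hB
  have hB1 : 1 ≤ B := by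
    have : B = 1 + L + e + L * e := by rw [hB]; ring
    have := mul_nonneg hL he
    linarith
  have hB0 : 0 ≤ B := zero_le_one.trans hB1
  have hyB : y ≤ B * (s * w + 1) := by
    have h1 : L * x ≤ L * (s * w) := mul_le_mul_of_nonneg_left hx hL
    have h2 : B * (s * w + 1) = L * (s * w) + e + ((s * w) + e * (s * w) + L * e * (s * w)
        + 1 + L + L * e) := by rw [hB]; ring
    have h3 : 0 ≤ (s * w) + e * (s * w) + L * e * (s * w) + 1 + L + L * e := by positivity
    linarith
  have hBB : B ≤ B ^ 2 := by nlinarith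
  have h1 : x * y ≤ s * w * (B ^ 2 * (s * w + 1)) :=
    mul_le_mul hx (hyB.trans (by gcongr)) hy0 hsw
  have h2 : s ^ 2 * y ^ 2 ≤ s ^ 2 * (B * (s * w + 1)) ^ 2 := by gcongr
  have h5 : s * (s * w + 1) ^ 2 + 2 * w * (s * w + 1) ≤ 5 * (s * w ^ 2 + w) := by
    have a1 : s ^ 2 ≤ 1 := pow_le_one₀ hs0 hs1
    have a2 : s ^ 2 * (s * w ^ 2) ≤ 1 * (s * w ^ 2) := by gcongr
    have a3 : s ^ 2 * w ≤ 1 * w := by gcongr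
    have e1 : s * (s * w + 1) ^ 2 + 2 * w * (s * w + 1) =
      s ^ 2 * (s * w ^ 2) + 2 * (s ^ 2 * w) + s + 2 * (s * w ^ 2) + 2 * w := by ring
    have a4 : 0 ≤ s * w ^ 2 := by positivity
    linarith
  have h7 : B ^ 2 = (1 + L) ^ 2 * (1 + e) ^ 2 := by rw [hB]; ring
  calc s ^ 2 * y ^ 2 + 2 * (x * y)
      ≤ s ^ 2 * (B * (s * w + 1)) ^ 2 + 2 * (s * w * (B ^ 2 * (s * w + 1))) := by linarith
    _ = B ^ 2 * s * (s * (s * w + 1) ^ 2 + 2 * w * (s * w + 1)) := by ring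
    _ ≤ B ^ 2 * s * (5 * (s * w ^ 2 + w)) := by gcongr
    _ = _ := by rw [h7]; ring

section Moments

variable {Ω : Type*} [MeasurableSpace Ω] {E : Type*} [NormedAddCommGroup E]
  [InnerProductSpace ℝ E] [FiniteDimensional ℝ E] [MeasurableSpace E] [BorelSpace E]
  {P : Measure Ω} [IsProbabilityMeasure P] {G : Ω → E → E} {g : E → E} {L μ : ℝ} {θs : E}

namespace CocoerciveField

variable (h : CocoerciveField P G g L μ θs)
include h

/-- The normalized squared distance to `θs` after one step. -/
lemma one_add_sq_step {γ : ℝ} (hγ : 0 < γ) (ω : Ω) (θ : E) :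
    1 + ‖step G γ ω θ - θs‖ ^ 2 / γ = 1 + ‖θ - θs‖ ^ 2 / γ
      + (γ * ‖G ω θ‖ ^ 2 - 2 * inner ℝ (θ - θs) (G ω θ)) := by
  have e : step G γ ω θ - θs = (θ - θs) - γ • G ω θ := by simp only [step]; abel
  rw [e, norm_sub_sq_real, norm_smul, mul_pow, real_inner_smul_right, Real.norm_eq_abs, sq_abs]
  field_simp
  ring

lemma abs_increment_le {γ : ℝ} (hγ : 0 < γ) (hγ1 : γ ≤ 1) (ω : Ω) (θ : E) :
    |γ * ‖G ω θ‖ ^ 2 - 2 * inner ℝ (θ - θs) (G ω θ)| ≤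
      5 * (1 + L) ^ 2 * (1 + ‖G ω θs‖) ^ 2 * √γ *
        (√γ * √(1 + ‖θ - θs‖ ^ 2 / γ) ^ 2 + √(1 + ‖θ - θs‖ ^ 2 / γ)) := by
  set w := √(1 + ‖θ - θs‖ ^ 2 / γ) with hw
  have hs0 : 0 ≤ √γ := Real.sqrt_nonneg γ
  have hs1 : √γ ≤ 1 := Real.sqrt_le_one.2 hγ1
  have hs2 : √γ ^ 2 = γ := Real.sq_sqrt hγ.le
  have hw2 : w ^ 2 = 1 + ‖θ - θs‖ ^ 2 / γ := Real.sq_sqrt (by positivity)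
  have hw1 : 1 ≤ w := Real.one_le_sqrt.2 (by have : 0 ≤ ‖θ - θs‖ ^ 2 / γ := by positivity
                                             linarith)
  have hL := h.nonneg
  set s := √γ
  have hx : ‖θ - θs‖ ≤ s * w := by
    refine abs_le_of_sq_le_sq' ?_ (by positivity) |>.2
    rw [mul_pow, hs2, hw2]
    field_simp
    linarith
  have hG := h.norm_le ω θ
  have h1 := abs_real_inner_le_norm (θ - θs) (G ω θ)
  have h3 : |γ * ‖G ω θ‖ ^ 2 - 2 * inner ℝ (θ - θs) (G ω θ)| ≤
      s ^ 2 * ‖G ω θ‖ ^ 2 + 2 * (‖θ - θs‖ * ‖G ω θ‖) := by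
    refine (abs_sub _ _).trans ?_
    rw [abs_of_nonneg (by positivity), abs_mul, abs_two, hs2]
    linarith
  exact h3.trans (increment_bound hL (norm_nonneg _) (norm_nonneg _) hs0 hs1 hw1
    hx hG)

lemma integrable_norm_sq_field (θ : E) : Integrable (fun ω => ‖G ω θ‖ ^ 2) P :=
  (h.memLp_field h.memLp θ).integrable_norm_pow two_ne_zero

lemma integrable_increment (γ : ℝ) (θ : E) :
    Integrable (fun ω => γ * ‖G ω θ‖ ^ 2 - 2 * inner ℝ (θ - θs) (G ω θ)) P :=
  ((h.integrable_norm_sq_field θ).const_mul γ).sub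
    (((h.integrable_field θ).const_inner (θ - θs)).const_mul 2)

/-- Strong monotonicity at `θs`, where the mean field vanishes, makes the cross term negative. The
second moment of the field contributes only at relative order `γ`, apart from a constant. -/
lemma integral_increment_le {γ : ℝ} (hγ : 0 < γ) (θ : E) :
    ∫ ω, (γ * ‖G ω θ‖ ^ 2 - 2 * inner ℝ (θ - θs) (G ω θ)) ∂P ≤
      γ * (-2 * μ * (‖θ - θs‖ ^ 2 / γ) + 2 * L ^ 2 * ‖θ - θs‖ ^ 2
        + 2 * ∫ ω, ‖G ω θs‖ ^ 2 ∂P) := by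
  rw [integral_sub ((h.integrable_norm_sq_field θ).const_mul γ)
    (((h.integrable_field θ).const_inner (θ - θs)).const_mul 2), integral_const_mul,
    integral_const_mul, integral_inner (h.integrable_field θ), h.mean]
  have h1 := h.monotone θ θs
  rw [h.zero, sub_zero, real_inner_comm] at h1
  have h2 : ∫ ω, ‖G ω θ‖ ^ 2 ∂P ≤ 2 * L ^ 2 * ‖θ - θs‖ ^ 2 + 2 * ∫ ω, ‖G ω θs‖ ^ 2 ∂P := by
    have i := (h.integrable_norm_sq_field θs).const_mul 2
    calc ∫ ω, ‖G ω θ‖ ^ 2 ∂P ≤ ∫ ω, (2 * L ^ 2 * ‖θ - θs‖ ^ 2 + 2 * ‖G ω θs‖ ^ 2) ∂P := by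
          refine integral_mono (h.integrable_norm_sq_field θ) ((integrable_const _).add i)
            fun ω => ?_
          have a := h.norm_le ω θ
          have b : ‖G ω θ‖ ^ 2 ≤ (L * ‖θ - θs‖ + ‖G ω θs‖) ^ 2 := by gcongr
          simp only
          nlinarith [sq_nonneg (L * ‖θ - θs‖ - ‖G ω θs‖)]
      _ = _ := by rw [integral_add (integrable_const _) i, integral_const_mul 2]; simp
  have h3 : γ * (‖θ - θs‖ ^ 2 / γ) = ‖θ - θs‖ ^ 2 := by field_simp
  have h4 := mul_le_mul_of_nonneg_left h2 hγ.le
  rw [add_assoc, mul_add γ]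
  have h5 : γ * (-2 * μ * (‖θ - θs‖ ^ 2 / γ)) = -2 * (μ * ‖θ - θs‖ ^ 2) := by
    rw [← h3]; field_simp
  rw [h5]
  linarith

/-- Even moments of the normalized distance to `θs` under an invariant probability measure are
bounded uniformly in small step sizes. -/
theorem exists_moment_bound (n : ℕ)
    (hp : MemLp (fun ω => G ω θs) ((2 * (n + 1) : ℕ) : ENNReal) P) :
    ∃ C γ₀ : ℝ, 0 < γ₀ ∧ ∀ γ, 0 < γ → γ ≤ γ₀ → ∀ ν : Measure E, IsProbabilityMeasure ν →
      push P G γ ν = ν →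
      Integrable (fun θ => (1 + ‖θ - θs‖ ^ 2 / γ) ^ (n + 1)) ν ∧
      ∫ θ, (1 + ‖θ - θs‖ ^ 2 / γ) ^ (n + 1) ∂ν ≤ C := by
  have hL := h.nonneg
  have hμ := h.pos
  set K : ℝ := 5 * (1 + L) ^ 2 with hK
  have hK1 : 1 ≤ K := by nlinarith
  have hq : Integrable (fun ω => (1 + ‖G ω θs‖) ^ (2 * (n + 1))) P := by
    have h1 : MemLp (fun ω => 1 + ‖G ω θs‖) ((2 * (n + 1) : ℕ) : ENNReal) P :=
      (memLp_const (1 : ℝ)).add hp.norm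
    have h2 := h1.integrable_norm_pow (p := 2 * (n + 1)) (by omega)
    refine h2.congr (ae_of_all _ fun ω => ?_)
    simp only
    rw [Real.norm_of_nonneg (by positivity)]
  set D := (4 * K) ^ (n + 1) * ∫ ω, (1 + ‖G ω θs‖) ^ (2 * (n + 1)) ∂P with hD
  have hD0 : 0 ≤ D := mul_nonneg (by positivity) (integral_nonneg fun ω => by positivity)
  set M := ∫ ω, ‖G ω θs‖ ^ 2 ∂P with hM
  have hM0 : 0 ≤ M := integral_nonneg fun ω => by positivity
  set N : ℝ := (n : ℝ) + 1 with hN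
  have hN0 : 0 < N := by positivity
  set A := 2 * L ^ 2 * N + D with hA
  set B := N * (2 * μ + 2 * M) + D with hB
  have hA0 : 0 ≤ A := by positivity
  have hB0 : 0 ≤ B := by positivity
  set c := μ * N / 2 with hc
  have hc0 : 0 < c := by positivity
  set R := B * (B / c) ^ n with hR
  have hR0 : 0 ≤ R := by positivity
  -- The linear term contributes the rate `-4 * c`. The three restrictions on `γ` allow the
  -- expansion in `√γ`, keep the factor `1 - γ * c` nonnegative, and make the remainder coefficient
  -- `√γ * A` at most `2 * c`. Lower powers absorb another `c`, leaving a net rate `c`.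
  refine ⟨R / c, min (min 1 c⁻¹) ((2 * c / (A + 1)) ^ 2), by positivity,
    fun γ hγ hγ₀ ν hν hinv => ?_⟩
  have hγ1 : γ ≤ 1 := hγ₀.trans ((min_le_left _ _).trans (min_le_left _ _))
  have hγc : γ * c ≤ 1 := by
    have : γ ≤ c⁻¹ := hγ₀.trans ((min_le_left _ _).trans (min_le_right _ _))
    calc γ * c ≤ c⁻¹ * c := by gcongr
      _ = 1 := inv_mul_cancel₀ hc0.ne'
  have hγA : √γ * A ≤ 2 * c := by
    have h1 : √γ ≤ 2 * c / (A + 1) := by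
      rw [Real.sqrt_le_left (by positivity)]
      exact hγ₀.trans (min_le_right _ _)
    calc √γ * A ≤ 2 * c / (A + 1) * (A + 1) := by gcongr; linarith
      _ = 2 * c := by field_simp
  have hs0 : 0 ≤ √γ := Real.sqrt_nonneg γ
  have hs1 : √γ ≤ 1 := Real.sqrt_le_one.2 hγ1
  have hs2 : √γ ^ 2 = γ := Real.sq_sqrt hγ.le
  -- The uniformity in `γ`: the rate and the constant of the drift condition are both proportional
  -- to `γ`, which cancels.
  have hfin : R / c = γ * R / (1 - (1 - γ * c)) := by
    rw [sub_sub_cancel, mul_div_mul_left _ _ hγ.ne']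
  rw [hfin]
  refine h.integral_le_of_drift hinv (by fun_prop) (fun θ => by positivity)
    (by linarith) (by nlinarith) (by positivity) fun θ => ?_
  set W := 1 + ‖θ - θs‖ ^ 2 / γ with hW
  have hW1 : 1 ≤ W := by
    have : 0 ≤ ‖θ - θs‖ ^ 2 / γ := by positivity
    linarith
  have hW0 : 0 ≤ W := zero_le_one.trans hW1
  have hw2 : √W ^ 2 = W := Real.sq_sqrt hW0
  set a : Ω → ℝ := fun ω => γ * ‖G ω θ‖ ^ 2 - 2 * inner ℝ (θ - θs) (G ω θ) with ha
  have hbound : ∀ ω, (1 + ‖step G γ ω θ - θs‖ ^ 2 / γ) ^ (n + 1) ≤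
      W ^ (n + 1) + N * W ^ n * a ω + (4 * K) ^ (n + 1) * (1 + ‖G ω θs‖) ^ (2 * (n + 1)) *
        (γ * (√γ * W ^ (n + 1) + W ^ n)) := fun ω => by
    have h1 := h.abs_increment_le hγ hγ1 ω θ
    have h2 := add_pow_succ_le n (Real.one_le_sqrt.2 hW1) hs0 hs1
      (by linarith [norm_nonneg (G ω θs)] : (1 : ℝ) ≤ 1 + ‖G ω θs‖) hK1 h1
    rw [hw2, hs2] at h2
    rw [h.one_add_sq_step hγ]
    exact h2
  have hai : Integrable a P := h.integrable_increment γ θ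
  have hi1 : Integrable (fun ω => W ^ (n + 1) + N * W ^ n * a ω) P :=
    (integrable_const _).add (hai.const_mul _)
  have hi2 : Integrable (fun ω => (4 * K) ^ (n + 1) * (1 + ‖G ω θs‖) ^ (2 * (n + 1)) *
        (γ * (√γ * W ^ (n + 1) + W ^ n))) P := (hq.const_mul _).mul_const _
  have hstep : Integrable (fun ω => (1 + ‖step G γ ω θ - θs‖ ^ 2 / γ) ^ (n + 1)) P := by
    refine Integrable.mono' (hi1.add hi2) ?_ (ae_of_all _ fun ω => ?_)
    · have := h.measurable_step_right γ θ
      fun_prop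
    · rw [Real.norm_of_nonneg (by positivity)]
      exact hbound ω
  refine ⟨hstep, ?_⟩
  have hinc := h.integral_increment_le hγ θ
  have hWx : ‖θ - θs‖ ^ 2 = γ * (W - 1) := by rw [hW]; field_simp; ring
  have hinc' : ∫ ω, a ω ∂P ≤ γ * (-2 * μ * (W - 1) + 2 * L ^ 2 * (√γ * W) + 2 * M) := by
    refine hinc.trans ?_
    have e1 : ‖θ - θs‖ ^ 2 / γ = W - 1 := by rw [hW]; ring
    have e2 : ‖θ - θs‖ ^ 2 ≤ √γ * W := by
      rw [hWx]
      have : γ ≤ √γ := by nlinarith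
      calc γ * (W - 1) ≤ γ * W := by gcongr; linarith
        _ ≤ √γ * W := by gcongr
    rw [e1]
    gcongr
  calc ∫ ω, (1 + ‖step G γ ω θ - θs‖ ^ 2 / γ) ^ (n + 1) ∂P
      ≤ ∫ ω, (W ^ (n + 1) + N * W ^ n * a ω + (4 * K) ^ (n + 1) *
          (1 + ‖G ω θs‖) ^ (2 * (n + 1)) * (γ * (√γ * W ^ (n + 1) + W ^ n))) ∂P :=
        integral_mono hstep (hi1.add hi2) hbound
    _ = W ^ (n + 1) + N * W ^ n * ∫ ω, a ω ∂P + D * (γ * (√γ * W ^ (n + 1) + W ^ n)) := by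
        rw [integral_add hi1 hi2, integral_add (integrable_const _) (hai.const_mul _),
          integral_const_mul, integral_mul_const, integral_const_mul]
        simp [hD]
    _ ≤ W ^ (n + 1) + N * W ^ n * (γ * (-2 * μ * (W - 1) + 2 * L ^ 2 * (√γ * W) + 2 * M))
          + D * (γ * (√γ * W ^ (n + 1) + W ^ n)) := by gcongr
    _ = W ^ (n + 1) + γ * ((√γ * A - 4 * c) * W ^ (n + 1) + B * W ^ n) := by
        rw [hA, hB, hc]; ring
    _ ≤ W ^ (n + 1) + γ * ((2 * c - 4 * c) * W ^ (n + 1) + (c * W ^ (n + 1) + R)) := by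
        gcongr
        exact mul_pow_le_add n hW0 hB0 hc0
    _ = (1 - γ * c) * W ^ (n + 1) + γ * R := by ring

/-- Even moments of the distance to `θs` under an invariant probability measure. -/
theorem exists_moment_bound_norm (n : ℕ)
    (hp : MemLp (fun ω => G ω θs) ((2 * (n + 1) : ℕ) : ENNReal) P) :
    ∃ C γ₀ : ℝ, 0 < γ₀ ∧ ∀ γ, 0 < γ → γ ≤ γ₀ → ∀ ν : Measure E, IsProbabilityMeasure ν →
      push P G γ ν = ν →
      Integrable (fun θ => ‖θ - θs‖ ^ (2 * (n + 1))) ν ∧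
      ∫ θ, ‖θ - θs‖ ^ (2 * (n + 1)) ∂ν ≤ C * γ ^ (n + 1) := by
  obtain ⟨C, γ₀, hγ₀, hC⟩ := h.exists_moment_bound n hp
  refine ⟨C, γ₀, hγ₀, fun γ hγ hle ν hν hinv => ?_⟩
  obtain ⟨hi, hb⟩ := hC γ hγ hle ν hν hinv
  have hpt : ∀ θ : E, ‖θ - θs‖ ^ (2 * (n + 1)) ≤
      γ ^ (n + 1) * (1 + ‖θ - θs‖ ^ 2 / γ) ^ (n + 1) := fun θ => by
    rw [← mul_pow, pow_mul]
    gcongr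
    have : γ * (1 + ‖θ - θs‖ ^ 2 / γ) = γ + ‖θ - θs‖ ^ 2 := by field_simp
    linarith
  have hi' : Integrable (fun θ => ‖θ - θs‖ ^ (2 * (n + 1))) ν := by
    refine Integrable.mono' (hi.const_mul (γ ^ (n + 1))) (by fun_prop) (ae_of_all _ fun θ => ?_)
    rw [Real.norm_of_nonneg (by positivity)]
    exact hpt θ
  refine ⟨hi', (integral_mono hi' (hi.const_mul _) hpt).trans ?_⟩
  rw [integral_const_mul, mul_comm]
  gcongr

end CocoerciveField
end Moments
end SGD

/-! ### Integrals of remainders and the stationarity identity. -/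

namespace SGD

section HasMean

variable {α : Type*} [MeasurableSpace α] {ν : Measure α}

/-- The function `f` is integrable with integral `I`. -/
structure HasMean (ν : Measure α) (f : α → ℝ) (I : ℝ) : Prop where
  integrable : Integrable f ν
  integral_eq : ∫ x, f x ∂ν = I

namespace HasMean

variable {f f' : α → ℝ} {I I' : ℝ}

lemma of_integrable (hf : Integrable f ν) : HasMean ν f (∫ x, f x ∂ν) := ⟨hf, rfl⟩

lemma const [IsProbabilityMeasure ν] (c : ℝ) : HasMean ν (fun _ => c) c :=
  ⟨integrable_const c, by simp⟩

lemma add (hf : HasMean ν f I) (hf' : HasMean ν f' I') :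
    HasMean ν (fun x => f x + f' x) (I + I') :=
  ⟨hf.1.add hf'.1, by rw [integral_add hf.1 hf'.1, hf.2, hf'.2]⟩

lemma sub (hf : HasMean ν f I) (hf' : HasMean ν f' I') :
    HasMean ν (fun x => f x - f' x) (I - I') :=
  ⟨hf.1.sub hf'.1, by rw [integral_sub hf.1 hf'.1, hf.2, hf'.2]⟩

lemma const_mul (c : ℝ) (hf : HasMean ν f I) : HasMean ν (fun x => c * f x) (c * I) :=
  ⟨hf.1.const_mul c, by rw [integral_const_mul, hf.2]⟩

lemma sum {ι : Type*} {s : Finset ι} {f : ι → α → ℝ} {I : ι → ℝ}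
    (hf : ∀ i ∈ s, HasMean ν (f i) (I i)) : HasMean ν (fun x => ∑ i ∈ s, f i x) (∑ i ∈ s, I i) :=
  ⟨integrable_finsetSum s fun i hi => (hf i hi).1, by
    rw [integral_finsetSum s fun i hi => (hf i hi).1]
    exact Finset.sum_congr rfl fun i hi => (hf i hi).2⟩

lemma congr (hf : HasMean ν f I) (h : ∀ x, f' x = f x) (hI : I' = I) : HasMean ν f' I' := by
  obtain rfl : f' = f := funext h
  exact hI ▸ hf

end HasMean

end HasMean

section SmallMoments

variable {E : Type*} [NormedAddCommGroup E] [MeasurableSpace E]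

/-- The probability measures `ν γ` concentrate at `θs` at the scale `√γ` as `γ ↓ 0`, measured by
moments of order `2`, `4` and `r`. -/
structure SmallMoments (ν : ℝ → Measure E) (θs : E) (r : ℕ) : Prop where
  prob : ∀ᶠ γ in 𝓝[>] 0, IsProbabilityMeasure (ν γ)
  integrable_two : ∀ᶠ γ in 𝓝[>] 0, Integrable (fun θ => ‖θ - θs‖ ^ 2) (ν γ)
  integrable_four : ∀ᶠ γ in 𝓝[>] 0, Integrable (fun θ => ‖θ - θs‖ ^ 4) (ν γ)
  integrable_pow : ∀ᶠ γ in 𝓝[>] 0, Integrable (fun θ => ‖θ - θs‖ ^ r) (ν γ)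
  isBigO_two : (fun γ => ∫ θ, ‖θ - θs‖ ^ 2 ∂(ν γ)) =O[𝓝[>] 0] fun γ : ℝ => γ
  isBigO_four : (fun γ => ∫ θ, ‖θ - θs‖ ^ 4 ∂(ν γ)) =O[𝓝[>] 0] fun γ : ℝ => γ ^ 2
  isBigO_pow : (fun γ => ∫ θ, ‖θ - θs‖ ^ r ∂(ν γ)) =O[𝓝[>] 0] fun γ : ℝ => γ

/-- The size of remainders whose mean is of order `γ ^ 2`. -/
def remainderBound (r : ℕ) (γ t : ℝ) : ℝ := t ^ 4 + γ * (t ^ 2 + t ^ 4 + t ^ r) + γ ^ 2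

lemma sq_isBigO_id : (fun γ : ℝ => γ ^ 2) =O[𝓝[>] 0] fun γ : ℝ => γ := by
  refine IsBigO.of_bound 1 ?_
  filter_upwards [Ioc_mem_nhdsGT (zero_lt_one' ℝ)] with γ hγ
  rw [Real.norm_of_nonneg (by positivity), Real.norm_of_nonneg hγ.1.le]
  nlinarith [hγ.1, hγ.2]

namespace SmallMoments

variable {ν : ℝ → Measure E} {θs : E} {r : ℕ} (hν : SmallMoments ν θs r)
include hν

/-- In use, `A` is an expression with mean zero by stationarity and `M` its Taylor polynomial, so
the mean of `M` equals that of the Taylor remainder up to sign. -/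
lemma isBigO_of_bound_sq {A M : ℝ → E → ℝ} {v : ℝ → ℝ} {K : ℝ}
    (hA : ∀ᶠ γ in 𝓝[>] 0, HasMean (ν γ) (A γ) 0)
    (hM : ∀ᶠ γ in 𝓝[>] 0, HasMean (ν γ) (M γ) (v γ))
    (hR : ∀ᶠ γ in 𝓝[>] 0, ∀ θ, |A γ θ - M γ θ| ≤ K * ‖θ - θs‖ ^ 2) :
    v =O[𝓝[>] 0] fun γ : ℝ => γ := by
  refine IsBigO.trans (IsBigO.of_bound 1 ?_) (hν.isBigO_two.const_mul_left K)
  filter_upwards [hA, hM, hR, hν.integrable_two] with γ h1 h2 h3 h4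
  have h5 := h1.sub h2
  rw [zero_sub] at h5
  rw [← norm_neg, ← h5.integral_eq, one_mul, ← integral_const_mul]
  exact (norm_integral_le_of_norm_le (h4.const_mul K) (ae_of_all _ h3)).trans (le_abs_self _)

lemma isBigO_of_remainderBound {A M : ℝ → E → ℝ} {v : ℝ → ℝ} {K : ℝ}
    (hA : ∀ᶠ γ in 𝓝[>] 0, HasMean (ν γ) (A γ) 0)
    (hM : ∀ᶠ γ in 𝓝[>] 0, HasMean (ν γ) (M γ) (v γ))
    (hR : ∀ᶠ γ in 𝓝[>] 0, ∀ θ, |A γ θ - M γ θ| ≤ K * remainderBound r γ ‖θ - θs‖) :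
    v =O[𝓝[>] 0] fun γ : ℝ => γ ^ 2 := by
  have hid : (fun γ : ℝ => γ) =O[𝓝[>] 0] fun γ : ℝ => γ := isBigO_refl _ _
  have hB : (fun γ : ℝ => K * (∫ θ, ‖θ - θs‖ ^ 4 ∂(ν γ) + γ * (∫ θ, ‖θ - θs‖ ^ 2 ∂(ν γ) +
      ∫ θ, ‖θ - θs‖ ^ 4 ∂(ν γ) + ∫ θ, ‖θ - θs‖ ^ r ∂(ν γ)) + γ ^ 2))
      =O[𝓝[>] 0] fun γ : ℝ => γ ^ 2 := by
    refine ((hν.isBigO_four.add ?_).add (isBigO_refl _ _)).const_mul_left K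
    have := hid.mul ((hν.isBigO_two.add (hν.isBigO_four.trans sq_isBigO_id)).add hν.isBigO_pow)
    simpa only [← sq] using this
  refine IsBigO.trans (IsBigO.of_bound 1 ?_) hB
  filter_upwards [hA, hM, hR, hν.integrable_two, hν.integrable_four, hν.integrable_pow,
    hν.prob] with γ h1 h2 h3 i2 i4 ir hp
  have h5 := h1.sub h2
  rw [zero_sub] at h5
  have h6 := (((HasMean.of_integrable i4).add (((HasMean.of_integrable i2).add
    (HasMean.of_integrable i4)).add (HasMean.of_integrable ir) |>.const_mul γ)).add
    (HasMean.const (γ ^ 2))).const_mul K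
  rw [← norm_neg, ← h5.integral_eq, one_mul, ← h6.integral_eq]
  exact (norm_integral_le_of_norm_le h6.integrable (ae_of_all _ h3)).trans (le_abs_self _)

end SmallMoments

end SmallMoments

/-- An injective linear map of finite-dimensional spaces reflects bounds. -/
lemma isBigO_of_injective_linearMap {α V W : Type*} [NormedAddCommGroup V] [NormedSpace ℝ V]
    [FiniteDimensional ℝ V] [NormedAddCommGroup W] [NormedSpace ℝ W] {l : Filter α}
    (A : V →ₗ[ℝ] W) (hA : Function.Injective A) {y : α → V} {β : α → ℝ}
    (h : (fun a => A (y a)) =O[l] β) : y =O[l] β := by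
  obtain ⟨K, -, hK⟩ := A.exists_antilipschitzWith (LinearMap.ker_eq_bot.2 hA)
  refine IsBigO.trans (IsBigO.of_bound K (Eventually.of_forall fun a => ?_)) h
  simpa using hK.le_mul_norm (map_zero A) (y a)

section Stationary

variable {Ω : Type*} [MeasurableSpace Ω] {E : Type*} [NormedAddCommGroup E]
  [InnerProductSpace ℝ E] [FiniteDimensional ℝ E] [MeasurableSpace E] [BorelSpace E]
  {P : Measure Ω} [IsProbabilityMeasure P] {G : Ω → E → E} {g : E → E} {L μ : ℝ} {θs : E}

namespace CocoerciveField

variable (h : CocoerciveField P G g L μ θs)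
include h

/-- The mean drift of an integrable function vanishes under an invariant measure. -/
lemma hasMean_drift {γ : ℝ} (hγ : γ ≠ 0) {ν : Measure E} [IsProbabilityMeasure ν]
    (hν : push P G γ ν = ν) {φ A : E → ℝ} (hm : Measurable φ) (hφ : Integrable φ ν)
    (hA : ∀ θ, HasMean P (fun ω => φ (step G γ ω θ)) (φ θ - γ * A θ)) : HasMean ν A 0 := by
  have hφ' : Integrable φ (push P G γ ν) := by rwa [hν]
  have h1 : HasMean ν (fun θ => φ θ - γ * A θ) (∫ θ, φ θ ∂ν) := by
    have hi := (h.integrable_comp_step hm hφ').integral_prod_left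
    have he := h.integral_push hm hφ'
    rw [hν] at he
    refine HasMean.congr ⟨hi, he.symm⟩ (fun θ => (hA θ).integral_eq.symm) rfl
  refine (((HasMean.of_integrable hφ).sub h1).const_mul γ⁻¹).congr (fun θ => ?_) (by simp)
  field_simp
  ring

lemma norm_mean_le (θ : E) : ‖g θ‖ ≤ L * ‖θ - θs‖ := by
  have e : g θ = ∫ ω, (G ω θ - G ω θs) ∂P := by
    rw [integral_sub (h.integrable_field θ) (h.integrable_field θs), h.mean, h.mean, h.zero,
      sub_zero]
  rw [e]
  have := norm_integral_le_of_norm_le_const (μ := P) (f := fun ω => G ω θ - G ω θs)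
    (ae_of_all _ fun ω => h.norm_sub_le ω θ θs)
  simpa using this

/-- The uniform bounds are used for orders `2`, `4` and `2 * (n + 1)`. The last is weakened to
`O(γ)`, which suffices because it enters `remainderBound` with an extra factor `γ`. -/
theorem smallMoments {n : ℕ} (hn : 1 ≤ n)
    (hp : MemLp (fun ω => G ω θs) ((2 * (n + 1) : ℕ) : ENNReal) P) {ν : ℝ → Measure E}
    (hν : ∀ γ, 0 < γ → γ * L < 2 → IsProbabilityMeasure (ν γ) ∧ push P G γ (ν γ) = ν γ) :
    SmallMoments ν θs (2 * (n + 1)) := by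
  have hsmall : ∀ᶠ γ in 𝓝[>] (0 : ℝ), 0 < γ ∧ γ * L < 2 := by
    refine eventually_mem_nhdsWithin.and ?_
    refine eventually_nhdsWithin_of_eventually_nhds ?_
    have : Tendsto (fun γ : ℝ => γ * L) (𝓝 0) (𝓝 (0 * L)) := tendsto_id.mul_const L
    rw [zero_mul] at this
    exact this.eventually_lt_const two_pos
  have key : ∀ k, k ≤ n →
      (∀ᶠ γ in 𝓝[>] 0, Integrable (fun θ => ‖θ - θs‖ ^ (2 * (k + 1))) (ν γ)) ∧
      (fun γ => ∫ θ, ‖θ - θs‖ ^ (2 * (k + 1)) ∂(ν γ)) =O[𝓝[>] 0] fun γ : ℝ => γ ^ (k + 1) := by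
    intro k hk
    have hpk : MemLp (fun ω => G ω θs) ((2 * (k + 1) : ℕ) : ENNReal) P :=
      hp.mono_exponent (by exact_mod_cast (by omega : 2 * (k + 1) ≤ 2 * (n + 1)))
    obtain ⟨C, γ₀, hγ₀, hC⟩ := h.exists_moment_bound_norm k hpk
    have hev : ∀ᶠ γ in 𝓝[>] (0 : ℝ), Integrable (fun θ => ‖θ - θs‖ ^ (2 * (k + 1))) (ν γ) ∧
        ∫ θ, ‖θ - θs‖ ^ (2 * (k + 1)) ∂(ν γ) ≤ C * γ ^ (k + 1) := by
      filter_upwards [hsmall, Ioc_mem_nhdsGT hγ₀] with γ h1 h2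
      obtain ⟨h3, h4⟩ := hν γ h1.1 h1.2
      exact hC γ h2.1 h2.2 (ν γ) h3 h4
    refine ⟨hev.mono fun γ hγ => hγ.1, IsBigO.of_bound C ?_⟩
    filter_upwards [hev, hsmall] with γ h1 h2
    have := h2.1
    rw [Real.norm_of_nonneg (integral_nonneg fun θ => by positivity),
      Real.norm_of_nonneg (by positivity)]
    exact h1.2
  have h0 := key 0 (Nat.zero_le _)
  have h1 := key 1 hn
  have hn' := key n le_rfl
  refine ⟨?_, h0.1, h1.1, hn'.1, ?_, h1.2, hn'.2.trans ?_⟩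
  · filter_upwards [hsmall] with γ hγ using (hν γ hγ.1 hγ.2).1
  · simpa using h0.2
  · refine IsBigO.of_bound 1 ?_
    filter_upwards [Ioc_mem_nhdsGT (zero_lt_one' ℝ)] with γ hγ
    have := hγ.1
    rw [Real.norm_of_nonneg (by positivity), Real.norm_of_nonneg hγ.1.le, one_mul]
    exact pow_le_of_le_one hγ.1.le hγ.2 (by omega)

end CocoerciveField
end Stationary
end SGD

/-! ### Coercive operators on tensors and stationarity for monomials. -/

namespace SGD

section Expansion

variable {d : ℕ}

/-- Taylor expansions at `θs` of a mean field `g` and a covariance `C`, with linear part `H` and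
quadratic part `T` of the field. -/
structure TaylorData (g : EuclideanSpace ℝ (Fin d) → EuclideanSpace ℝ (Fin d))
    (C : EuclideanSpace ℝ (Fin d) → Matrix (Fin d) (Fin d) ℝ) (θs : EuclideanSpace ℝ (Fin d))
    (H : Matrix (Fin d) (Fin d) ℝ) (T : Fin d → Fin d → Fin d → ℝ) (μ K : ℝ) (n : ℕ) : Prop where
  pos : 0 < μ
  coercive : ∀ v : Fin d → ℝ, μ * ∑ i, v i ^ 2 ≤ ∑ i, ∑ j, v i * (H i j * v j)
  nonneg : 0 ≤ K
  first : ∀ θ l, |g θ l - ∑ i, H l i * (θ - θs) i| ≤ K * ‖θ - θs‖ ^ 2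
  second : ∀ θ l, |g θ l - ∑ i, H l i * (θ - θs) i
    - (1 / 2) * ∑ a, ∑ b, T a b l * ((θ - θs) a * (θ - θs) b)| ≤ K * ‖θ - θs‖ ^ 3
  third : ∃ Q : Fin d → Fin d → Fin d → Fin d → ℝ, ∀ θ l, |g θ l - ∑ i, H l i * (θ - θs) i
    - (1 / 2) * ∑ a, ∑ b, T a b l * ((θ - θs) a * (θ - θs) b)
    - ∑ a, ∑ b, ∑ c, Q a b c l * ((θ - θs) a * (θ - θs) b * (θ - θs) c)| ≤ K * ‖θ - θs‖ ^ 4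
  cov_first : ∀ θ i j, |C θ i j - C θs i j| ≤ K * ‖θ - θs‖ * (1 + ‖θ - θs‖ ^ (2 * n))
  cov_second : ∃ D : Fin d → Fin d → Fin d → ℝ, ∀ θ i j,
    |C θ i j - C θs i j - ∑ k, D i j k * (θ - θs) k| ≤
      K * ‖θ - θs‖ ^ 2 * (1 + ‖θ - θs‖ ^ (2 * n))

lemma abs_apply_le_norm (x : EuclideanSpace ℝ (Fin d)) (i : Fin d) : |x i| ≤ ‖x‖ :=
  PiLp.norm_apply_le x i

/-- The action of `H` on each of the three indices of a tensor. -/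
def tensorThree (H : Matrix (Fin d) (Fin d) ℝ) :
    (Fin d → Fin d → Fin d → ℝ) →ₗ[ℝ] (Fin d → Fin d → Fin d → ℝ) where
  toFun N i j k := ∑ a, H k a * N i j a + ∑ a, H j a * N i a k + ∑ a, H i a * N a j k
  map_add' N N' := by
    funext i j k
    simp only [Pi.add_apply, mul_add, Finset.sum_add_distrib]
    ring
  map_smul' c N := by
    funext i j k
    simp only [Pi.smul_apply, smul_eq_mul, RingHom.id_apply, mul_add, Finset.mul_sum,
      mul_left_comm]

lemma lyapunov_apply (H X : Matrix (Fin d) (Fin d) ℝ) : lyapunov H X = H * X + X * H := by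
  simp [lyapunov, tensor]

section Injective

variable {H : Matrix (Fin d) (Fin d) ℝ} {μ : ℝ} (hμ : 0 < μ)
  (hH : ∀ v : Fin d → ℝ, μ * ∑ i, v i ^ 2 ≤ ∑ i, ∑ j, v i * (H i j * v j))
include hμ hH

/-- Pairing the image of `N` with `N` gives at least `3 * μ` times the sum of squares: in each of
the three sums, coercivity of `H` is applied in the index that `H` acts on, with the other two
frozen. -/
lemma tensorThree_injective : Function.Injective (tensorThree H) := by
  rw [injective_iff_map_eq_zero]
  intro N hN
  have h0 : ∑ i, ∑ j, ∑ k, N i j k * tensorThree H N i j k = 0 := by simp [hN]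
  have h1 : μ * ∑ i, ∑ j, ∑ k, N i j k ^ 2 ≤ ∑ i, ∑ j, ∑ k, N i j k * ∑ a, H k a * N i j a := by
    simp only [Finset.mul_sum]
    refine Finset.sum_le_sum fun i _ => Finset.sum_le_sum fun j _ => ?_
    simpa only [Finset.mul_sum] using hH fun k => N i j k
  have h2 : μ * ∑ i, ∑ j, ∑ k, N i j k ^ 2 ≤ ∑ i, ∑ j, ∑ k, N i j k * ∑ a, H j a * N i a k := by
    simp only [Finset.mul_sum]
    refine Finset.sum_le_sum fun i _ => ?_
    rw [Finset.sum_comm, Finset.sum_comm (s := Finset.univ) (t := Finset.univ)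
      (f := fun j k => ∑ a, N i j k * (H j a * N i a k))]
    refine Finset.sum_le_sum fun k _ => ?_
    simpa only [Finset.mul_sum] using hH fun j => N i j k
  have h3 : μ * ∑ i, ∑ j, ∑ k, N i j k ^ 2 ≤ ∑ i, ∑ j, ∑ k, N i j k * ∑ a, H i a * N a j k := by
    simp only [Finset.mul_sum]
    rw [Finset.sum_comm, Finset.sum_comm (s := Finset.univ) (t := Finset.univ)
      (f := fun i j => ∑ k, ∑ a, N i j k * (H i a * N a j k))]
    refine Finset.sum_le_sum fun j _ => ?_
    rw [Finset.sum_comm, Finset.sum_comm (s := Finset.univ) (t := Finset.univ)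
      (f := fun i k => ∑ a, N i j k * (H i a * N a j k))]
    refine Finset.sum_le_sum fun k _ => ?_
    simpa only [Finset.mul_sum] using hH fun i => N i j k
  have h4 : ∑ i, ∑ j, ∑ k, N i j k * tensorThree H N i j k =
      ∑ i, ∑ j, ∑ k, N i j k * ∑ a, H k a * N i j a
      + ∑ i, ∑ j, ∑ k, N i j k * ∑ a, H j a * N i a k
      + ∑ i, ∑ j, ∑ k, N i j k * ∑ a, H i a * N a j k := by
    simp only [tensorThree, LinearMap.coe_mk, AddHom.coe_mk, mul_add, Finset.sum_add_distrib]
  have h5 : ∑ i, ∑ j, ∑ k, N i j k ^ 2 ≤ 0 := by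
    have : 3 * (μ * ∑ i, ∑ j, ∑ k, N i j k ^ 2) ≤ 0 := by linarith
    by_contra! hc
    have := mul_pos hμ hc
    linarith
  funext i j k
  have h6 : N i j k ^ 2 ≤ ∑ i, ∑ j, ∑ k, N i j k ^ 2 :=
    calc N i j k ^ 2 ≤ ∑ k, N i j k ^ 2 :=
          Finset.single_le_sum (f := fun k => N i j k ^ 2) (fun _ _ => sq_nonneg _)
            (Finset.mem_univ k)
      _ ≤ ∑ j, ∑ k, N i j k ^ 2 :=
          Finset.single_le_sum (f := fun j => ∑ k, N i j k ^ 2)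
            (fun _ _ => Finset.sum_nonneg fun _ _ => sq_nonneg _) (Finset.mem_univ j)
      _ ≤ _ := Finset.single_le_sum (f := fun i => ∑ j, ∑ k, N i j k ^ 2)
            (fun _ _ => Finset.sum_nonneg fun _ _ => Finset.sum_nonneg fun _ _ => sq_nonneg _)
            (Finset.mem_univ i)
  exact pow_eq_zero_iff two_ne_zero |>.1 (le_antisymm (h6.trans h5) (sq_nonneg _))

lemma mulVecLin_injective : Function.Injective H.mulVecLin := by
  rw [injective_iff_map_eq_zero]
  intro v hv
  have h0 : ∑ i, ∑ j, v i * (H i j * v j) = 0 := by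
    refine Finset.sum_eq_zero fun i _ => ?_
    rw [← Finset.mul_sum]
    have : ∑ j, H i j * v j = 0 := congrFun hv i
    rw [this, mul_zero]
  have h1 : ∑ i, v i ^ 2 ≤ 0 := by
    have h := hH v
    rw [h0] at h
    by_contra! hc
    have := mul_pos hμ hc
    linarith
  funext i
  have h2 : v i ^ 2 ≤ ∑ i, v i ^ 2 :=
    Finset.single_le_sum (f := fun i => v i ^ 2) (fun _ _ => sq_nonneg _) (Finset.mem_univ i)
  exact pow_eq_zero_iff two_ne_zero |>.1 (le_antisymm (h2.trans h1) (sq_nonneg _))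

lemma isUnit_of_coercive : IsUnit H :=
  Matrix.mulVec_injective_iff_isUnit.1 (mulVecLin_injective hμ hH)

/-- Left and right multiplication are each coercive for the entrywise pairing, by columns and by
rows respectively. Symmetry of `H` is needed for the right multiplication. -/
lemma lyapunov_injective (hsymm : ∀ i j, H i j = H j i) :
    Function.Injective (lyapunov H) := by
  rw [injective_iff_map_eq_zero]
  intro X hX
  have h0 : ∑ i, ∑ j, X i j * lyapunov H X i j = 0 := by simp [hX]
  have h1 : μ * ∑ i, ∑ j, X i j ^ 2 ≤ ∑ i, ∑ j, X i j * (H * X) i j := by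
    simp only [Finset.mul_sum, Matrix.mul_apply]
    rw [Finset.sum_comm, Finset.sum_comm (s := Finset.univ) (t := Finset.univ)
      (f := fun i j => ∑ a, X i j * (H i a * X a j))]
    refine Finset.sum_le_sum fun j _ => ?_
    simpa only [Finset.mul_sum] using hH fun i => X i j
  have h2 : μ * ∑ i, ∑ j, X i j ^ 2 ≤ ∑ i, ∑ j, X i j * (X * H) i j := by
    simp only [Finset.mul_sum, Matrix.mul_apply]
    refine Finset.sum_le_sum fun i _ => ?_
    refine le_trans (by simpa only [Finset.mul_sum] using hH fun j => X i j) (le_of_eq ?_)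
    refine Finset.sum_congr rfl fun j _ => Finset.sum_congr rfl fun a _ => ?_
    rw [hsymm j a, mul_comm (H a j)]
  have h4 : ∑ i, ∑ j, X i j * lyapunov H X i j =
      ∑ i, ∑ j, X i j * (H * X) i j + ∑ i, ∑ j, X i j * (X * H) i j := by
    simp only [lyapunov_apply, Matrix.add_apply, mul_add, Finset.sum_add_distrib]
  have h5 : ∑ i, ∑ j, X i j ^ 2 ≤ 0 := by
    have : 2 * (μ * ∑ i, ∑ j, X i j ^ 2) ≤ 0 := by linarith
    by_contra! hc
    have := mul_pos hμ hc
    linarith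
  ext i j
  have h6 : X i j ^ 2 ≤ ∑ i, ∑ j, X i j ^ 2 :=
    calc X i j ^ 2 ≤ ∑ j, X i j ^ 2 :=
          Finset.single_le_sum (f := fun j => X i j ^ 2) (fun _ _ => sq_nonneg _)
            (Finset.mem_univ j)
      _ ≤ _ := Finset.single_le_sum (f := fun i => ∑ j, X i j ^ 2)
            (fun _ _ => Finset.sum_nonneg fun _ _ => sq_nonneg _) (Finset.mem_univ i)
  exact pow_eq_zero_iff two_ne_zero |>.1 (le_antisymm (h6.trans h5) (sq_nonneg _))

lemma isUnit_lyapunov (hsymm : ∀ i j, H i j = H j i) : IsUnit (lyapunov H) := by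
  rw [Module.End.isUnit_iff]
  have := lyapunov_injective hμ hH hsymm
  exact ⟨this, LinearMap.injective_iff_surjective.1 this⟩

end Injective

variable {Ω : Type*} [MeasurableSpace Ω] {P : Measure Ω} [IsProbabilityMeasure P]
  {G : Ω → EuclideanSpace ℝ (Fin d) → EuclideanSpace ℝ (Fin d)}
  {g : EuclideanSpace ℝ (Fin d) → EuclideanSpace ℝ (Fin d)} {L μ : ℝ}
  {θs : EuclideanSpace ℝ (Fin d)}

lemma step_sub_apply (γ : ℝ) (ω : Ω) (θ : EuclideanSpace ℝ (Fin d)) (i : Fin d) :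
    (step G γ ω θ - θs) i = (θ - θs) i - γ * G ω θ i := by
  simp [step]; ring

section Integrable

variable {ν : Measure (EuclideanSpace ℝ (Fin d))} [IsProbabilityMeasure ν]

lemma integrable_coord (h2 : Integrable (fun θ => ‖θ - θs‖ ^ 2) ν) (i : Fin d) :
    Integrable (fun θ => (θ - θs) i) ν := by
  refine Integrable.mono' ((integrable_const 1).add h2) (by fun_prop) (ae_of_all _ fun θ => ?_)
  have := abs_apply_le_norm (θ - θs) i
  have h : ‖θ - θs‖ ≤ 1 + ‖θ - θs‖ ^ 2 := by nlinarith [sq_nonneg (‖θ - θs‖ - 1)]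
  exact this.trans h

lemma integrable_coord_two (h2 : Integrable (fun θ => ‖θ - θs‖ ^ 2) ν) (i j : Fin d) :
    Integrable (fun θ => (θ - θs) i * (θ - θs) j) ν := by
  refine Integrable.mono' h2 (by fun_prop) (ae_of_all _ fun θ => ?_)
  rw [norm_mul, sq]
  gcongr <;> exact abs_apply_le_norm (θ - θs) _

lemma integrable_coord_three (h2 : Integrable (fun θ => ‖θ - θs‖ ^ 2) ν)
    (h4 : Integrable (fun θ => ‖θ - θs‖ ^ 4) ν) (i j k : Fin d) :
    Integrable (fun θ => (θ - θs) i * (θ - θs) j * (θ - θs) k) ν := by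
  refine Integrable.mono' (h2.add h4) (by fun_prop) (ae_of_all _ fun θ => ?_)
  rw [norm_mul, norm_mul]
  calc ‖(θ - θs) i‖ * ‖(θ - θs) j‖ * ‖(θ - θs) k‖
      ≤ ‖θ - θs‖ * ‖θ - θs‖ * ‖θ - θs‖ := by gcongr <;> exact abs_apply_le_norm (θ - θs) _
    _ ≤ ‖θ - θs‖ ^ 2 + ‖θ - θs‖ ^ 4 := by nlinarith [sq_nonneg (‖θ - θs‖ ^ 2 - ‖θ - θs‖)]

end Integrable

namespace CocoerciveField

variable (h : CocoerciveField P G g L μ θs)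
include h

lemma hasMean_field (θ : EuclideanSpace ℝ (Fin d)) (i : Fin d) :
    HasMean P (fun ω => G ω θ i) (g θ i) := by
  have := ContinuousLinearMap.integral_comp_comm (EuclideanSpace.proj (𝕜 := ℝ) i)
    (h.integrable_field θ)
  rw [h.mean] at this
  exact ⟨(EuclideanSpace.proj (𝕜 := ℝ) i).integrable_comp (h.integrable_field θ), this⟩

section Cov

variable {C : EuclideanSpace ℝ (Fin d) → Matrix (Fin d) (Fin d) ℝ}
  (hC : ∀ θ i j, HasMean P (fun ω => (G ω θ i - g θ i) * (G ω θ j - g θ j)) (C θ i j))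

include hC in
lemma hasMean_field_two (θ : EuclideanSpace ℝ (Fin d)) (i j : Fin d) :
    HasMean P (fun ω => G ω θ i * G ω θ j) (g θ i * g θ j + C θ i j) :=
  (((hC θ i j).add (((h.hasMean_field θ j).const_mul (g θ i)).add
    ((h.hasMean_field θ i).const_mul (g θ j)))).sub (HasMean.const (g θ i * g θ j))).congr
    (fun ω => by ring) (by ring)

lemma integrable_norm_pow_three (hp : MemLp (fun ω => G ω θs) 3 P)
    (θ : EuclideanSpace ℝ (Fin d)) : Integrable (fun ω => ‖G ω θ‖ ^ 3) P :=
  (h.memLp_field hp θ).integrable_norm_pow (p := 3) (by norm_num)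

lemma abs_field_three_le (ω : Ω) (θ : EuclideanSpace ℝ (Fin d)) (i j k : Fin d) :
    ‖G ω θ i * G ω θ j * G ω θ k‖ ≤ ‖G ω θ‖ ^ 3 := by
  rw [norm_mul, norm_mul, pow_succ, sq]
  gcongr <;> exact PiLp.norm_apply_le _ _

lemma hasMean_field_three (hp : MemLp (fun ω => G ω θs) 3 P) (θ : EuclideanSpace ℝ (Fin d))
    (i j k : Fin d) : HasMean P (fun ω => G ω θ i * G ω θ j * G ω θ k)
      (∫ ω, G ω θ i * G ω θ j * G ω θ k ∂P) := by
  refine HasMean.of_integrable ?_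
  refine Integrable.mono' (h.integrable_norm_pow_three hp θ) ?_
    (ae_of_all _ fun ω => h.abs_field_three_le ω θ i j k)
  have := h.measurable_field θ
  fun_prop

/-- The growth is cubic by the Lipschitz bound; the cube is traded for even powers, which the
available moments control. -/
lemma exists_abs_integral_three_le (hp : MemLp (fun ω => G ω θs) 3 P) :
    ∃ B, 0 ≤ B ∧ ∀ θ i j k,
      |∫ ω, G ω θ i * G ω θ j * G ω θ k ∂P| ≤ B * (1 + ‖θ - θs‖ ^ 2 + ‖θ - θs‖ ^ 4) := by
  have hL := h.nonneg
  have i3 := h.integrable_norm_pow_three hp θs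
  set e := ∫ ω, ‖G ω θs‖ ^ 3 ∂P with he
  have he0 : 0 ≤ e := integral_nonneg fun ω => by positivity
  refine ⟨4 * (L ^ 3 + e), by positivity, fun θ i j k => ?_⟩
  have hb : ∀ ω, ‖G ω θ i * G ω θ j * G ω θ k‖ ≤ 4 * ((L * ‖θ - θs‖) ^ 3 + ‖G ω θs‖ ^ 3) :=
    fun ω => by
    refine (h.abs_field_three_le ω θ i j k).trans ?_
    have h1 : ‖G ω θ‖ ^ 3 ≤ (L * ‖θ - θs‖ + ‖G ω θs‖) ^ 3 := by
      gcongr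
      exact h.norm_le ω θ
    refine h1.trans ((add_pow_le (by positivity) (norm_nonneg _) 3).trans (le_of_eq ?_))
    norm_num
  have hm := ((HasMean.const (ν := P) ((L * ‖θ - θs‖) ^ 3)).add
    (HasMean.of_integrable i3)).const_mul 4
  refine (norm_integral_le_of_norm_le hm.integrable (ae_of_all _ hb)).trans ?_
  rw [hm.integral_eq, ← he, mul_pow]
  have h2 : ‖θ - θs‖ ^ 3 ≤ ‖θ - θs‖ ^ 2 + ‖θ - θs‖ ^ 4 := by
    nlinarith [sq_nonneg (‖θ - θs‖ ^ 2 - ‖θ - θs‖)]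
  have h3 : L ^ 3 * ‖θ - θs‖ ^ 3 ≤ L ^ 3 * (‖θ - θs‖ ^ 2 + ‖θ - θs‖ ^ 4) := by gcongr
  have h4 : 0 ≤ e * (‖θ - θs‖ ^ 2 + ‖θ - θs‖ ^ 4) := by positivity
  have h5 : 0 ≤ L ^ 3 := by positivity
  nlinarith

variable {γ : ℝ} (hγ : γ ≠ 0) {ν : Measure (EuclideanSpace ℝ (Fin d))} [IsProbabilityMeasure ν]
  (hν : push P G γ ν = ν) (h2 : Integrable (fun θ => ‖θ - θs‖ ^ 2) ν)
  (h4 : Integrable (fun θ => ‖θ - θs‖ ^ 4) ν)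
include hγ hν h2

lemma stationary_one (i : Fin d) : HasMean ν (fun θ => g θ i) 0 := by
  refine h.hasMean_drift hγ hν (φ := fun θ => (θ - θs) i) (by fun_prop)
    (integrable_coord h2 i) fun θ => ?_
  exact ((HasMean.const _).sub ((h.hasMean_field θ i).const_mul γ)).congr
    (fun ω => step_sub_apply γ ω θ i) rfl

include hC

lemma stationary_two (i j : Fin d) :
    HasMean ν (fun θ => (θ - θs) i * g θ j + g θ i * (θ - θs) j
      - γ * (g θ i * g θ j + C θ i j)) 0 := by
  refine h.hasMean_drift hγ hν (φ := fun θ => (θ - θs) i * (θ - θs) j) (by fun_prop)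
    (integrable_coord_two h2 i j) fun θ => ?_
  refine ((HasMean.const ((θ - θs) i * (θ - θs) j)).sub (((((h.hasMean_field θ j).const_mul
    ((θ - θs) i)).add ((h.hasMean_field θ i).const_mul ((θ - θs) j))).sub
    ((h.hasMean_field_two hC θ i j).const_mul γ)).const_mul γ)).congr (fun ω => ?_) (by ring)
  rw [step_sub_apply, step_sub_apply]
  ring

include h4

/-- The powers of `γ` count the factors of the field in the expanded product, less one for the
division by `γ`. The third moment of the field needs only a bound, as it comes with `γ ^ 2`. -/
lemma stationary_three (hp : MemLp (fun ω => G ω θs) 3 P) (i j k : Fin d) :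
    HasMean ν (fun θ => (θ - θs) i * (θ - θs) j * g θ k + (θ - θs) i * g θ j * (θ - θs) k
      + g θ i * (θ - θs) j * (θ - θs) k
      - γ * ((θ - θs) i * (g θ j * g θ k + C θ j k) + (θ - θs) j * (g θ i * g θ k + C θ i k)
        + (θ - θs) k * (g θ i * g θ j + C θ i j))
      + γ ^ 2 * ∫ ω, G ω θ i * G ω θ j * G ω θ k ∂P) 0 := by
  refine h.hasMean_drift hγ hν (φ := fun θ => (θ - θs) i * (θ - θs) j * (θ - θs) k) (by fun_prop)
    (integrable_coord_three h2 h4 i j k) fun θ => ?_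
  have a1 := (((h.hasMean_field θ k).const_mul ((θ - θs) i * (θ - θs) j)).add
    ((h.hasMean_field θ j).const_mul ((θ - θs) i * (θ - θs) k))).add
    ((h.hasMean_field θ i).const_mul ((θ - θs) j * (θ - θs) k))
  have a2 := (((h.hasMean_field_two hC θ j k).const_mul ((θ - θs) i)).add
    ((h.hasMean_field_two hC θ i k).const_mul ((θ - θs) j))).add
    ((h.hasMean_field_two hC θ i j).const_mul ((θ - θs) k))
  refine ((HasMean.const ((θ - θs) i * (θ - θs) j * (θ - θs) k)).sub (((a1.sub
    (a2.const_mul γ)).add ((h.hasMean_field_three hp θ i j k).const_mul (γ ^ 2))).const_mul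
    γ)).congr (fun ω => ?_) (by ring)
  rw [step_sub_apply, step_sub_apply, step_sub_apply]
  ring

end Cov
end CocoerciveField
end Expansion
end SGD

/-! ### Orders of the stationary bias, third moments and second moments. -/

namespace SGD

section Asymptotics

variable {d : ℕ} {Ω : Type*} [MeasurableSpace Ω] {P : Measure Ω} [IsProbabilityMeasure P]
  {G : Ω → EuclideanSpace ℝ (Fin d) → EuclideanSpace ℝ (Fin d)}
  {g : EuclideanSpace ℝ (Fin d) → EuclideanSpace ℝ (Fin d)} {L μ μ' : ℝ}
  {θs : EuclideanSpace ℝ (Fin d)}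
  {C : EuclideanSpace ℝ (Fin d) → Matrix (Fin d) (Fin d) ℝ}
  {H : Matrix (Fin d) (Fin d) ℝ} {T : Fin d → Fin d → Fin d → ℝ} {K : ℝ} {n : ℕ}
  {ν : ℝ → Measure (EuclideanSpace ℝ (Fin d))}

lemma abs_mul_mul_le {x y z a b c : ℝ} (hx : |x| ≤ a) (hy : |y| ≤ b) (hz : |z| ≤ c) :
    |x * y * z| ≤ a * b * c := by
  rw [abs_mul, abs_mul]
  have := abs_nonneg x
  have := abs_nonneg y
  have := abs_nonneg z
  have := this.trans hz
  have : 0 ≤ b := (abs_nonneg y).trans hy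
  have : 0 ≤ a := (abs_nonneg x).trans hx
  gcongr

lemma abs_mul_le_mul {x y a b : ℝ} (hx : |x| ≤ a) (hy : |y| ≤ b) : |x * y| ≤ a * b := by
  rw [abs_mul]
  have := abs_nonneg x
  have := abs_nonneg y
  gcongr
  linarith

lemma cubic_remainder_le {B γ u z : ℝ} (hK : 0 ≤ K) (hB : 0 ≤ B) (hγ0 : 0 ≤ γ) (hγ1 : γ ≤ 1)
    (hz : 0 ≤ z) :
    3 * (u * u * (K * u ^ 2)) + γ * (3 * (u * (L * u) * (L * u)) + 3 * (u * (K * u * (1 + z))))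
      + γ ^ 2 * (B * (1 + u ^ 2 + u ^ 4)) ≤
    (3 * K + 3 * L ^ 2 + B) * (u ^ 4 + γ * (u ^ 2 + u ^ 4 + u ^ 2 * z) + γ ^ 2) := by
  have f1 : u ^ 3 ≤ u ^ 2 + u ^ 4 := by nlinarith [sq_nonneg (u ^ 2 - u)]
  have f2 : 3 * L ^ 2 * (γ * u ^ 3) ≤ 3 * L ^ 2 * (γ * (u ^ 2 + u ^ 4)) := by gcongr
  have f3 : B * (γ ^ 2 * (u ^ 2 + u ^ 4)) ≤ B * (γ * (u ^ 2 + u ^ 4)) := by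
    have : γ ^ 2 ≤ γ := pow_le_of_le_one hγ0 hγ1 two_ne_zero
    gcongr
  have f4 : 0 ≤ 3 * K * (γ * u ^ 4 + γ ^ 2) + 3 * L ^ 2 * (u ^ 4 + γ * (u ^ 2 * z) + γ ^ 2)
      + B * (u ^ 4 + γ * (u ^ 2 * z)) := by positivity
  calc _ = 3 * K * (u ^ 4 + γ * (u ^ 2 + u ^ 2 * z)) + 3 * L ^ 2 * (γ * u ^ 3)
        + (B * γ ^ 2 + B * (γ ^ 2 * (u ^ 2 + u ^ 4))) := by ring
    _ ≤ 3 * K * (u ^ 4 + γ * (u ^ 2 + u ^ 2 * z)) + 3 * L ^ 2 * (γ * (u ^ 2 + u ^ 4))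
        + (B * γ ^ 2 + B * (γ * (u ^ 2 + u ^ 4))) := by gcongr
    _ ≤ 3 * K * (u ^ 4 + γ * (u ^ 2 + u ^ 2 * z)) + 3 * L ^ 2 * (γ * (u ^ 2 + u ^ 4))
        + (B * γ ^ 2 + B * (γ * (u ^ 2 + u ^ 4))) + (3 * K * (γ * u ^ 4 + γ ^ 2)
          + 3 * L ^ 2 * (u ^ 4 + γ * (u ^ 2 * z) + γ ^ 2) + B * (u ^ 4 + γ * (u ^ 2 * z))) :=
        le_add_of_nonneg_right f4
    _ = _ := by ring

namespace CocoerciveField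

variable (h : CocoerciveField P G g L μ' θs) (t : TaylorData g C θs H T μ K n)
  (hm : SmallMoments ν θs (2 * (n + 1)))
  (hν : ∀ᶠ γ in 𝓝[>] 0, push P G γ (ν γ) = ν γ)
  (hC : ∀ θ i j, HasMean P (fun ω => (G ω θ i - g θ i) * (G ω θ j - g θ j)) (C θ i j))
include h t hm hν

/-- A mean-zero field with a quadratic Taylor remainder makes `H` times the bias `O(γ)`. This crude
bound is what the identities of degree two and three need, since the bias appears there multiplied
by `γ`. -/
lemma isBigO_mean : (fun γ i => ∫ θ, (θ - θs) i ∂(ν γ)) =O[𝓝[>] 0] fun γ : ℝ => γ := by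
  refine isBigO_of_injective_linearMap H.mulVecLin (mulVecLin_injective t.pos t.coercive) ?_
  rw [isBigO_pi]
  intro l
  refine hm.isBigO_of_bound_sq (A := fun _ θ => g θ l)
    (M := fun _ θ => ∑ i, H l i * (θ - θs) i) (K := K) ?_ ?_
    (Eventually.of_forall fun γ θ => t.first θ l)
  · filter_upwards [hν, hm.prob, hm.integrable_two, eventually_mem_nhdsWithin] with γ h1 h2 h3 h4
    exact h.stationary_one (ne_of_gt h4) h1 h3 l
  · filter_upwards [hm.prob, hm.integrable_two] with γ h2 h3
    exact HasMean.sum fun i _ => (HasMean.of_integrable (integrable_coord h3 i)).const_mul _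

include hC

/-- The leading part of the degree three identity is `tensorThree H` applied to the moments. The
remainders are of fourth order in the distance or carry `γ` with at least a squared distance, or
carry `γ ^ 2`; freezing the covariance at `θs` leaves `γ` times the bias. -/
lemma isBigO_third_moment (hp : MemLp (fun ω => G ω θs) 3 P) :
    (fun γ i j k => ∫ θ, (θ - θs) i * (θ - θs) j * (θ - θs) k ∂(ν γ))
      =O[𝓝[>] 0] fun γ : ℝ => γ ^ 2 := by
  refine isBigO_of_injective_linearMap (tensorThree H) (tensorThree_injective t.pos t.coercive) ?_
  rw [isBigO_pi]
  intro i
  rw [isBigO_pi]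
  intro j
  rw [isBigO_pi]
  intro k
  obtain ⟨B, hB0, hB⟩ := h.exists_abs_integral_three_le hp
  have hL := h.nonneg
  have hK := t.nonneg
  have hmean := isBigO_pi.1 (h.isBigO_mean t hm hν)
  have hid : (fun γ : ℝ => γ) =O[𝓝[>] 0] fun γ : ℝ => γ := isBigO_refl _ _
  have hlin : (fun γ : ℝ => γ * (C θs j k * ∫ θ, (θ - θs) i ∂(ν γ)
      + C θs i k * ∫ θ, (θ - θs) j ∂(ν γ) + C θs i j * ∫ θ, (θ - θs) k ∂(ν γ)))
      =O[𝓝[>] 0] fun γ : ℝ => γ ^ 2 := by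
    have := hid.mul ((((hmean i).const_mul_left (C θs j k)).add
      ((hmean j).const_mul_left (C θs i k))).add ((hmean k).const_mul_left (C θs i j)))
    simpa only [← sq] using this
  have hmain := hm.isBigO_of_remainderBound (K := 3 * K + 3 * L ^ 2 + B)
    (A := fun γ θ => (θ - θs) i * (θ - θs) j * g θ k + (θ - θs) i * g θ j * (θ - θs) k
      + g θ i * (θ - θs) j * (θ - θs) k
      - γ * ((θ - θs) i * (g θ j * g θ k + C θ j k) + (θ - θs) j * (g θ i * g θ k + C θ i k)
        + (θ - θs) k * (g θ i * g θ j + C θ i j))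
      + γ ^ 2 * ∫ ω, G ω θ i * G ω θ j * G ω θ k ∂P)
    (M := fun γ θ => (∑ a, H k a * ((θ - θs) i * (θ - θs) j * (θ - θs) a)
      + ∑ a, H j a * ((θ - θs) i * (θ - θs) a * (θ - θs) k)
      + ∑ a, H i a * ((θ - θs) a * (θ - θs) j * (θ - θs) k))
      - γ * (C θs j k * (θ - θs) i + C θs i k * (θ - θs) j + C θs i j * (θ - θs) k))
    (v := fun γ => tensorThree H (fun i j k => ∫ θ, (θ - θs) i * (θ - θs) j * (θ - θs) k ∂(ν γ))
      i j k - γ * (C θs j k * ∫ θ, (θ - θs) i ∂(ν γ)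
      + C θs i k * ∫ θ, (θ - θs) j ∂(ν γ) + C θs i j * ∫ θ, (θ - θs) k ∂(ν γ)))
    ?_ ?_ ?_
  · simpa using hmain.add hlin
  · filter_upwards [hν, hm.prob, hm.integrable_two, hm.integrable_four,
      eventually_mem_nhdsWithin] with γ h1 h2 h3 h4 h5
    exact h.stationary_three hC (ne_of_gt h5) h1 h3 h4 hp i j k
  · filter_upwards [hm.prob, hm.integrable_two, hm.integrable_four] with γ h1 h2 h4
    have m3 : ∀ i j k, HasMean (ν γ) (fun θ => (θ - θs) i * (θ - θs) j * (θ - θs) k) _ :=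
      fun i j k => HasMean.of_integrable (integrable_coord_three h2 h4 i j k)
    have m1 : ∀ i, HasMean (ν γ) (fun θ => (θ - θs) i) _ :=
      fun i => HasMean.of_integrable (integrable_coord h2 i)
    exact (((HasMean.sum fun a _ => (m3 i j a).const_mul _).add
      (HasMean.sum fun a _ => (m3 i a k).const_mul _)).add
      (HasMean.sum fun a _ => (m3 a j k).const_mul _)).sub
      (((((m1 i).const_mul _).add ((m1 j).const_mul _)).add ((m1 k).const_mul _)).const_mul γ)
  · filter_upwards [Ioc_mem_nhdsGT (zero_lt_one' ℝ)] with γ hγ θ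
    obtain ⟨hγ0, hγ1⟩ := hγ
    set x := θ - θs with hx
    set u := ‖x‖ with hu
    have hu0 : 0 ≤ u := norm_nonneg _
    have hxi : ∀ i, |x i| ≤ u := abs_apply_le_norm x
    have hgi : ∀ i, |g θ i| ≤ L * u := fun i => (abs_apply_le_norm _ i).trans (h.norm_mean_le θ)
    have hR := t.first θ
    have hS := t.cov_first θ
    have hΘ := hB θ i j k
    set Θ := ∫ ω, G ω θ i * G ω θ j * G ω θ k ∂P
    rw [← hx, ← hu] at hΘ
    simp only [← hx, ← hu] at hR hS
    have e : ∀ c l, ∑ a, H l a * (c * x a) = c * ∑ a, H l a * x a := fun c l => by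
      rw [Finset.mul_sum]
      exact Finset.sum_congr rfl fun a _ => by ring
    have e1 : ∑ a, H k a * (x i * x j * x a) = x i * x j * ∑ a, H k a * x a := e _ _
    have e2 : ∑ a, H j a * (x i * x a * x k) = x i * x k * ∑ a, H j a * x a := by
      rw [← e]; exact Finset.sum_congr rfl fun a _ => by ring
    have e3 : ∑ a, H i a * (x a * x j * x k) = x j * x k * ∑ a, H i a * x a := by
      rw [← e]; exact Finset.sum_congr rfl fun a _ => by ring
    rw [e1, e2, e3]
    have b1 := abs_mul_mul_le (hxi i) (hxi j) (hR k)
    have b2 := abs_mul_mul_le (hxi i) (hxi k) (hR j)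
    have b3 := abs_mul_mul_le (hxi j) (hxi k) (hR i)
    have c1 := abs_mul_mul_le (hxi i) (hgi j) (hgi k)
    have c2 := abs_mul_mul_le (hxi j) (hgi i) (hgi k)
    have c3 := abs_mul_mul_le (hxi k) (hgi i) (hgi j)
    have d1 := abs_mul_le_mul (hxi i) (hS j k)
    have d2 := abs_mul_le_mul (hxi j) (hS i k)
    have d3 := abs_mul_le_mul (hxi k) (hS i j)
    set Rk := g θ k - ∑ a, H k a * x a with hRk
    set Rj := g θ j - ∑ a, H j a * x a with hRj
    set Ri := g θ i - ∑ a, H i a * x a with hRi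
    -- The error splits into the linearization error of the field, products of two mean fields, the
    -- variation of the covariance, and the third moment of the field.
    have split : x i * x j * g θ k + x i * g θ j * x k + g θ i * x j * x k
        - γ * (x i * (g θ j * g θ k + C θ j k) + x j * (g θ i * g θ k + C θ i k)
          + x k * (g θ i * g θ j + C θ i j)) + γ ^ 2 * Θ
        - (x i * x j * ∑ a, H k a * x a + x i * x k * ∑ a, H j a * x a
          + x j * x k * ∑ a, H i a * x a - γ * (C θs j k * x i + C θs i k * x j + C θs i j * x k))
        = (x i * x j * Rk + x i * x k * Rj + x j * x k * Ri)
          - γ * ((x i * g θ j * g θ k + x j * g θ i * g θ k + x k * g θ i * g θ j)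
            + (x i * (C θ j k - C θs j k) + x j * (C θ i k - C θs i k)
              + x k * (C θ i j - C θs i j))) + γ ^ 2 * Θ := by
      rw [hRk, hRj, hRi]; ring
    rw [split]
    have B1 : |x i * x j * Rk + x i * x k * Rj + x j * x k * Ri| ≤ 3 * (u * u * (K * u ^ 2)) :=
      (abs_add_three _ _ _).trans (by linarith)
    have B2 : |x i * g θ j * g θ k + x j * g θ i * g θ k + x k * g θ i * g θ j| ≤
        3 * (u * (L * u) * (L * u)) := (abs_add_three _ _ _).trans (by linarith)
    have B3 : |x i * (C θ j k - C θs j k) + x j * (C θ i k - C θs i k)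
        + x k * (C θ i j - C θs i j)| ≤ 3 * (u * (K * u * (1 + u ^ (2 * n)))) :=
      (abs_add_three _ _ _).trans (by linarith)
    have B4 : |γ * ((x i * g θ j * g θ k + x j * g θ i * g θ k + x k * g θ i * g θ j)
            + (x i * (C θ j k - C θs j k) + x j * (C θ i k - C θs i k)
              + x k * (C θ i j - C θs i j)))| ≤
        γ * (3 * (u * (L * u) * (L * u)) + 3 * (u * (K * u * (1 + u ^ (2 * n))))) := by
      rw [abs_mul, abs_of_pos hγ0]
      gcongr
      exact (abs_add_le _ _).trans (add_le_add B2 B3)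
    have B5 : |γ ^ 2 * Θ| ≤ γ ^ 2 * (B * (1 + u ^ 2 + u ^ 4)) := by
      rw [abs_mul, abs_of_nonneg (sq_nonneg γ)]
      gcongr
    refine (abs_add_le _ _).trans ((add_le_add ((abs_sub _ _).trans (add_le_add B1 B4)) B5).trans
      ?_)
    have hr : u ^ (2 * (n + 1)) = u ^ 2 * u ^ (2 * n) := by ring
    rw [remainderBound, hr]
    exact cubic_remainder_le hK hB0 hγ0.le hγ1 (by positivity)

/-- The quadratic part of the field yields third moments, and the linear part of the covariance
yields `γ` times the bias. Both are `O(γ ^ 2)`, so only `H` and the covariance at `θs` survive. -/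
lemma isBigO_second_moment (hp : MemLp (fun ω => G ω θs) 3 P) (i j : Fin d) :
    (fun γ => ∑ a, H j a * ∫ θ, (θ - θs) i * (θ - θs) a ∂(ν γ)
      + ∑ a, H i a * ∫ θ, (θ - θs) a * (θ - θs) j ∂(ν γ) - γ * C θs i j)
      =O[𝓝[>] 0] fun γ : ℝ => γ ^ 2 := by
  obtain ⟨D, hD⟩ := t.cov_second
  have hL := h.nonneg
  have hK := t.nonneg
  have hmean := isBigO_pi.1 (h.isBigO_mean t hm hν)
  have hid : (fun γ : ℝ => γ) =O[𝓝[>] 0] fun γ : ℝ => γ := isBigO_refl _ _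
  have hthird : ∀ i j k, (fun γ => ∫ θ, (θ - θs) i * (θ - θs) j * (θ - θs) k ∂(ν γ))
      =O[𝓝[>] 0] fun γ : ℝ => γ ^ 2 := fun i j k =>
    isBigO_pi.1 (isBigO_pi.1 (isBigO_pi.1 (h.isBigO_third_moment t hm hν hC hp) i) j) k
  have hlin : (fun γ : ℝ => γ * ∑ k, D i j k * ∫ θ, (θ - θs) k ∂(ν γ))
      =O[𝓝[>] 0] fun γ : ℝ => γ ^ 2 := by
    have := hid.mul (IsBigO.fun_sum (s := Finset.univ) fun k _ => (hmean k).const_mul_left (D i j k))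
    simpa only [← sq] using this
  have hcub : (fun γ : ℝ => (1 / 2) * (∑ a, ∑ b, T a b j *
      ∫ θ, (θ - θs) a * (θ - θs) b * (θ - θs) i ∂(ν γ) + ∑ a, ∑ b, T a b i *
      ∫ θ, (θ - θs) a * (θ - θs) b * (θ - θs) j ∂(ν γ))) =O[𝓝[>] 0] fun γ : ℝ => γ ^ 2 :=
    ((IsBigO.fun_sum fun a _ => IsBigO.fun_sum fun b _ => (hthird a b i).const_mul_left _).add
      (IsBigO.fun_sum fun a _ => IsBigO.fun_sum fun b _ => (hthird a b j).const_mul_left _)).const_mul_left _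
  have hmain := hm.isBigO_of_remainderBound (K := 2 * K + (L ^ 2 + K))
    (A := fun γ θ => (θ - θs) i * g θ j + g θ i * (θ - θs) j
      - γ * (g θ i * g θ j + C θ i j))
    (M := fun γ θ => ∑ a, H j a * ((θ - θs) i * (θ - θs) a)
      + ∑ a, H i a * ((θ - θs) a * (θ - θs) j)
      + (1 / 2) * (∑ a, ∑ b, T a b j * ((θ - θs) a * (θ - θs) b * (θ - θs) i)
        + ∑ a, ∑ b, T a b i * ((θ - θs) a * (θ - θs) b * (θ - θs) j))
      - γ * (C θs i j + ∑ k, D i j k * (θ - θs) k))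
    (v := fun γ => ∑ a, H j a * ∫ θ, (θ - θs) i * (θ - θs) a ∂(ν γ)
      + ∑ a, H i a * ∫ θ, (θ - θs) a * (θ - θs) j ∂(ν γ)
      + (1 / 2) * (∑ a, ∑ b, T a b j * ∫ θ, (θ - θs) a * (θ - θs) b * (θ - θs) i ∂(ν γ)
        + ∑ a, ∑ b, T a b i * ∫ θ, (θ - θs) a * (θ - θs) b * (θ - θs) j ∂(ν γ))
      - γ * (C θs i j + ∑ k, D i j k * ∫ θ, (θ - θs) k ∂(ν γ)))
    ?_ ?_ ?_
  · refine ((hmain.sub hcub).add hlin).congr_left fun γ => ?_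
    ring
  · filter_upwards [hν, hm.prob, hm.integrable_two, eventually_mem_nhdsWithin] with γ h1 h2 h3 h5
    exact h.stationary_two hC (ne_of_gt h5) h1 h3 i j
  · filter_upwards [hm.prob, hm.integrable_two, hm.integrable_four] with γ h1 h2 h4
    have m3 : ∀ i j k, HasMean (ν γ) (fun θ => (θ - θs) i * (θ - θs) j * (θ - θs) k) _ :=
      fun i j k => HasMean.of_integrable (integrable_coord_three h2 h4 i j k)
    have m2 : ∀ i j, HasMean (ν γ) (fun θ => (θ - θs) i * (θ - θs) j) _ :=
      fun i j => HasMean.of_integrable (integrable_coord_two h2 i j)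
    have m1 : ∀ i, HasMean (ν γ) (fun θ => (θ - θs) i) _ :=
      fun i => HasMean.of_integrable (integrable_coord h2 i)
    exact (((HasMean.sum fun a _ => (m2 i a).const_mul _).add
      (HasMean.sum fun a _ => (m2 a j).const_mul _)).add
      (((HasMean.sum fun a _ => HasMean.sum fun b _ => (m3 a b i).const_mul _).add
        (HasMean.sum fun a _ => HasMean.sum fun b _ => (m3 a b j).const_mul _)).const_mul _)).sub
      (((HasMean.const _).add (HasMean.sum fun k _ => (m1 k).const_mul _)).const_mul γ)
  · filter_upwards [Ioc_mem_nhdsGT (zero_lt_one' ℝ)] with γ hγ θ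
    obtain ⟨hγ0, hγ1⟩ := hγ
    set x := θ - θs with hx
    set u := ‖x‖ with hu
    have hu0 : 0 ≤ u := norm_nonneg _
    have hxi : ∀ i, |x i| ≤ u := abs_apply_le_norm x
    have hgi : ∀ i, |g θ i| ≤ L * u := fun i => (abs_apply_le_norm _ i).trans (h.norm_mean_le θ)
    have hR := t.second θ
    have hS := hD θ i j
    simp only [← hx, ← hu] at hR hS
    have e1 : ∑ a, H j a * (x i * x a) = x i * ∑ a, H j a * x a := by
      rw [Finset.mul_sum]; exact Finset.sum_congr rfl fun a _ => by ring
    have e2 : ∑ a, H i a * (x a * x j) = x j * ∑ a, H i a * x a := by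
      rw [Finset.mul_sum]; exact Finset.sum_congr rfl fun a _ => by ring
    have e3 : ∀ l m, ∑ a, ∑ b, T a b l * (x a * x b * x m) =
        x m * ∑ a, ∑ b, T a b l * (x a * x b) := fun l m => by
      simp only [Finset.mul_sum]
      exact Finset.sum_congr rfl fun a _ => Finset.sum_congr rfl fun b _ => by ring
    rw [e1, e2, e3, e3]
    have b1 := abs_mul_le_mul (hxi i) (hR j)
    have b2 := abs_mul_le_mul (hxi j) (hR i)
    have c1 := abs_mul_le_mul (hgi i) (hgi j)
    set Rj := g θ j - ∑ a, H j a * x a - 1 / 2 * ∑ a, ∑ b, T a b j * (x a * x b) with hRj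
    set Ri := g θ i - ∑ a, H i a * x a - 1 / 2 * ∑ a, ∑ b, T a b i * (x a * x b) with hRi
    set S := C θ i j - C θs i j - ∑ k, D i j k * x k with hSS
    have split : x i * g θ j + g θ i * x j - γ * (g θ i * g θ j + C θ i j)
        - (x i * ∑ a, H j a * x a + x j * ∑ a, H i a * x a
          + 1 / 2 * (x i * ∑ a, ∑ b, T a b j * (x a * x b)
            + x j * ∑ a, ∑ b, T a b i * (x a * x b)) - γ * (C θs i j + ∑ k, D i j k * x k))
        = (x i * Rj + x j * Ri) - γ * (g θ i * g θ j + S) := by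
      rw [hRj, hRi, hSS]; ring
    rw [split]
    have B1 : |x i * Rj + x j * Ri| ≤ 2 * (u * (K * u ^ 3)) :=
      (abs_add_le _ _).trans (by linarith)
    have B2 : |γ * (g θ i * g θ j + S)| ≤
        γ * (L * u * (L * u) + K * u ^ 2 * (1 + u ^ (2 * n))) := by
      rw [abs_mul, abs_of_pos hγ0]
      gcongr
      exact (abs_add_le _ _).trans (add_le_add c1 hS)
    refine (abs_sub _ _).trans ((add_le_add B1 B2).trans ?_)
    have hr : u ^ (2 * (n + 1)) = u ^ 2 * u ^ (2 * n) := by ring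
    have hr0 : 0 ≤ u ^ (2 * n) := by positivity
    rw [remainderBound, hr]
    generalize u ^ (2 * n) = z at hr0
    have f : 0 ≤ 2 * K * (γ * (u ^ 2 + u ^ 4 + u ^ 2 * z) + γ ^ 2)
        + (L ^ 2 + K) * (u ^ 4 + γ * u ^ 4 + γ ^ 2) + L ^ 2 * (γ * (u ^ 2 * z)) := by positivity
    linarith

/-- The cubic Taylor coefficients multiply third moments, hence their values are irrelevant;
expanding to that order is what leaves a quartic remainder, of mean `O(γ ^ 2)`. -/
lemma isBigO_mean_expansion (hp : MemLp (fun ω => G ω θs) 3 P) (l : Fin d) :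
    (fun γ => ∑ i, H l i * ∫ θ, (θ - θs) i ∂(ν γ)
      + (1 / 2) * ∑ a, ∑ b, T a b l * ∫ θ, (θ - θs) a * (θ - θs) b ∂(ν γ))
      =O[𝓝[>] 0] fun γ : ℝ => γ ^ 2 := by
  obtain ⟨Q, hQ⟩ := t.third
  have hthird : ∀ i j k, (fun γ => ∫ θ, (θ - θs) i * (θ - θs) j * (θ - θs) k ∂(ν γ))
      =O[𝓝[>] 0] fun γ : ℝ => γ ^ 2 := fun i j k =>
    isBigO_pi.1 (isBigO_pi.1 (isBigO_pi.1 (h.isBigO_third_moment t hm hν hC hp) i) j) k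
  have hcub : (fun γ : ℝ => ∑ a, ∑ b, ∑ c, Q a b c l *
      ∫ θ, (θ - θs) a * (θ - θs) b * (θ - θs) c ∂(ν γ)) =O[𝓝[>] 0] fun γ : ℝ => γ ^ 2 :=
    IsBigO.fun_sum fun a _ => IsBigO.fun_sum fun b _ => IsBigO.fun_sum fun c _ =>
      (hthird a b c).const_mul_left _
  have hmain := hm.isBigO_of_remainderBound (K := K) (A := fun _ θ => g θ l)
    (M := fun _ θ => ∑ i, H l i * (θ - θs) i
      + (1 / 2) * ∑ a, ∑ b, T a b l * ((θ - θs) a * (θ - θs) b)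
      + ∑ a, ∑ b, ∑ c, Q a b c l * ((θ - θs) a * (θ - θs) b * (θ - θs) c))
    (v := fun γ => ∑ i, H l i * ∫ θ, (θ - θs) i ∂(ν γ)
      + (1 / 2) * ∑ a, ∑ b, T a b l * ∫ θ, (θ - θs) a * (θ - θs) b ∂(ν γ)
      + ∑ a, ∑ b, ∑ c, Q a b c l * ∫ θ, (θ - θs) a * (θ - θs) b * (θ - θs) c ∂(ν γ))
    ?_ ?_ ?_
  · refine (hmain.sub hcub).congr_left fun γ => ?_
    ring
  · filter_upwards [hν, hm.prob, hm.integrable_two, eventually_mem_nhdsWithin] with γ h1 h2 h3 h5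
    exact h.stationary_one (ne_of_gt h5) h1 h3 l
  · filter_upwards [hm.prob, hm.integrable_two, hm.integrable_four] with γ h1 h2 h4
    exact ((HasMean.sum fun i _ => (HasMean.of_integrable (integrable_coord h2 i)).const_mul _).add
      ((HasMean.sum fun a _ => HasMean.sum fun b _ =>
        (HasMean.of_integrable (integrable_coord_two h2 a b)).const_mul _).const_mul _)).add
      (HasMean.sum fun a _ => HasMean.sum fun b _ => HasMean.sum fun c _ =>
        (HasMean.of_integrable (integrable_coord_three h2 h4 a b c)).const_mul _)
  · filter_upwards [eventually_mem_nhdsWithin] with γ hγ θ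
    have hγ0 : 0 < γ := hγ
    rw [← sub_sub, ← sub_sub]
    refine (hQ θ l).trans (mul_le_mul_of_nonneg_left ?_ t.nonneg)
    rw [remainderBound, add_assoc]
    exact le_add_of_nonneg_right (by positivity)

end CocoerciveField
end Asymptotics
end SGD

/-! ### Taylor's formula, strong convexity and coordinates. -/

namespace SGD

section Calculus

variable {E : Type*} [NormedAddCommGroup E] [NormedSpace ℝ E]

/-- Taylor's formula with a bound on the remainder. -/
lemma norm_sub_taylor_le {W : Type*} [NormedAddCommGroup W] [NormedSpace ℝ W] [CompleteSpace W]
    {F : E → W} {n : ℕ} (hF : ContDiff ℝ (n + 1) F) {B : ℝ} (x y : E)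
    (hB : ∀ t ∈ Set.Icc (0 : ℝ) 1, ‖iteratedFDeriv ℝ (n + 1) F (x + t • y)‖ ≤ B) :
    ‖F (x + y) - ∑ k ∈ Finset.range (n + 1),
      ((k.factorial : ℝ)⁻¹ • iteratedFDeriv ℝ k F x fun _ => y)‖ ≤ B * ‖y‖ ^ (n + 1) := by
  rw [map_add_eq_sum_add_integral_iteratedFDeriv (fun t _ => hF.contDiffAt), add_sub_cancel_left,
    norm_smul]
  have hB0 : 0 ≤ B := (norm_nonneg _).trans (hB 0 ⟨le_rfl, zero_le_one⟩)
  -- The weight `(1 - t) ^ n` and the prefactor `1 / n!` are both simply bounded by one.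
  have h1 : ‖∫ t in (0 : ℝ)..1, (1 - t) ^ n • iteratedFDeriv ℝ (n + 1) F (x + t • y) fun _ => y‖ ≤
      B * ‖y‖ ^ (n + 1) * |1 - 0| := by
    refine intervalIntegral.norm_integral_le_of_norm_le_const fun t ht => ?_
    rw [Set.uIoc_of_le zero_le_one] at ht
    have ht1 : 0 ≤ 1 - t := by linarith [ht.2]
    have h2 : (1 - t) ^ n ≤ 1 := pow_le_one₀ ht1 (by linarith [ht.1])
    have h3 := (iteratedFDeriv ℝ (n + 1) F (x + t • y)).le_opNorm fun _ => y
    rw [Finset.prod_const, Finset.card_univ, Fintype.card_fin] at h3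
    have h4 := h3.trans (mul_le_mul_of_nonneg_right (hB t ⟨ht.1.le, ht.2⟩) (by positivity))
    rw [norm_smul, norm_pow, Real.norm_of_nonneg ht1]
    exact (mul_le_of_le_one_left (norm_nonneg _) h2).trans h4
  rw [sub_zero, abs_one, mul_one] at h1
  refine (mul_le_of_le_one_left (norm_nonneg _) ?_).trans h1
  rw [norm_inv, Real.norm_natCast]
  exact inv_le_one_of_one_le₀ (by exact_mod_cast Nat.one_le_iff_ne_zero.2 n.factorial_ne_zero)

end Calculus

section StrongConvexity

variable {E : Type*} [NormedAddCommGroup E] [InnerProductSpace ℝ E] {f : E → ℝ} {μ : ℝ}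

lemma hasDerivAt_comp_add_smul {F : E → ℝ} {θ : E} (hF : DifferentiableAt ℝ F θ) (v : E) :
    HasDerivAt (fun t : ℝ => F (θ + t • v)) (fderiv ℝ F θ v) 0 := by
  have h1 : HasDerivAt (fun t : ℝ => θ + t • v) v 0 := by
    simpa using ((hasDerivAt_id (0 : ℝ)).smul_const v).const_add θ
  have h2 : HasFDerivAt F (fderiv ℝ F θ) (θ + (0 : ℝ) • v) := by simpa using hF.hasFDerivAt
  exact h2.comp_hasDerivAt (0 : ℝ) h1

/-- The first-order condition for strong convexity. -/
lemma _root_.StrongConvexOn.fderiv_le (hf : StrongConvexOn Set.univ μ f)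
    (hd : Differentiable ℝ f) (θ η : E) :
    fderiv ℝ f θ (η - θ) ≤ f η - f θ - μ / 2 * ‖θ - η‖ ^ 2 := by
  have h1 := (hasDerivAt_comp_add_smul (hd θ) (η - θ)).tendsto_slope_zero_right
  have h2 : Tendsto (fun t : ℝ => f η - f θ - (1 - t) * (μ / 2 * ‖θ - η‖ ^ 2)) (𝓝[>] 0)
      (𝓝 (f η - f θ - (1 - 0) * (μ / 2 * ‖θ - η‖ ^ 2))) := by
    refine (Continuous.tendsto ?_ 0).mono_left nhdsWithin_le_nhds
    fun_prop
  rw [sub_zero, one_mul] at h2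
  -- Strong convexity at `θ + t • (η - θ)`, divided by `t`, bounds the difference quotient; then `t
  -- ↓ 0`.
  refine le_of_tendsto_of_tendsto h1 h2 ?_
  filter_upwards [Ioc_mem_nhdsGT (zero_lt_one' ℝ)] with t ht
  have h3 := hf.2 (Set.mem_univ θ) (Set.mem_univ η) (sub_nonneg.2 ht.2) ht.1.le
    (sub_add_cancel 1 t)
  have e : (1 - t) • θ + t • η = θ + t • (η - θ) := by
    rw [sub_smul, one_smul, smul_sub]; abel
  rw [e] at h3
  simp only [smul_eq_mul] at h3
  rw [zero_add, zero_smul, add_zero, smul_eq_mul, inv_mul_le_iff₀ ht.1]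
  nlinarith

lemma _root_.StrongConvexOn.le_fderiv_sub (hf : StrongConvexOn Set.univ μ f)
    (hd : Differentiable ℝ f) (θ η : E) :
    μ * ‖θ - η‖ ^ 2 ≤ fderiv ℝ f θ (θ - η) - fderiv ℝ f η (θ - η) := by
  have h1 := hf.fderiv_le hd θ η
  have h2 := hf.fderiv_le hd η θ
  rw [← neg_sub θ η, map_neg] at h1
  rw [norm_sub_rev η θ] at h2
  linarith

/-- Strong monotonicity of the derivative between `θ + t • v` and `θ`, divided by `t ^ 2`, in the
limit `t ↓ 0`. -/
lemma _root_.StrongConvexOn.le_fderiv_fderiv (hf : StrongConvexOn Set.univ μ f)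
    (hd : ContDiff ℝ 2 f) (θ v : E) : μ * ‖v‖ ^ 2 ≤ fderiv ℝ (fderiv ℝ f) θ v v := by
  have hd1 : Differentiable ℝ f := hd.differentiable (by norm_num)
  have hd2 : Differentiable ℝ (fderiv ℝ f) :=
    (hd.fderiv_right (m := 1) (by norm_num)).differentiable (by norm_num)
  have hd3 : DifferentiableAt ℝ (fun θ => fderiv ℝ f θ v) θ := (hd2 θ).clm_apply
    (differentiableAt_const v)
  have h1 := (hasDerivAt_comp_add_smul hd3 v).tendsto_slope_zero_right
  have e : fderiv ℝ (fun θ => fderiv ℝ f θ v) θ v = fderiv ℝ (fderiv ℝ f) θ v v := by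
    rw [fderiv_clm_apply (hd2 θ) (differentiableAt_const v)]
    simp
  rw [e] at h1
  refine ge_of_tendsto h1 ?_
  filter_upwards [eventually_mem_nhdsWithin] with t ht
  have ht0 : 0 < t := ht
  have h2 := hf.le_fderiv_sub hd1 (θ + t • v) θ
  rw [add_sub_cancel_left, norm_smul, mul_pow, Real.norm_eq_abs, sq_abs, map_smul, map_smul,
    smul_eq_mul, smul_eq_mul] at h2
  rw [zero_add, zero_smul, add_zero, smul_eq_mul, le_inv_mul_iff₀ ht0]
  refine le_of_mul_le_mul_left ?_ ht0
  linarith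

end StrongConvexity

section Coordinates

variable {d : ℕ}

lemma sum_smul_single (x : EuclideanSpace ℝ (Fin d)) :
    ∑ i, x i • EuclideanSpace.single i (1 : ℝ) = x := by
  simpa using (EuclideanSpace.basisFun (Fin d) ℝ).sum_repr x

section Multilinear

variable {W : Type*} [NormedAddCommGroup W] [NormedSpace ℝ W]

lemma clm_apply_eq_sum (A : EuclideanSpace ℝ (Fin d) →L[ℝ] W) (x : EuclideanSpace ℝ (Fin d)) :
    A x = ∑ i, x i • A (EuclideanSpace.single i 1) := by
  conv_lhs => rw [← sum_smul_single x]
  simp only [map_sum, map_smul]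

lemma clm_apply_two_eq_sum
    (A : EuclideanSpace ℝ (Fin d) →L[ℝ] EuclideanSpace ℝ (Fin d) →L[ℝ] W)
    (x : EuclideanSpace ℝ (Fin d)) :
    A x x = ∑ i, ∑ j, (x i * x j) • A (EuclideanSpace.single i 1) (EuclideanSpace.single j 1) := by
  rw [clm_apply_eq_sum A x, _root_.sum_apply]
  refine Finset.sum_congr rfl fun i _ => ?_
  rw [_root_.smul_apply, clm_apply_eq_sum, Finset.smul_sum]
  exact Finset.sum_congr rfl fun j _ => by rw [smul_smul]

lemma clm_apply_three_eq_sum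
    (A : EuclideanSpace ℝ (Fin d) →L[ℝ] EuclideanSpace ℝ (Fin d) →L[ℝ]
      EuclideanSpace ℝ (Fin d) →L[ℝ] W) (x : EuclideanSpace ℝ (Fin d)) :
    A x x x = ∑ i, ∑ j, ∑ k, (x i * x j * x k) •
      A (EuclideanSpace.single i 1) (EuclideanSpace.single j 1) (EuclideanSpace.single k 1) := by
  rw [clm_apply_two_eq_sum A x, _root_.sum_apply]
  refine Finset.sum_congr rfl fun i _ => ?_
  rw [_root_.sum_apply]
  refine Finset.sum_congr rfl fun j _ => ?_
  rw [_root_.smul_apply, clm_apply_eq_sum, Finset.smul_sum]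
  exact Finset.sum_congr rfl fun k _ => by rw [smul_smul]

end Multilinear

lemma gradient_apply (f : EuclideanSpace ℝ (Fin d) → ℝ) (θ : EuclideanSpace ℝ (Fin d))
    (l : Fin d) : ∇ f θ l = fderiv ℝ f θ (EuclideanSpace.single l 1) := by
  rw [← inner_gradient_left, EuclideanSpace.inner_single_right]
  simp

variable {f : EuclideanSpace ℝ (Fin d) → ℝ} {θs : EuclideanSpace ℝ (Fin d)} {μ : ℝ}

lemma hessian_apply (θ : EuclideanSpace ℝ (Fin d)) (i j : Fin d) :
    hessian f θ i j = fderiv ℝ (fderiv ℝ f) θ (EuclideanSpace.single i 1)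
      (EuclideanSpace.single j 1) := by
  simp [hessian, iteratedFDeriv_two_apply]

lemma hessian_symm (hf : ContDiff ℝ 2 f) (θ : EuclideanSpace ℝ (Fin d)) (i j : Fin d) :
    hessian f θ i j = hessian f θ j i := by
  rw [hessian_apply, hessian_apply]
  exact (hf.contDiffAt.isSymmSndFDerivAt (by simp)).eq _ _

lemma hessian_coercive (hconv : StrongConvexOn Set.univ μ f) (hf : ContDiff ℝ 2 f)
    (θ : EuclideanSpace ℝ (Fin d)) (v : Fin d → ℝ) :
    μ * ∑ i, v i ^ 2 ≤ ∑ i, ∑ j, v i * (hessian f θ i j * v j) := by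
  have h := hconv.le_fderiv_fderiv hf θ (WithLp.toLp 2 v)
  rw [clm_apply_two_eq_sum, EuclideanSpace.norm_sq_eq] at h
  simp only [Real.norm_eq_abs, sq_abs, smul_eq_mul] at h
  refine h.trans (le_of_eq ?_)
  refine Finset.sum_congr rfl fun i _ => Finset.sum_congr rfl fun j _ => ?_
  rw [hessian_apply]; ring

/-- The third derivatives of `f` at `θ`. -/
noncomputable def thirdDeriv (f : EuclideanSpace ℝ (Fin d) → ℝ) (θ : EuclideanSpace ℝ (Fin d))
    (i j l : Fin d) : ℝ :=
  iteratedFDeriv ℝ 3 f θ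
    ![EuclideanSpace.single i 1, EuclideanSpace.single j 1, EuclideanSpace.single l 1]

lemma thirdDeriv_eq (θ : EuclideanSpace ℝ (Fin d)) (i j l : Fin d) :
    thirdDeriv f θ i j l = fderiv ℝ (fderiv ℝ (fderiv ℝ f)) θ (EuclideanSpace.single i 1)
      (EuclideanSpace.single j 1) (EuclideanSpace.single l 1) := by
  rw [thirdDeriv, iteratedFDeriv_succ_apply_right, iteratedFDeriv_two_apply]
  rfl

/-- Taylor's formula for the coordinates of the gradient. -/
lemma abs_gradient_sub_taylor_le {n : ℕ} (hf : ContDiff ℝ (n + 1) (fderiv ℝ f)) {B : ℝ}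
    (hB : ∀ θ, ‖iteratedFDeriv ℝ (n + 2) f θ‖ ≤ B) (θ : EuclideanSpace ℝ (Fin d)) (l : Fin d) :
    |∇ f θ l - ∑ k ∈ Finset.range (n + 1), (k.factorial : ℝ)⁻¹ *
      (iteratedFDeriv ℝ k (fderiv ℝ f) θs fun _ => θ - θs) (EuclideanSpace.single l 1)| ≤
      B * ‖θ - θs‖ ^ (n + 1) := by
  have h := norm_sub_taylor_le hf (B := B) θs (θ - θs) fun t _ => by
    rw [norm_iteratedFDeriv_fderiv]; exact hB _
  rw [add_sub_cancel] at h
  have h2 := (ContinuousLinearMap.le_opNorm _ (EuclideanSpace.single l (1 : ℝ))).trans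
    (mul_le_mul_of_nonneg_right h (norm_nonneg _))
  rw [PiLp.norm_single, norm_one, mul_one] at h2
  simpa [gradient_apply] using h2

lemma iteratedFDeriv_three_apply {W : Type*} [NormedAddCommGroup W] [NormedSpace ℝ W]
    (F : EuclideanSpace ℝ (Fin d) → W) (θ x : EuclideanSpace ℝ (Fin d)) :
    (iteratedFDeriv ℝ 3 F θ fun _ => x) = fderiv ℝ (fderiv ℝ (fderiv ℝ F)) θ x x x := by
  rw [iteratedFDeriv_succ_apply_right, iteratedFDeriv_two_apply]
  rfl

lemma abs_apply_le_frobenius (M : Matrix (Fin d) (Fin d) ℝ) (i j : Fin d) : |M i j| ≤ ‖M‖ := by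
  rw [Matrix.frobenius_norm_def, ← Real.sqrt_eq_rpow]
  refine Real.abs_le_sqrt ?_
  simp only [Real.norm_eq_abs, Real.rpow_two, sq_abs]
  calc M i j ^ 2 ≤ ∑ j, M i j ^ 2 :=
        Finset.single_le_sum (f := fun j => M i j ^ 2) (fun _ _ => sq_nonneg _) (Finset.mem_univ j)
    _ ≤ _ := Finset.single_le_sum (f := fun i => ∑ j, M i j ^ 2)
        (fun _ _ => Finset.sum_nonneg fun _ _ => sq_nonneg _) (Finset.mem_univ i)

/-- Replaces the real growth exponent by an even integer, so that the covariance remainders match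
the moment of order `2 * (n + 1)`. -/
lemma one_add_rpow_le {u κ : ℝ} {n : ℕ} (hu : 0 ≤ u) (hκ : 0 ≤ κ) (hn : κ ≤ 2 * n) :
    1 + u ^ κ ≤ 2 * (1 + u ^ (2 * n)) := by
  have h0 : 0 ≤ u ^ (2 * n) := by positivity
  rcases le_total u 1 with h | h
  · have := Real.rpow_le_one hu h hκ
    linarith
  · have h1 := Real.rpow_le_rpow_of_exponent_le h hn
    have h2 : u ^ (2 * (n : ℝ)) = u ^ (2 * n) := by
      rw [← Real.rpow_natCast]; norm_num
    rw [h2] at h1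
    linarith

/-- The Taylor expansions of the gradient and of the noise covariance at the minimizer. -/
theorem exists_taylorData {L κ : ℝ} {C : EuclideanSpace ℝ (Fin d) → Matrix (Fin d) (Fin d) ℝ}
    {n : ℕ} (hmin : fderiv ℝ f θs = 0) (hμ : 0 < μ) (hconv : StrongConvexOn Set.univ μ f)
    (hf : SmoothObjective f L) (hκ : 0 ≤ κ) (hn : κ ≤ 2 * n) (hC : SmoothCov C θs κ) :
    ∃ K, TaylorData (∇ f) C θs (hessian f θs) (thirdDeriv f θs) μ K n := by
  obtain ⟨B₃, hB₃⟩ := hf.bounded 3 (by simp)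
  obtain ⟨B₄, hB₄⟩ := hf.bounded 4 (by simp)
  obtain ⟨B₅, hB₅⟩ := hf.bounded 5 (by simp)
  obtain ⟨M, hM0, hM⟩ := hC.growth
  have b₃ : 0 ≤ B₃ := (norm_nonneg _).trans (hB₃ θs)
  have b₄ : 0 ≤ B₄ := (norm_nonneg _).trans (hB₄ θs)
  have b₅ : 0 ≤ B₅ := (norm_nonneg _).trans (hB₅ θs)
  have hf2 : ContDiff ℝ 2 f := hf.contDiff.of_le (by norm_num)
  have hf' : ContDiff ℝ 4 (fderiv ℝ f) := hf.contDiff.fderiv_right (by norm_num)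
  have e1 : ∀ θ l, (fderiv ℝ (fderiv ℝ f) θs (θ - θs)) (EuclideanSpace.single l 1) =
      ∑ i, hessian f θs l i * (θ - θs) i := fun θ l => by
    rw [clm_apply_eq_sum (fderiv ℝ (fderiv ℝ f) θs), _root_.sum_apply]
    refine Finset.sum_congr rfl fun i _ => ?_
    rw [hessian_symm hf2, hessian_apply, _root_.smul_apply, smul_eq_mul, mul_comm]
  have e2 : ∀ θ l, (fderiv ℝ (fderiv ℝ (fderiv ℝ f)) θs (θ - θs) (θ - θs))
      (EuclideanSpace.single l 1) =
      ∑ a, ∑ b, thirdDeriv f θs a b l * ((θ - θs) a * (θ - θs) b) := fun θ l => by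
    rw [clm_apply_two_eq_sum, _root_.sum_apply]
    refine Finset.sum_congr rfl fun i _ => ?_
    rw [_root_.sum_apply]
    refine Finset.sum_congr rfl fun j _ => ?_
    rw [thirdDeriv_eq, _root_.smul_apply, smul_eq_mul, mul_comm]
  have seg : ∀ θ, ∀ t ∈ Set.Icc (0 : ℝ) 1,
      1 + ‖θs + t • (θ - θs) - θs‖ ^ κ ≤ 2 * (1 + ‖θ - θs‖ ^ (2 * n)) := fun θ t ht => by
    refine le_trans ?_ (one_add_rpow_le (norm_nonneg _) hκ hn)
    rw [add_sub_cancel_left, norm_smul, Real.norm_of_nonneg ht.1]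
    have := mul_le_of_le_one_left (norm_nonneg (θ - θs)) ht.2
    have := mul_nonneg ht.1 (norm_nonneg (θ - θs))
    gcongr
  have hcomplete : CompleteSpace (Matrix (Fin d) (Fin d) ℝ) := FiniteDimensional.complete ℝ _
  set K := B₃ + B₄ + B₅ + 2 * M with hK
  have taylorC1 : ∀ θ, ‖C θ - C θs‖ ≤ K * ‖θ - θs‖ * (1 + ‖θ - θs‖ ^ (2 * n)) := fun θ => by
    have h := norm_sub_taylor_le (n := 0) (F := C) (hC.contDiff.of_le (by norm_num))
      (B := 2 * M * (1 + ‖θ - θs‖ ^ (2 * n))) θs (θ - θs) fun t ht => by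
        refine (hM (0 + 1) (by simp) _).trans ?_
        have := mul_le_mul_of_nonneg_left (seg θ t ht) hM0
        linarith
    rw [add_sub_cancel] at h
    simp only [zero_add, Finset.range_one, Finset.sum_singleton, Nat.factorial_zero, Nat.cast_one,
      inv_one, one_smul, iteratedFDeriv_zero_apply, pow_one] at h
    refine h.trans ?_
    calc _ = 2 * M * (‖θ - θs‖ * (1 + ‖θ - θs‖ ^ (2 * n))) := by ring
      _ ≤ K * (‖θ - θs‖ * (1 + ‖θ - θs‖ ^ (2 * n))) := by gcongr; linarith
      _ = _ := by ring
  have taylorC2 : ∀ θ, ‖C θ - C θs - fderiv ℝ C θs (θ - θs)‖ ≤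
      K * ‖θ - θs‖ ^ 2 * (1 + ‖θ - θs‖ ^ (2 * n)) := fun θ => by
    have h := norm_sub_taylor_le (n := 1) (F := C) (hC.contDiff.of_le (by norm_num))
      (B := 2 * M * (1 + ‖θ - θs‖ ^ (2 * n))) θs (θ - θs) fun t ht => by
        refine (hM (1 + 1) (by simp) _).trans ?_
        have := mul_le_mul_of_nonneg_left (seg θ t ht) hM0
        linarith
    rw [add_sub_cancel] at h
    simp only [Finset.sum_range_succ, Finset.range_zero, Finset.sum_empty, zero_add,
      Nat.factorial_zero, Nat.factorial_one, Nat.cast_one, inv_one, one_smul,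
      iteratedFDeriv_zero_apply, iteratedFDeriv_one_apply, ← sub_sub] at h
    refine h.trans ?_
    calc _ = 2 * M * (‖θ - θs‖ ^ 2 * (1 + ‖θ - θs‖ ^ (2 * n))) := by ring
      _ ≤ K * (‖θ - θs‖ ^ 2 * (1 + ‖θ - θs‖ ^ (2 * n))) := by gcongr; linarith
      _ = _ := by ring
  refine ⟨K, hμ, hessian_coercive hconv hf2 θs, by positivity, fun θ l => ?_, fun θ l => ?_,
    ⟨fun a b c l => (6 : ℝ)⁻¹ * fderiv ℝ (fderiv ℝ (fderiv ℝ (fderiv ℝ f))) θs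
      (EuclideanSpace.single a 1) (EuclideanSpace.single b 1) (EuclideanSpace.single c 1)
      (EuclideanSpace.single l 1), fun θ l => ?_⟩, fun θ i j => ?_,
    ⟨fun i j k => fderiv ℝ C θs (EuclideanSpace.single k 1) i j, fun θ i j => ?_⟩⟩
  · have h := abs_gradient_sub_taylor_le (n := 1) (θs := θs) (hf'.of_le (by norm_num)) hB₃ θ l
    simp only [Finset.sum_range_succ, Finset.range_zero, Finset.sum_empty, zero_add,
      Nat.factorial_zero, Nat.factorial_one, Nat.cast_one, inv_one, one_mul,
      iteratedFDeriv_zero_apply, iteratedFDeriv_one_apply, hmin, _root_.zero_apply,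
      e1] at h
    refine h.trans (mul_le_mul_of_nonneg_right (by linarith) (by positivity))
  · have h := abs_gradient_sub_taylor_le (n := 2) (θs := θs) (hf'.of_le (by norm_num)) hB₄ θ l
    simp only [Finset.sum_range_succ, Finset.range_zero, Finset.sum_empty, zero_add,
      Nat.factorial_zero, Nat.factorial_one, Nat.factorial_two, Nat.cast_one, inv_one, one_mul,
      iteratedFDeriv_zero_apply, iteratedFDeriv_one_apply, iteratedFDeriv_two_apply, hmin,
      _root_.zero_apply, e1, e2, ← sub_sub, Nat.cast_ofNat] at h
    rw [← one_div] at h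
    refine h.trans (mul_le_mul_of_nonneg_right (by linarith) (by positivity))
  · have h := abs_gradient_sub_taylor_le (n := 3) (θs := θs) (hf'.of_le (by norm_num)) hB₅ θ l
    have e3 : (6 : ℝ)⁻¹ * (fderiv ℝ (fderiv ℝ (fderiv ℝ (fderiv ℝ f))) θs (θ - θs) (θ - θs)
        (θ - θs)) (EuclideanSpace.single l 1) = ∑ a, ∑ b, ∑ c,
        (6 : ℝ)⁻¹ * fderiv ℝ (fderiv ℝ (fderiv ℝ (fderiv ℝ f))) θs
          (EuclideanSpace.single a 1) (EuclideanSpace.single b 1) (EuclideanSpace.single c 1)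
          (EuclideanSpace.single l 1) * ((θ - θs) a * (θ - θs) b * (θ - θs) c) := by
      rw [clm_apply_three_eq_sum]
      simp only [_root_.sum_apply, _root_.smul_apply, smul_eq_mul,
        Finset.mul_sum]
      refine Finset.sum_congr rfl fun a _ => Finset.sum_congr rfl fun b _ =>
        Finset.sum_congr rfl fun c _ => ?_
      ring
    have f3 : ((3 : ℕ).factorial : ℝ) = 6 := by norm_num [Nat.factorial]
    simp only [Finset.sum_range_succ, Finset.range_zero, Finset.sum_empty, zero_add,
      Nat.factorial_zero, Nat.factorial_one, Nat.factorial_two, f3, Nat.cast_one, inv_one, one_mul,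
      iteratedFDeriv_zero_apply, iteratedFDeriv_one_apply, iteratedFDeriv_two_apply,
      iteratedFDeriv_three_apply, hmin,
      _root_.zero_apply, e1, e2, e3, ← sub_sub, Nat.cast_ofNat] at h
    rw [← one_div] at h
    refine h.trans (mul_le_mul_of_nonneg_right (by linarith) (by positivity))
  · exact (abs_apply_le_frobenius (C θ - C θs) i j).trans (taylorC1 θ)
  · have h := (abs_apply_le_frobenius (C θ - C θs - fderiv ℝ C θs (θ - θs)) i j).trans
      (taylorC2 θ)
    have e : fderiv ℝ C θs (θ - θs) =
        ∑ k, (θ - θs) k • fderiv ℝ C θs (EuclideanSpace.single k 1) := clm_apply_eq_sum _ _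
    rw [e] at h
    simp only [Matrix.sub_apply, Matrix.sum_apply, Matrix.smul_apply, smul_eq_mul] at h
    simpa only [mul_comm] using h

end Coordinates
end SGD

/-! ### From the random fields of the theorem to a jointly measurable field. -/

namespace SGD

section Noise

variable {Ω : Type*} [MeasurableSpace Ω] {P : Measure Ω} [IsProbabilityMeasure P] {d : ℕ}
  {f : EuclideanSpace ℝ (Fin d) → ℝ}
  {ε : ℕ → Ω → EuclideanSpace ℝ (Fin d) → EuclideanSpace ℝ (Fin d)}
  {θs : EuclideanSpace ℝ (Fin d)} {μ L : ℝ}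

lemma GradientNoise.measurable_one (hε : GradientNoise P ε) (θ : EuclideanSpace ℝ (Fin d)) :
    Measurable fun ω => ε 1 ω θ := by
  obtain ⟨ℱ, hℱ⟩ := hε.martingaleDifference
  exact (hℱ 0 θ).1.mono (ℱ.le 1) le_rfl

lemma GradientNoise.integrable_one (hε : GradientNoise P ε) (θ : EuclideanSpace ℝ (Fin d)) :
    Integrable (fun ω => ε 1 ω θ) P := by
  obtain ⟨ℱ, hℱ⟩ := hε.martingaleDifference
  exact (hℱ 0 θ).2.1

lemma GradientNoise.integral_one (hε : GradientNoise P ε) (θ : EuclideanSpace ℝ (Fin d)) :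
    ∫ ω, ε 1 ω θ ∂P = 0 := by
  obtain ⟨ℱ, hℱ⟩ := hε.martingaleDifference
  rw [← integral_condExp (ℱ.le 0), integral_congr_ae (hℱ 0 θ).2.2]
  simp

/-- The noisy gradient, set to zero outside a measurable event of full probability. -/
noncomputable def noisyGradient (f : EuclideanSpace ℝ (Fin d) → ℝ)
    (ε : ℕ → Ω → EuclideanSpace ℝ (Fin d) → EuclideanSpace ℝ (Fin d)) (N : Set Ω) (ω : Ω)
    (θ : EuclideanSpace ℝ (Fin d)) : EuclideanSpace ℝ (Fin d) :=
  N.indicator (fun ω => ∇ f θ + ε 1 ω θ) ω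

lemma noisyGradient_ae_eq {N : Set Ω} (hN : N ∈ ae P) :
    ∀ᵐ ω ∂P, ∀ θ, noisyGradient f ε N ω θ = ∇ f θ + ε 1 ω θ := by
  filter_upwards [hN] with ω hω θ using Set.indicator_of_mem hω _

lemma le_inner_gradient_sub (hconv : StrongConvexOn Set.univ μ f) (hf : Differentiable ℝ f)
    (θ η : EuclideanSpace ℝ (Fin d)) :
    μ * ‖θ - η‖ ^ 2 ≤ inner ℝ (∇ f θ - ∇ f η) (θ - η) := by
  rw [inner_sub_left, inner_gradient_left, inner_gradient_left]
  exact hconv.le_fderiv_sub hf θ η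

/-- The hypotheses give measurability only at each fixed point. After the field is set to zero off a
full event, a trivially co-coercive choice, every realization is Lipschitz in `θ`. Continuity in `θ`
and measurability in `ω` then give joint measurability. -/
theorem cocoerciveField_noisyGradient (hμ : 0 < μ) (hconv : StrongConvexOn Set.univ μ f)
    (hf : Differentiable ℝ f) (hmin : fderiv ℝ f θs = 0) (hL : 0 ≤ L) (hε : GradientNoise P ε)
    {N : Set Ω} (hN : N ∈ ae P) (hNm : MeasurableSet N)
    (hco : ∀ ω ∈ N, ∀ θ η : EuclideanSpace ℝ (Fin d),
      ‖(∇ f θ + ε 1 ω θ) - (∇ f η + ε 1 ω η)‖ ^ 2 ≤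
        L * inner ℝ ((∇ f θ + ε 1 ω θ) - (∇ f η + ε 1 ω η)) (θ - η))
    (hmem : MemLp (fun ω => ε 1 ω θs) 2 P) :
    CocoerciveField P (noisyGradient f ε N) (∇ f) L μ θs := by
  have hgs : ∇ f θs = 0 := by
    ext l
    rw [gradient_apply, hmin]
    simp
  have hcoc : ∀ ω θ η, ‖noisyGradient f ε N ω θ - noisyGradient f ε N ω η‖ ^ 2 ≤
      L * inner ℝ (noisyGradient f ε N ω θ - noisyGradient f ε N ω η) (θ - η) := by
    intro ω θ η
    by_cases hω : ω ∈ N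
    · simpa only [noisyGradient, Set.indicator_of_mem hω] using hco ω hω θ η
    · simp [noisyGradient, Set.indicator_of_notMem hω]
  refine ⟨?_, hcoc, hL, hμ, fun θ => ?_, le_inner_gradient_sub hconv hf, hgs, ?_⟩
  · have h1 : Measurable (Function.uncurry fun θ ω => noisyGradient f ε N ω θ) := by
      refine measurable_uncurry_of_continuous_of_measurable (fun ω => ?_) fun θ => ?_
      · have : LipschitzWith L.toNNReal (noisyGradient f ε N ω) := by
          refine LipschitzWith.of_dist_le_mul fun θ η => ?_
          rw [dist_eq_norm, dist_eq_norm, Real.coe_toNNReal _ hL]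
          exact norm_sub_le_of_cocoercive hL (hcoc ω) θ η
        exact this.continuous
      · exact (measurable_const.add (hε.measurable_one θ)).indicator hNm
    exact h1.comp measurable_swap
  · have h1 : ∫ ω, noisyGradient f ε N ω θ ∂P = ∫ ω, (∇ f θ + ε 1 ω θ) ∂P := by
      refine integral_congr_ae ?_
      filter_upwards [noisyGradient_ae_eq hN] with ω hω using hω θ
    rw [h1, integral_add (integrable_const _) (hε.integrable_one θ), hε.integral_one]
    simp
  · refine hmem.ae_eq ?_
    filter_upwards [noisyGradient_ae_eq (f := f) (ε := ε) hN] with ω hω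
    rw [hω θs, hgs, zero_add]

/-- The kernel at a fixed point sees only the law of the step, which a change on a null event does
not affect; the rest is Fubini for the product measure. -/
lemma isInvariantProb_kernel_iff {N : Set Ω} (hN : N ∈ ae P)
    (h : CocoerciveField P (noisyGradient f ε N) (∇ f) L μ θs) {γ : ℝ}
    {ν : Measure (EuclideanSpace ℝ (Fin d))} :
    IsInvariantProb (kernel P f ε γ) ν ↔
      IsProbabilityMeasure ν ∧ push P (noisyGradient f ε N) γ ν = ν := by
  refine and_congr_right fun hν => ?_
  have hk : ∀ θ, kernel P f ε γ θ = P.map fun ω => step (noisyGradient f ε N) γ ω θ := fun θ => by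
    refine Measure.map_congr ?_
    filter_upwards [noisyGradient_ae_eq (f := f) (ε := ε) hN] with ω hω
    rw [step, hω θ]
  have hp : ∀ A, MeasurableSet A →
      ∫⁻ θ, kernel P f ε γ θ A ∂ν = push P (noisyGradient f ε N) γ ν A := fun A hA => by
    rw [push, Measure.map_apply (h.measurable_step γ) hA,
      Measure.prod_apply (h.measurable_step γ hA)]
    refine lintegral_congr fun θ => ?_
    rw [hk, Measure.map_apply (h.measurable_step_right γ θ) hA]
    rfl
  constructor
  · intro hi
    ext A hA
    rw [← hp A hA, hi A hA]
  · intro hi A hA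
    rw [hp A hA, hi]

end Noise

/-! ### Inversion of the two linear equations and conclusion. -/

section Main

variable {d : ℕ} {Ω : Type*} [MeasurableSpace Ω] {P : Measure Ω} [IsProbabilityMeasure P]
  {G : Ω → EuclideanSpace ℝ (Fin d) → EuclideanSpace ℝ (Fin d)}
  {g : EuclideanSpace ℝ (Fin d) → EuclideanSpace ℝ (Fin d)} {L μ μ' : ℝ}
  {θs : EuclideanSpace ℝ (Fin d)}
  {C : EuclideanSpace ℝ (Fin d) → Matrix (Fin d) (Fin d) ℝ}
  {H : Matrix (Fin d) (Fin d) ℝ} {T : Fin d → Fin d → Fin d → ℝ} {K : ℝ} {n : ℕ}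
  {ν : ℝ → Measure (EuclideanSpace ℝ (Fin d))}

/-- The entries of the matrix `H X + X H`, as a linear map. -/
def lyapunovEntries (H : Matrix (Fin d) (Fin d) ℝ) :
    Matrix (Fin d) (Fin d) ℝ →ₗ[ℝ] (Fin d → Fin d → ℝ) where
  toFun X i j := lyapunov H X i j
  map_add' X Y := by funext i j; simp
  map_smul' c X := by funext i j; simp

namespace CocoerciveField

variable (h : CocoerciveField P G g L μ' θs) (t : TaylorData g C θs H T μ K n)
  (hsymm : ∀ i j, H i j = H j i)
  (hm : SmallMoments ν θs (2 * (n + 1)))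
  (hν : ∀ᶠ γ in 𝓝[>] 0, push P G γ (ν γ) = ν γ)
  (hC : ∀ θ i j, HasMean P (fun ω => (G ω θ i - g θ i) * (G ω θ j - g θ j)) (C θ i j))
  (hp : MemLp (fun ω => G ω θs) 3 P)
include h t hsymm hm hν hC hp

theorem isBigO_secondMoment_sub :
    (fun γ : ℝ => secondMoment (ν γ) θs - γ • Ring.inverse (lyapunov H) (C θs))
      =O[𝓝[>] 0] fun γ : ℝ => γ ^ 2 := by
  refine isBigO_of_injective_linearMap (lyapunovEntries H) (fun X Y hXY =>
    lyapunov_injective t.pos t.coercive hsymm (by ext i j; exact congrFun (congrFun hXY i) j)) ?_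
  rw [isBigO_pi]
  intro i
  rw [isBigO_pi]
  intro j
  refine (h.isBigO_second_moment t hm hν hC hp i j).congr_left fun γ => ?_
  have hinv : lyapunov H (Ring.inverse (lyapunov H) (C θs)) = C θs := by
    have := Ring.mul_inverse_cancel _ (isUnit_lyapunov t.pos t.coercive hsymm)
    exact LinearMap.congr_fun this (C θs)
  change _ = lyapunov H _ i j
  rw [map_sub, map_smul, hinv, lyapunov_apply, Matrix.sub_apply, Matrix.add_apply,
    Matrix.mul_apply, Matrix.mul_apply, Matrix.smul_apply, smul_eq_mul, add_comm]
  congr 2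
  refine Finset.sum_congr rfl fun a _ => ?_
  rw [hsymm j a, mul_comm]
  rfl

/-- After `H` is applied, the claim is `isBigO_mean_expansion` with the second moments replaced by
their leading term, at a cost `O(γ ^ 2)` by `isBigO_secondMoment_sub`. -/
theorem isBigO_mean_sub :
    (fun γ : ℝ => (∫ θ, θ ∂(ν γ)) - θs - γ • WithLp.toLp 2 (-(1 / 2 : ℝ) • (H⁻¹ *ᵥ
        (fun l => ∑ i, ∑ j, Ring.inverse (lyapunov H) (C θs) i j * T i j l))))
      =O[𝓝[>] 0] fun γ : ℝ => γ ^ 2 := by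
  set X := Ring.inverse (lyapunov H) (C θs) with hX
  have hdet : IsUnit H.det := (Matrix.isUnit_iff_isUnit_det H).1
    (isUnit_of_coercive t.pos t.coercive)
  have hsec := h.isBigO_secondMoment_sub t hsymm hm hν hC hp
  have hentry : ∀ i j, (fun γ : ℝ => ∫ θ, (θ - θs) i * (θ - θs) j ∂(ν γ) - γ * X i j)
      =O[𝓝[>] 0] fun γ : ℝ => γ ^ 2 := fun i j =>
    (IsBigO.of_bound 1 (Eventually.of_forall fun γ => by
      rw [one_mul]; exact abs_apply_le_frobenius (secondMoment (ν γ) θs - γ • X) i j)).trans hsec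
  let A : EuclideanSpace ℝ (Fin d) →ₗ[ℝ] (Fin d → ℝ) :=
    H.mulVecLin ∘ₗ (WithLp.linearEquiv 2 ℝ (Fin d → ℝ)).toLinearMap
  have hA : Function.Injective A :=
    (mulVecLin_injective t.pos t.coercive).comp (WithLp.linearEquiv 2 ℝ (Fin d → ℝ)).injective
  refine isBigO_of_injective_linearMap A hA ?_
  rw [isBigO_pi]
  intro l
  have hsum : (fun γ : ℝ => (1 / 2) * ∑ a, ∑ b, T a b l *
      (∫ θ, (θ - θs) a * (θ - θs) b ∂(ν γ) - γ * X a b)) =O[𝓝[>] 0] fun γ : ℝ => γ ^ 2 :=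
    (IsBigO.fun_sum fun a _ => IsBigO.fun_sum fun b _ =>
      (hentry a b).const_mul_left _).const_mul_left _
  refine ((h.isBigO_mean_expansion t hm hν hC hp l).sub hsum).congr' ?_ EventuallyEq.rfl
  filter_upwards [hm.prob, hm.integrable_two] with γ h1 h2
  have hi : Integrable (fun θ : EuclideanSpace ℝ (Fin d) => θ - θs) (ν γ) := by
    refine Integrable.mono' ((integrable_const 1).add h2) (by fun_prop) (ae_of_all _ fun θ => ?_)
    change ‖θ - θs‖ ≤ 1 + ‖θ - θs‖ ^ 2
    nlinarith [sq_nonneg (‖θ - θs‖ - 1)]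
  have hi' : Integrable (fun θ : EuclideanSpace ℝ (Fin d) => θ) (ν γ) :=
    (hi.add (integrable_const θs)).congr (ae_of_all _ fun θ => sub_add_cancel θ θs)
  have hmean : ∀ i, ((∫ θ, θ ∂(ν γ)) - θs) i = ∫ θ, (θ - θs) i ∂(ν γ) := fun i => by
    have e := (EuclideanSpace.proj (𝕜 := ℝ) i).integral_comp_comm hi
    rw [integral_sub hi' (integrable_const _)] at e
    simpa using e.symm
  have hHinv : H *ᵥ (H⁻¹ *ᵥ (fun l => ∑ i, ∑ j, X i j * T i j l)) =
      fun l => ∑ i, ∑ j, X i j * T i j l := by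
    rw [Matrix.mulVec_mulVec, Matrix.mul_nonsing_inv _ hdet, Matrix.one_mulVec]
  have hAv : ∀ v w : EuclideanSpace ℝ (Fin d), A (v - γ • w) l =
      (∑ i, H l i * v i) - γ * (H *ᵥ w.ofLp) l := fun v w => by
    rw [map_sub, map_smul]
    rfl
  rw [hAv]
  simp only [Matrix.mulVec_smul, hHinv, hmean, Pi.smul_apply, smul_eq_mul]
  simp only [mul_sub, Finset.sum_sub_distrib]
  have e : ∑ a, ∑ b, T a b l * (γ * X a b) = γ * ∑ i, ∑ j, X i j * T i j l := by
    simp only [Finset.mul_sum]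
    exact Finset.sum_congr rfl fun a _ => Finset.sum_congr rfl fun b _ => by ring
  rw [e]
  ring

end CocoerciveField

/-- A natural exponent between the growth of the covariance and the available moments. -/
lemma exists_nat_exponent {κ : ℝ} :
    ∃ n : ℕ, 1 ≤ n ∧ κ ≤ 2 * n ∧ ((2 * (n + 1) : ℕ) : ℝ) ≤ max 6 (2 * (κ + 1)) := by
  rcases le_total κ 2 with hκ | hκ
  · exact ⟨1, le_rfl, by simpa using hκ, le_max_of_le_left (by norm_num)⟩
  -- Rounding up gives `2 * (n + 1) < κ + 4`, which is at most `2 * (κ + 1)` because `κ ≥ 2` here;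
  -- smaller `κ` is covered by `n = 1` and the sixth moment.
  · refine ⟨⌈κ / 2⌉₊, ?_, ?_, le_max_of_le_right ?_⟩
    · exact Nat.one_le_ceil_iff.2 (by linarith)
    · have := Nat.le_ceil (κ / 2)
      linarith
    · have := Nat.ceil_lt_add_one (by linarith : 0 ≤ κ / 2)
      push_cast
      linarith

end Main
end SGD

theorem mainTheorem3 {Ω : Type*} [MeasurableSpace Ω] (P : Measure Ω) [IsProbabilityMeasure P]
    {d : ℕ} (f : EuclideanSpace ℝ (Fin d) → ℝ)
    (ε : ℕ → Ω → EuclideanSpace ℝ (Fin d) → EuclideanSpace ℝ (Fin d))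
    (θs : EuclideanSpace ℝ (Fin d)) (μ L κ : ℝ)
    (hθs : IsMinOn f Set.univ θs)
    (hμ : 0 < μ) (hconv : StrongConvexOn Set.univ μ f)
    (hsmooth : SGD.SmoothObjective f L)
    (hnoise : SGD.GradientNoise P ε)
    (hκ : 0 ≤ κ) (hcoc : SGD.CocoerciveNoise P f ε L θs (max 6 (2 * (κ + 1))))
    (hcov : SGD.SmoothCov (SGD.noiseCov P ε) θs κ) :
    -- the matrix `f''(θs)` and the operator `f''(θs) ⊗ I + I ⊗ f''(θs)` are invertible
    IsUnit (SGD.hessian f θs) ∧ IsUnit (SGD.lyapunov (SGD.hessian f θs)) ∧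
    ∃ π : ℝ → Measure (EuclideanSpace ℝ (Fin d)),
      -- for `0 < γ < 2 / L`, `π γ` is the unique invariant probability measure of `R_γ`
      (∀ γ : ℝ, 0 < γ → γ * L < 2 →
        SGD.IsInvariantProb (SGD.kernel P f ε γ) (π γ) ∧
        (∀ ν, SGD.IsInvariantProb (SGD.kernel P f ε γ) ν → ν = π γ) ∧
        MemLp (fun θ => θ) 2 (π γ)) ∧
      -- expansion of the stationary mean
      (fun γ : ℝ => (∫ θ, θ ∂(π γ)) - θs -
          γ • WithLp.toLp 2 (-(1 / 2 : ℝ) • ((SGD.hessian f θs)⁻¹ *ᵥ SGD.thirdApply f θs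
            (Ring.inverse (SGD.lyapunov (SGD.hessian f θs)) (SGD.noiseCov P ε θs)))))
        =O[𝓝[>] 0] (fun γ : ℝ => γ ^ 2) ∧
      -- expansion of the stationary second moment
      (fun γ : ℝ => SGD.secondMoment (π γ) θs -
          γ • Ring.inverse (SGD.lyapunov (SGD.hessian f θs)) (SGD.noiseCov P ε θs))
        =O[𝓝[>] 0] (fun γ : ℝ => γ ^ 2) := by
  have hf2 : ContDiff ℝ 2 f := hsmooth.contDiff.of_le (by norm_num)
  have hfd : Differentiable ℝ f := hf2.differentiable (by norm_num)
  have hmin : fderiv ℝ f θs = 0 := (hθs.isLocalMin univ_mem).fderiv_eq_zero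
  have hsymm := SGD.hessian_symm hf2 θs
  have hpos := SGD.hessian_coercive hconv hf2 θs
  refine ⟨SGD.isUnit_of_coercive hμ hpos, SGD.isUnit_lyapunov hμ hpos hsymm, ?_⟩
  obtain ⟨n, hn1, hnκ, hnp⟩ := SGD.exists_nat_exponent (κ := κ)
  obtain ⟨K, hT⟩ := SGD.exists_taylorData hmin hμ hconv hsmooth hκ hnκ hcov
  obtain ⟨N, hN, hNm, hco⟩ := (hcoc.cocoercive 0).exists_measurable_mem
  -- moments of the noise at the minimizer
  have hεp : MemLp (fun ω => ε 1 ω θs) (ENNReal.ofReal (max 6 (2 * (κ + 1)))) P := by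
    obtain ⟨τ, -, hτ⟩ := hcoc.moment
    exact ⟨(hnoise.measurable_one θs).aestronglyMeasurable,
      (hτ 0).trans_lt ENNReal.ofReal_lt_top⟩
  have hmem : ∀ k : ℕ, (k : ℝ) ≤ max 6 (2 * (κ + 1)) → MemLp (fun ω => ε 1 ω θs) k P :=
    fun k hk => hεp.mono_exponent (by
      rw [← ENNReal.ofReal_natCast]; exact ENNReal.ofReal_le_ofReal hk)
  have h := SGD.cocoerciveField_noisyGradient hμ hconv hfd hmin hsmooth.nonneg hnoise hN hNm hco
    (by simpa using hmem 2 (le_max_of_le_left (by norm_num)))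
  have hae := SGD.noisyGradient_ae_eq (f := f) (ε := ε) hN
  have hgmem : ∀ k : ℕ, (k : ℝ) ≤ max 6 (2 * (κ + 1)) →
      MemLp (fun ω => SGD.noisyGradient f ε N ω θs) k P := fun k hk => by
    refine (hmem k hk).ae_eq ?_
    filter_upwards [hae] with ω hω
    rw [hω θs, h.zero, zero_add]
  have hC : ∀ θ i j, SGD.HasMean P (fun ω => (SGD.noisyGradient f ε N ω θ i - ∇ f θ i) *
      (SGD.noisyGradient f ε N ω θ j - ∇ f θ j)) (SGD.noiseCov P ε θ i j) := by
    intro θ i j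
    have hl := (h.memLp_field h.memLp θ).sub (memLp_const (∇ f θ))
    have hli : ∀ i, MemLp (fun ω => SGD.noisyGradient f ε N ω θ i - ∇ f θ i) 2 P := fun i =>
      hl.of_le ((continuous_apply i |>.comp (PiLp.continuous_ofLp 2 _)).comp_aestronglyMeasurable
        hl.aestronglyMeasurable) (ae_of_all _ fun ω => PiLp.norm_apply_le
          (SGD.noisyGradient f ε N ω θ - ∇ f θ) i)
    refine ⟨(hli i).integrable_mul (hli j), integral_congr_ae ?_⟩
    filter_upwards [hae] with ω hω
    rw [hω θ]
    simp
  -- The family must be defined for every real `γ`; outside the admissible range it takes the zero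
  -- measure as a default.
  have hex : ∀ γ : ℝ, ∃ ν : Measure (EuclideanSpace ℝ (Fin d)), 0 < γ → γ * L < 2 →
      IsProbabilityMeasure ν ∧ SGD.push P (SGD.noisyGradient f ε N) γ ν = ν := by
    intro γ
    by_cases hγ : 0 < γ ∧ γ * L < 2
    · obtain ⟨ν, hν⟩ := h.exists_invariant hγ.1 hγ.2
      exact ⟨ν, fun _ _ => hν⟩
    · exact ⟨0, fun h1 h2 => absurd ⟨h1, h2⟩ hγ⟩
  choose π hπ using hex
  have hm := h.smallMoments hn1 (hgmem _ hnp) hπ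
  have hν : ∀ᶠ γ in 𝓝[>] 0, SGD.push P (SGD.noisyGradient f ε N) γ (π γ) = π γ := by
    have hlim : Tendsto (fun γ : ℝ => γ * L) (𝓝 0) (𝓝 (0 * L)) := tendsto_id.mul_const L
    rw [zero_mul] at hlim
    filter_upwards [eventually_mem_nhdsWithin, eventually_nhdsWithin_of_eventually_nhds
      (hlim.eventually_lt_const two_pos)] with γ h1 h2 using (hπ γ h1 h2).2
  have hp3 : MemLp (fun ω => SGD.noisyGradient f ε N ω θs) 3 P := by
    simpa using hgmem 3 (le_max_of_le_left (by norm_num))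
  refine ⟨π, fun γ hγ hγL => ?_, h.isBigO_mean_sub hT hsymm hm hν hC hp3,
    h.isBigO_secondMoment_sub hT hsymm hm hν hC hp3⟩
  obtain ⟨h1, h2⟩ := hπ γ hγ hγL
  refine ⟨(SGD.isInvariantProb_kernel_iff hN h).2 ⟨h1, h2⟩, fun ν hν' => ?_,
    h.memLp_two_of_invariant hγ hγL h2⟩
  obtain ⟨h3, h4⟩ := (SGD.isInvariantProb_kernel_iff hN h).1 hν'
  exact h.invariant_unique hγ hγL h4 h2
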